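/- Let $n\ge 3$. Let $\Gamma\subset\mathbb{R}^n$ be an open, convex, connected, symmetric cone with vertex at $0$ such that $\{\lambda:\lambda_i>0\ \forall i\}\subseteq\Gamma\subseteq\{\lambda:\lambda_1+\dots+\lambda_n>0\}$, and let $f\in C^\infty(\Gamma)\cap C^0(\overline\Gamma)$ be concave, homogeneous of degree one and symmetric in the $\lambda_i$, with $f>0$ in $\Gamma$, $f=0$ on $\partial\Gamma$ and $\partial f/\partial\lambda_i>0$ in $\Gamma$ for all $i$. Let $\mu_\Gamma^+$ be the number with $(-\mu_\Gamma^+,1,\dots,1)\in\partial\Gamma$ and assume $\mu_\Gamma^+>1$. For $\tau\in(0,1]$ and $\lambda\in\mathbb{R}^n$ put $\lambda^\tau=\tau\lambda+(1-\tau)(\lambda_1+\dots+\lambda_n)(1,\dots,1)$, $f^\tau(\lambda)=\frac{1}{\tau+n(1-\tau)}f(\lambda^\tau)$ and $\Gamma^\tau=\{\lambda:\lambda^\tau\in\Gamma\}$. For a Riemannian metric $g$ let $A_g=\frac{1}{n-2}\big(\mathrm{Ric}_g-\frac{R_g}{2(n-1)}g\big)$ be its Schouten tensor, and let $\lambda(T)$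 be the vector of eigenvalues of a $(1,1)$-tensor $T$. For all $K,L,R\in\mathbb{R}$ there is a constant $C$, depending only on $n,f,\Gamma,K,L$ and $R$, with the following property. Let $(M,g_0)$ be a smooth Riemannian manifold of dimension $n$, possibly with non-empty boundary, let $\tau\in(0,1]$, let $\psi\in C^\infty(M)$ be positive, and let $B_r$ be a geodesic ball of radius $r\in(0,R]$ contained in the interior of $M$. (More generally, $B_r$ may be any open metric ball $\{x: d_{g_0}(p,x)<r\}$ which is contained in the interior of $M$ and in a coordinate chart, and whose concentric closed balls of radius less than $r$ are compact.) Suppose that, in some smooth coordinate chart whose domain contains $B_r$, the coefficients $(g_0)_{ij}$, their derivatives up to order three and the inverse coefficients $g_0^{ij}$ are bounded by $K$ on $B_r$, and that $\psi\le L$ and $|\nabla_{g_0}\psi|_{g_0}\le L$ on $B_r$. If $u\in C^3(B_r)$ is bounded from above and $g_u=e^{2u}g_0$ satisfies $$f^\tau\big(\lambda(-g_u^{-1}A_{g_u})\big)=\psi,\qquad \lambda(-g_u^{-1}A_{g_u})\in\Gamma^\tau\qquad\text{in }B_r,$$ then $$|\nabla_{g_0}u|_{g_0}(x)\le C\big(r^{-1}+e^{\sup_{B_r}u}\big)\qquad\text{for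 all }x\in B_{r/2},$$ where $B_{r/2}$ is the concentric ball of radius $r/2$. In particular, $C$ does not depend on $\tau$, on $\inf_{B_r}\psi$ or on a lower bound for $u$. -/

import Mathlib

open Set Manifold Bundle
open scoped ContDiff

universe u v

noncomputable section

/-! ### The cone and the defining function -/

/-- The standing assumptions on the pair `(f, Γ)`. Only the values of `f` on the closure of `Γ`
matter. -/
structure IsAdmissiblePair {n : ℕ} (f : (Fin n → ℝ) → ℝ) (Γ : Set (Fin n → ℝ)) : Prop where
  isOpen : IsOpen Γ
  convex : Convex ℝ Γ
  isConnected : IsConnected Γ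
  /-- `Γ` is symmetric: invariant under permutations of the coordinates. -/
  symm : ∀ (σ : Equiv.Perm (Fin n)), ∀ lam ∈ Γ, lam ∘ σ ∈ Γ
  /-- `Γ` is a cone with vertex at the origin. -/
  cone : ∀ t : ℝ, 0 < t → ∀ lam ∈ Γ, t • lam ∈ Γ
  /-- `Γ` contains the positive cone `Γ_n^+`. -/
  positive_subset : {lam : Fin n → ℝ | ∀ i, 0 < lam i} ⊆ Γ
  /-- `Γ` is contained in the half-space `Γ_1^+`. -/
  subset_half : Γ ⊆ {lam : Fin n → ℝ | 0 < ∑ i, lam i}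
  f_smooth : ContDiffOn ℝ ∞ f Γ
  f_continuous : ContinuousOn f (closure Γ)
  f_concave : ConcaveOn ℝ Γ f
  f_homogeneous : ∀ t : ℝ, 0 < t → ∀ lam ∈ Γ, f (t • lam) = t * f lam
  f_symm : ∀ (σ : Equiv.Perm (Fin n)), ∀ lam ∈ Γ, f (lam ∘ σ) = f lam
  f_pos : ∀ lam ∈ Γ, 0 < f lam
  f_boundary : ∀ lam ∈ frontier Γ, f lam = 0
  /-- `∂f/∂λ_i > 0` in `Γ` for every `i`. -/
  f_monotone : ∀ lam ∈ Γ, ∀ i : Fin n, 0 < fderiv ℝ f lam (Pi.single i 1)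

/-- `μ` is the number `μ_Γ^+`, that is `(-μ, 1, …, 1) ∈ ∂Γ`. (`Γ` being symmetric, the position of
the entry `-μ` does not matter.) -/
def IsMuPlus {n : ℕ} (Γ : Set (Fin n → ℝ)) (μ : ℝ) : Prop :=
  ∀ i : Fin n, Function.update (fun _ : Fin n => (1 : ℝ)) i (-μ) ∈ frontier Γ

/-- `λ^τ = τ λ + (1 - τ) σ₁(λ) e` with `e = (1, …, 1)`. -/
def tauVec {n : ℕ} (τ : ℝ) (lam : Fin n → ℝ) : Fin n → ℝ :=
  fun i => τ * lam i + (1 - τ) * ∑ j, lam j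

/-- `f^τ(λ) = f(λ^τ) / (τ + n (1 - τ))`. -/
def fTau {n : ℕ} (τ : ℝ) (f : (Fin n → ℝ) → ℝ) (lam : Fin n → ℝ) : ℝ :=
  f (tauVec τ lam) / (τ + n * (1 - τ))

/-- `Γ^τ = {λ : λ^τ ∈ Γ}`. -/
def coneTau {n : ℕ} (τ : ℝ) (Γ : Set (Fin n → ℝ)) : Set (Fin n → ℝ) :=
  {lam | tauVec τ lam ∈ Γ}

/-- `lam` is the vector of eigenvalues of `T`, listed with multiplicity (in some order). -/
def IsEigenvalueVector {n : ℕ} (T : Matrix (Fin n) (Fin n) ℝ) (lam : Fin n → ℝ) : Prop :=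
  T.charpoly = ∏ i, (Polynomial.X - Polynomial.C (lam i))

/-! ### Curvature in local coordinates

Here `G` is the matrix `(g_{ij})` of a metric as a function of the coordinates
`y ∈ ℝⁿ`. -/

/-- The partial derivative `∂_i h` at `y`. -/
def partialD {n : ℕ} (i : Fin n) (h : EuclideanSpace ℝ (Fin n) → ℝ)
    (y : EuclideanSpace ℝ (Fin n)) : ℝ :=
  fderiv ℝ h y (EuclideanSpace.single i 1)

/-- The Christoffel symbols
`Γ^k_{ij} = ½ g^{kl} (∂_i g_{jl} + ∂_j g_{il} - ∂_l g_{ij})`. -/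
def christoffel {n : ℕ} (G : EuclideanSpace ℝ (Fin n) → Matrix (Fin n) (Fin n) ℝ)
    (k i j : Fin n) (y : EuclideanSpace ℝ (Fin n)) : ℝ :=
  (1 / 2) * ∑ l, (G y)⁻¹ k l *
    (partialD i (fun z => G z j l) y + partialD j (fun z => G z i l) y
      - partialD l (fun z => G z i j) y)

/-- The Ricci tensor
`R_{ij} = ∂_k Γ^k_{ij} - ∂_j Γ^k_{ik} + Γ^k_{kl} Γ^l_{ij} - Γ^k_{jl} Γ^l_{ik}`
(positive on round spheres). -/
def ricci {n : ℕ} (G : EuclideanSpace ℝ (Fin n) → Matrix (Fin n) (Fin n) ℝ)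
    (y : EuclideanSpace ℝ (Fin n)) : Matrix (Fin n) (Fin n) ℝ :=
  Matrix.of fun i j =>
    ∑ k, (partialD k (christoffel G k i j) y - partialD j (christoffel G k i k) y)
      + ∑ k, ∑ l, (christoffel G k k l y * christoffel G l i j y
          - christoffel G k j l y * christoffel G l i k y)

/-- The scalar curvature `R = g^{ij} R_{ij}`. -/
def scalarCurvature {n : ℕ} (G : EuclideanSpace ℝ (Fin n) → Matrix (Fin n) (Fin n) ℝ)
    (y : EuclideanSpace ℝ (Fin n)) : ℝ :=
  ∑ i, ∑ j, (G y)⁻¹ i j * ricci G y i j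

/-- The `(0,2)`-Schouten tensor `A = (Ric - R / (2 (n - 1)) g) / (n - 2)`. -/
def schouten {n : ℕ} (G : EuclideanSpace ℝ (Fin n) → Matrix (Fin n) (Fin n) ℝ)
    (y : EuclideanSpace ℝ (Fin n)) : Matrix (Fin n) (Fin n) ℝ :=
  (1 / ((n : ℝ) - 2)) •
    (ricci G y - (scalarCurvature G y / (2 * ((n : ℝ) - 1))) • G y)

/-! ### Riemannian manifolds, possibly with boundary -/

section Manifold

variable {n : ℕ} {H : Type u} [TopologicalSpace H]
  (I : ModelWithCorners ℝ (EuclideanSpace ℝ (Fin n)) H)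
  {M : Type v} [TopologicalSpace M] [ChartedSpace H M]

/-- `φ` is a system of smooth local coordinates with values in an open subset of `ℝⁿ`. -/
structure IsCoordinateChart (φ : OpenPartialHomeomorph M (EuclideanSpace ℝ (Fin n))) : Prop where
  smooth : ContMDiffOn I 𝓘(ℝ, EuclideanSpace ℝ (Fin n)) ∞ φ φ.source
  smooth_symm : ContMDiffOn 𝓘(ℝ, EuclideanSpace ℝ (Fin n)) I ∞ φ.symm φ.target

/-- The coordinate vector field `∂_i` of `φ` at the point with coordinates `y`. -/
def coordVec (φ : OpenPartialHomeomorph M (EuclideanSpace ℝ (Fin n)))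
    (y : EuclideanSpace ℝ (Fin n)) (i : Fin n) : TangentSpace I (φ.symm y) :=
  mfderiv 𝓘(ℝ, EuclideanSpace ℝ (Fin n)) I φ.symm y
    (EuclideanSpace.single i 1 : EuclideanSpace ℝ (Fin n))

/-- The derivative `dh(v)` of the function `h` at `x` in the direction of the tangent vector `v`. -/
def dirDeriv (h : M → ℝ) (x : M) (v : TangentSpace I x) : ℝ :=
  mfderiv I 𝓘(ℝ, ℝ) h x v

variable [RiemannianBundle (fun x : M => TangentSpace I x)]

/-- The open ball of radius `r` about `p` for the Riemannian distance. -/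
def riemannianBall (p : M) (r : ℝ) : Set M :=
  {x | riemannianEDist I p x < ENNReal.ofReal r}

/-- The ball `B_r(p)` of radius `r > 0` lies in the interior of the manifold and all closed balls
of smaller radius about `p` are compact, so that `B_r(p)` reaches neither the boundary nor an end
of the manifold. Every geodesic ball (the diffeomorphic image under `exp_p` of a ball of
radius `r` in the tangent space) contained in the interior is of this kind. -/
structure IsInteriorBall (p : M) (r : ℝ) : Prop where
  radius_pos : 0 < r
  subset_interior : riemannianBall I p r ⊆ I.interior M
  compact_closedBall : ∀ s : ℝ, s < r →
    IsCompact {x : M | riemannianEDist I p x ≤ ENNReal.ofReal s}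

/-- The matrix `g_{ij} = g(∂_i, ∂_j)` of the Riemannian metric in the coordinates `φ`. -/
def metricCoeff (φ : OpenPartialHomeomorph M (EuclideanSpace ℝ (Fin n)))
    (y : EuclideanSpace ℝ (Fin n)) : Matrix (Fin n) (Fin n) ℝ :=
  Matrix.of fun i j => inner ℝ (coordVec I φ y i) (coordVec I φ y j)

/-- The matrix of the conformal metric `g_u = e^{2u} g` in the coordinates `φ`. -/
def conformalCoeff (φ : OpenPartialHomeomorph M (EuclideanSpace ℝ (Fin n))) (w : M → ℝ)
    (y : EuclideanSpace ℝ (Fin n)) : Matrix (Fin n) (Fin n) ℝ :=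
  Real.exp (2 * w (φ.symm y)) • metricCoeff I φ y

/-- The matrix, in the coordinates `φ`, of the `(1,1)`-tensor `- g_u⁻¹ A_{g_u}` at the point `x`.
Changing `φ` conjugates this matrix, so its eigenvalues do not depend on `φ`. -/
def negSchoutenEndo (φ : OpenPartialHomeomorph M (EuclideanSpace ℝ (Fin n))) (w : M → ℝ)
    (x : M) : Matrix (Fin n) (Fin n) ℝ :=
  -((conformalCoeff I φ w (φ x))⁻¹ * schouten (conformalCoeff I φ w) (φ x))

/-- The metric is bounded by `K` in `C³` on `B` in the coordinates `φ`: the coefficients `g_{ij}`,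
their derivatives up to order three and the coefficients `g^{ij}` of the inverse matrix are bounded
by `K`. -/
def MetricC3Bound (φ : OpenPartialHomeomorph M (EuclideanSpace ℝ (Fin n))) (B : Set M)
    (K : ℝ) : Prop :=
  ∀ x ∈ B, ∀ i j : Fin n,
    |(metricCoeff I φ (φ x))⁻¹ i j| ≤ K ∧
      ∀ k : ℕ, k ≤ 3 → ‖iteratedFDeriv ℝ k (fun y => metricCoeff I φ y i j) (φ x)‖ ≤ K

/-- `|∇h|_g (x)`: the length of the gradient of `h` at `x`, which is the norm of the differential
`dh`, that is the largest value of `|dh(v)|` over tangent vectors of Riemannian length at most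
one. -/
def gradNorm (h : M → ℝ) (x : M) : ℝ :=
  sSup {t : ℝ | ∃ v : TangentSpace I x, ‖v‖ ≤ 1 ∧ t = |dirDeriv I h x v|}

/-- `w` solves `f^τ(λ(-g_w⁻¹ A_{g_w})) = ψ`, `λ(-g_w⁻¹ A_{g_w}) ∈ Γ^τ` on `B`, where `g_w = e^{2w} g`
and `B` lies in the domain of the coordinates `φ`. -/
def SolvesConformalEquation (φ : OpenPartialHomeomorph M (EuclideanSpace ℝ (Fin n)))
    (f : (Fin n → ℝ) → ℝ) (Γ : Set (Fin n → ℝ)) (τ : ℝ) (ψ w : M → ℝ) (B : Set M) : Prop :=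
  ∀ x ∈ B, ∃ lam : Fin n → ℝ, IsEigenvalueVector (negSchoutenEndo I φ w x) lam ∧
    lam ∈ coneTau τ Γ ∧ fTau τ f lam = ψ x

end Manifold

end

/-! ### The pair `(f^τ, Γ^τ)` -/

section ConeTau

variable {n : ℕ} {f : (Fin n → ℝ) → ℝ} {Γ : Set (Fin n → ℝ)}

/-! The argument is Bernstein's, run on coefficient matrices in a coordinate ball of radius
comparable to `r`. The conformal change of the Schouten tensor (`IsMetricOn.schouten_conformal`)
turns the equation into f^τ(λ(g⁻¹W)) = ψ e^{2u} with W = ∇²u - du ⊗ du + ½|du|² g - A. A C³ bound on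
g bounds the Christoffel symbols and A in C¹ (`exists_curvature_bound`), so a single constant
governs all coefficients (`IsLocalSolution`).

Let ρ = s² - |y - y₀|² and consider an interior maximum of ρ²|Du|², with p = |Du| and q = s/ρ there.
The first order condition gives |D²u Du| ≤ 2qp²; the second order condition bounds |D²u ξ|² + D³u(ξ,
ξ, Du) by 14 q²p²|ξ|² for every ξ (`max_conditions`). Let α be the gradient of f^τ at the eigenvalue
vector λ, t = Σ α_a, and T_a a g-orthonormal eigenframe of W. Taking ξ = T_a, weighting by α_a and
eliminating D³u through the equation differentiated in the direction Du yields, with E = e^{sup u},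
X = Σ α_a|D²u T_a| and Z = Σ α_a|D²u T_a|², Z ≤ C(q²p² + p³ + qp³ + E²p) t + C p X. The derivative
of e^{2u} contributes 2ψe^{2u}|Du|² with the favourable sign, so no lower bound on ψ or u is needed.

In the other direction, μ > 1 puts (-1, 1, …, 1) in the open cone, so the α-weighted trace of ½|du|²
g - du ⊗ du is at least δ|du|² t (`IsAdmissiblePair.exists_margin`, `margin_le`). Since Σ α_a λ_a =
ψe^{2u} is at most of order E², the Hessian has to compensate: c p² t ≤ C(p + E²) t + C X. With X² ≤
tZ the two inequalities force p ≤ Λ(1 + q + E) (`bound_of_inequalities`).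

No ellipticity ratio enters: every term is normalized by t, and t ≥ f(1, …, 1). Uniformity in τ
comes from Γ ⊆ Γ^τ and f^τ(1, …, 1) = f(1, …, 1). Eigenvalues are never differentiated: by concavity
and Schur's theorem, Σ α_a W(S_a, S_a) along a moving orthonormal frame S touches ψe^{2u} from
above, which determines the first derivative (`IsAdmissiblePair.deriv_equation`). -/

theorem IsAdmissiblePair.add_mem (h : IsAdmissiblePair f Γ) {x y : Fin n → ℝ} (hx : x ∈ Γ)
    (hy : y ∈ Γ) : x + y ∈ Γ := by
  have h1 := h.convex hx hy (a := 1 / 2) (b := 1 / 2) (by norm_num) (by norm_num) (by norm_num)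
  have h2 := h.cone 2 two_pos _ h1
  have h3 : (2 : ℝ) • ((1 / 2 : ℝ) • x + (1 / 2 : ℝ) • y) = x + y := by
    ext i; simp; ring
  rwa [h3] at h2

/-- A concave function that is homogeneous of degree one is superadditive. -/
theorem IsAdmissiblePair.superadditive (h : IsAdmissiblePair f Γ) {x y : Fin n → ℝ} (hx : x ∈ Γ)
    (hy : y ∈ Γ) : f x + f y ≤ f (x + y) := by
  have h1 := h.f_concave.2 hx hy (show (0 : ℝ) ≤ 1 / 2 by norm_num)
    (show (0 : ℝ) ≤ 1 / 2 by norm_num) (by norm_num)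
  have h0 := h.convex hx hy (a := 1 / 2) (b := 1 / 2) (by norm_num) (by norm_num) (by norm_num)
  have h2 := h.f_homogeneous 2 two_pos _ h0
  have h3 : (2 : ℝ) • ((1 / 2 : ℝ) • x + (1 / 2 : ℝ) • y) = x + y := by
    ext i; simp; ring
  rw [h3] at h2
  simp only [smul_eq_mul] at h1
  linarith

theorem IsAdmissiblePair.differentiableAt (h : IsAdmissiblePair f Γ) {x : Fin n → ℝ}
    (hx : x ∈ Γ) : DifferentiableAt ℝ f x :=
  (h.f_smooth.contDiffAt (h.isOpen.mem_nhds hx)).differentiableAt (by simp)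

/-- Superadditivity and homogeneity give f(x) + t f(y) ≤ f(x + t y) for t > 0; divide by t and let t
→ 0⁺. Homogeneity makes the tangent hyperplane pass through the origin, hence no affine term. -/
theorem IsAdmissiblePair.le_fderiv (h : IsAdmissiblePair f Γ) {x y : Fin n → ℝ}
    (hx : x ∈ Γ) (hy : y ∈ Γ) : f y ≤ fderiv ℝ f x y := by
  have hd : HasDerivAt (fun t : ℝ => f (x + t • y)) (fderiv ℝ f x y) 0 := by
    have h1 : HasFDerivAt f (fderiv ℝ f x) (x + (0 : ℝ) • y) := by
      simpa using (h.differentiableAt hx).hasFDerivAt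
    have h2 : HasDerivAt (fun t : ℝ => x + t • y) y 0 := by
      simpa using ((hasDerivAt_id (0 : ℝ)).smul_const y).const_add x
    exact h1.comp_hasDerivAt (0 : ℝ) h2
  have h3 := hd.tendsto_slope_zero_right
  refine ge_of_tendsto h3 ?_
  filter_upwards [self_mem_nhdsWithin] with t ht
  have ht' : (0 : ℝ) < t := ht
  have h4 := h.superadditive hx (h.cone t ht' y hy)
  rw [h.f_homogeneous t ht' y hy] at h4
  simp only [zero_add, zero_smul, add_zero, smul_eq_mul]
  rw [← div_eq_inv_mul, le_div_iff₀ ht']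
  linarith

/-- Euler's relation: both sides are the derivative of f((1 + t)x) at t = 0. -/
theorem IsAdmissiblePair.fderiv_self (h : IsAdmissiblePair f Γ) {x : Fin n → ℝ}
    (hx : x ∈ Γ) : fderiv ℝ f x x = f x := by
  have hd : HasDerivAt (fun t : ℝ => f ((1 + t) • x)) (fderiv ℝ f x x) 0 := by
    have h1 : HasFDerivAt f (fderiv ℝ f x) ((1 + (0 : ℝ)) • x) := by
      simpa using (h.differentiableAt hx).hasFDerivAt
    have h2 : HasDerivAt (fun t : ℝ => (1 + t) • x) x 0 := by
      simpa using ((hasDerivAt_id (0 : ℝ)).const_add 1).smul_const x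
    exact h1.comp_hasDerivAt (0 : ℝ) h2
  have hd2 : HasDerivAt (fun t : ℝ => (1 + t) * f x) (f x) 0 := by
    simpa using ((hasDerivAt_id (0 : ℝ)).const_add 1).mul_const (f x)
  refine hd.unique (hd2.congr_of_eventuallyEq ?_)
  filter_upwards [Ioi_mem_nhds (show (-1 : ℝ) < 0 by norm_num)] with t ht
  exact h.f_homogeneous _ (by simp only [mem_Ioi] at ht; linarith) x hx

theorem tauVec_comp_perm (τ : ℝ) (lam : Fin n → ℝ) (σ : Equiv.Perm (Fin n)) :
    tauVec τ (lam ∘ σ) = tauVec τ lam ∘ σ := by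
  ext i
  simp [tauVec, Equiv.sum_comp σ lam]

theorem tauVec_smul (τ t : ℝ) (lam : Fin n → ℝ) : tauVec τ (t • lam) = t • tauVec τ lam := by
  ext i
  simp [tauVec, ← Finset.mul_sum]
  ring

theorem tauVec_one (τ : ℝ) : tauVec τ (1 : Fin n → ℝ) = (τ + n * (1 - τ)) • (1 : Fin n → ℝ) := by
  ext i
  simp [tauVec]
  ring

theorem tau_factor_pos (hn : 0 < n) {τ : ℝ} (h0 : 0 < τ) (h1 : τ ≤ 1) :
    0 < τ + n * (1 - τ) := by
  have : 0 ≤ (n : ℝ) * (1 - τ) := mul_nonneg (by positivity) (by linarith)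
  linarith

/-- Adding a positive multiple of (1, …, 1) stays in Γ. This transfers the margin vectors and (1, …,
1) to every Γ^τ, with constants independent of τ. -/
theorem IsAdmissiblePair.subset_coneTau (h : IsAdmissiblePair f Γ) {τ : ℝ} (h0 : 0 < τ)
    (h1 : τ ≤ 1) : Γ ⊆ coneTau τ Γ := by
  intro lam hlam
  rcases h1.eq_or_lt with rfl | h1
  · have : tauVec 1 lam = lam := by ext i; simp [tauVec]
    simpa [coneTau, this] using hlam
  have hs : 0 < ∑ j, lam j := h.subset_half hlam
  exact h.add_mem (h.cone τ h0 lam hlam)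
    (h.positive_subset (show ∀ i : Fin n, 0 < (1 - τ) * ∑ j, lam j from
      fun i => mul_pos (by linarith) hs))

theorem IsAdmissiblePair.comp_perm_mem_coneTau (h : IsAdmissiblePair f Γ) {τ : ℝ}
    {lam : Fin n → ℝ} (hl : lam ∈ coneTau τ Γ) (σ : Equiv.Perm (Fin n)) :
    lam ∘ σ ∈ coneTau τ Γ := by
  simp only [coneTau, mem_ofPred_eq, tauVec_comp_perm] at *
  exact h.symm σ _ hl

theorem IsAdmissiblePair.fTau_comp_perm (h : IsAdmissiblePair f Γ) {τ : ℝ}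
    {lam : Fin n → ℝ} (hl : lam ∈ coneTau τ Γ) (σ : Equiv.Perm (Fin n)) :
    fTau τ f (lam ∘ σ) = fTau τ f lam := by
  rw [fTau, fTau, tauVec_comp_perm, h.f_symm σ _ hl]

theorem IsAdmissiblePair.smul_mem_coneTau (h : IsAdmissiblePair f Γ) {τ t : ℝ} (ht : 0 < t)
    {lam : Fin n → ℝ} (hl : lam ∈ coneTau τ Γ) : t • lam ∈ coneTau τ Γ := by
  simp only [coneTau, mem_ofPred_eq, tauVec_smul] at *
  exact h.cone t ht _ hl

theorem IsAdmissiblePair.fTau_smul (h : IsAdmissiblePair f Γ) {τ t : ℝ} (ht : 0 < t)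
    {lam : Fin n → ℝ} (hl : lam ∈ coneTau τ Γ) : fTau τ f (t • lam) = t * fTau τ f lam := by
  rw [fTau, fTau, tauVec_smul, h.f_homogeneous t ht _ hl, mul_div_assoc]

theorem IsAdmissiblePair.fTau_nonneg (h : IsAdmissiblePair f Γ) (hn : 0 < n) {τ : ℝ}
    (h0 : 0 < τ) (h1 : τ ≤ 1) {lam : Fin n → ℝ} (hl : lam ∈ coneTau τ Γ) : 0 ≤ fTau τ f lam :=
  div_nonneg (h.f_pos _ hl).le (tau_factor_pos hn h0 h1).le

theorem IsAdmissiblePair.one_mem (h : IsAdmissiblePair f Γ) : (1 : Fin n → ℝ) ∈ Γ :=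
  h.positive_subset (by simp)

/-- The normalizing factor of f^τ is chosen for this identity; it bounds the trace of the
linearization below uniformly in τ. -/
theorem IsAdmissiblePair.fTau_one (h : IsAdmissiblePair f Γ) (hn : 0 < n) {τ : ℝ}
    (h0 : 0 < τ) (h1 : τ ≤ 1) : fTau τ f 1 = f 1 := by
  have hp := tau_factor_pos hn h0 h1
  rw [fTau, tauVec_one, h.f_homogeneous _ hp _ h.one_mem]
  field_simp

/-- The supporting hyperplane of `f^τ` at a point of `Γ^τ`. -/
theorem IsAdmissiblePair.exists_supporting (h : IsAdmissiblePair f Γ) (hn : 0 < n) {τ : ℝ}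
    (h0 : 0 < τ) (h1 : τ ≤ 1) {lam : Fin n → ℝ} (hl : lam ∈ coneTau τ Γ) :
    ∃ α : Fin n → ℝ, (∀ i, 0 ≤ α i) ∧ ∑ i, α i * lam i = fTau τ f lam ∧
      ∀ V ∈ coneTau τ Γ, fTau τ f V ≤ ∑ i, α i * V i := by
  have hp := tau_factor_pos hn h0 h1
  set c := τ + n * (1 - τ) with hc
  set D : Fin n → ℝ := fun i => fderiv ℝ f (tauVec τ lam) (Pi.single i 1) with hD
  have hDpos : ∀ i, 0 < D i := fun i => h.f_monotone _ hl i
  -- The map λ ↦ λ^τ is self-adjoint, so the gradient of f^τ is its image of the gradient of f,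
  -- divided by the normalizing factor.
  have key : ∀ V : Fin n → ℝ, ∑ i, ((τ * D i + (1 - τ) * ∑ j, D j) / c) * V i
      = fderiv ℝ f (tauVec τ lam) (tauVec τ V) / c := by
    intro V
    have e1 : fderiv ℝ f (tauVec τ lam) (tauVec τ V) = ∑ i, tauVec τ V i * D i := by
      conv_lhs => rw [pi_eq_sum_univ' (tauVec τ V)]
      simp [map_sum, hD, Pi.single]
    rw [e1, Finset.sum_div]
    have e2 : ∑ i, tauVec τ V i * D i / c
        = ∑ i, (τ * D i * V i / c) + ∑ i, D i * ((1 - τ) * (∑ j, V j) / c) := by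
      rw [← Finset.sum_add_distrib]
      refine Finset.sum_congr rfl fun i _ => ?_
      rw [tauVec]; ring
    have e3 : ∑ i, ((τ * D i + (1 - τ) * ∑ j, D j) / c) * V i
        = ∑ i, (τ * D i * V i / c) + ∑ i, V i * ((1 - τ) * (∑ j, D j) / c) := by
      rw [← Finset.sum_add_distrib]
      refine Finset.sum_congr rfl fun i _ => ?_
      ring
    rw [e2, e3, ← Finset.sum_mul, ← Finset.sum_mul]
    ring
  refine ⟨fun i => (τ * D i + (1 - τ) * ∑ j, D j) / c, fun i => ?_, ?_, fun V hV => ?_⟩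
  · refine div_nonneg (add_nonneg (mul_nonneg h0.le (hDpos i).le)
      (mul_nonneg (by linarith) (Finset.sum_nonneg fun j _ => (hDpos j).le))) hp.le
  · rw [key, h.fderiv_self hl, fTau]
  · rw [key, fTau]
    exact div_le_div_of_nonneg_right (h.le_fderiv hl hV) hp.le

/-- If `μ_Γ^+ > 1`, the vectors `½ (1, …, 1, -1, 1, …, 1)` lie in the interior of `Γ`. -/
theorem IsAdmissiblePair.exists_margin (h : IsAdmissiblePair f Γ) {μ : ℝ} (hμ : IsMuPlus Γ μ)
    (hμ1 : 1 < μ) :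
    ∃ δ > 0, ∀ b : Fin n, (fun a => (if a = b then -1 / 2 else 1 / 2) - δ : Fin n → ℝ) ∈ Γ := by
  have h1 : ∀ b : Fin n, ∃ δ > 0, ∀ t ∈ Ioo 0 δ,
      (fun a => (if a = b then -1 / 2 else 1 / 2) - t : Fin n → ℝ) ∈ Γ := by
    intro b
    have hmem : (fun a => (if a = b then -1 / 2 else 1 / 2) - (0 : ℝ) : Fin n → ℝ) ∈ Γ := by
      -- The point (-1, 1, …, 1) divides the segment from the boundary point (-μ, 1, …, 1) to the
      -- interior point (1, …, 1) with weights 2/(1+μ) and (μ-1)/(1+μ). The second weight is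
      -- positive exactly because μ > 1.
      have hint := h.convex.combo_closure_interior_mem_interior (hμ b).1
        (by rw [h.isOpen.interior_eq]; exact h.one_mem)
        (a := 2 / (1 + μ)) (b := (μ - 1) / (1 + μ)) (by positivity)
        (div_pos (by linarith) (by linarith)) (by field_simp; ring)
      rw [h.isOpen.interior_eq] at hint
      have := h.cone (1 / 2) (by norm_num) _ hint
      convert this using 1
      ext a
      by_cases hab : a = b
      · subst hab; simp; field_simp; ring
      · simp [hab]; field_simp; ring
    have hcont : Continuous fun t : ℝ =>
        (fun a => (if a = b then -1 / 2 else 1 / 2) - t : Fin n → ℝ) := by fun_prop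
    have hev := hcont.continuousAt.preimage_mem_nhds (h.isOpen.mem_nhds hmem)
    obtain ⟨δ, hδ, hsub⟩ := Metric.mem_nhds_iff.1 hev
    refine ⟨δ, hδ, fun t ht => hsub ?_⟩
    simp only [Metric.mem_ball, Real.dist_eq, sub_zero]
    rw [abs_of_pos ht.1]; exact ht.2
  choose δ hδ hmem using h1
  obtain ⟨ε, hε, hle⟩ : ∃ ε > 0, ∀ b, ε < δ b := by
    have : ∀ᶠ ε in nhdsWithin (0 : ℝ) (Ioi 0), ∀ b, ε < δ b :=
      Filter.eventually_all.2 fun b => nhdsWithin_le_nhds (Iio_mem_nhds (hδ b))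
    obtain ⟨ε, h2, h3⟩ := (this.and self_mem_nhdsWithin).exists
    exact ⟨ε, h3, h2⟩
  exact ⟨ε, hε, fun b => hmem b ε ⟨hε, hle b⟩⟩

end ConeTau

/-! ### Linear algebra -/

section LinearAlgebra

open Matrix Filter Topology

variable {n : ℕ}

/-- The multiset of roots determines the vector up to order: the fibres over each value have equal
cardinality and can be matched one by one. -/
theorem exists_perm_of_prod_X_sub_C_eq {a b : Fin n → ℝ}
    (h : ∏ i, (Polynomial.X - Polynomial.C (a i)) = ∏ i, (Polynomial.X - Polynomial.C (b i))) :
    ∃ σ : Equiv.Perm (Fin n), a ∘ σ = b := by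
  have h1 : Finset.univ.val.map a = Finset.univ.val.map b := by
    have e : ∀ c : Fin n → ℝ, (∏ i, (Polynomial.X - Polynomial.C (c i))).roots
        = Finset.univ.val.map c := by
      intro c
      have := Polynomial.roots_multiset_prod_X_sub_C (Finset.univ.val.map c)
      rwa [Multiset.map_map] at this
    rw [← e a, ← e b, h]
  have hcard : ∀ x : ℝ, Fintype.card {i // b i = x} = Fintype.card {i // a i = x} := by
    intro x
    have := congrArg (Multiset.count x) h1
    rw [Multiset.count_map, Multiset.count_map] at this
    rw [Fintype.card_subtype, Fintype.card_subtype]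
    simp only [Finset.card_def, Finset.filter_val]
    simpa [eq_comm] using this.symm
  let e : ∀ x : ℝ, {i // b i = x} ≃ {i // a i = x} := fun x => Fintype.equivOfCardEq (hcard x)
  let σ : Equiv.Perm (Fin n) := Equiv.ofFiberEquiv e
  exact ⟨σ, funext fun i => Equiv.ofFiberEquiv_map e i⟩

/-- The spectral theorem with a prescribed ordering of the eigenvalues. -/
theorem IsEigenvalueVector.exists_orthogonal {A : Matrix (Fin n) (Fin n) ℝ} {lam : Fin n → ℝ}
    (h : IsEigenvalueVector A lam) (hA : Aᵀ = A) :
    ∃ O : Matrix (Fin n) (Fin n) ℝ, Oᵀ * O = 1 ∧ O * Oᵀ = 1 ∧ A = O * diagonal lam * Oᵀ := by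
  have hH : A.IsHermitian := by rw [IsHermitian, conjTranspose_eq_transpose_of_trivial, hA]
  have hc := hH.charpoly_eq
  rw [h] at hc
  obtain ⟨σ, hσ⟩ := exists_perm_of_prod_X_sub_C_eq (a := hH.eigenvalues) (b := lam)
    (by simpa using hc.symm)
  set V : Matrix (Fin n) (Fin n) ℝ := hH.eigenvectorUnitary.val with hV
  have hs : star V = Vᵀ := by rw [star_eq_conjTranspose, conjTranspose_eq_transpose_of_trivial]
  have h1 : Vᵀ * V = 1 := by rw [← hs]; exact Unitary.coe_star_mul_self hH.eigenvectorUnitary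
  have hsp : A = V * diagonal hH.eigenvalues * Vᵀ := by
    have := hH.spectral_theorem
    rw [Unitary.conjStarAlgAut_apply] at this
    conv_lhs => rw [this]
    rw [← hs]
    rfl
  have hO : (V.submatrix id σ)ᵀ * V.submatrix id σ = 1 := by
    rw [transpose_submatrix, ← Equiv.coe_refl, submatrix_mul_equiv, h1,
      submatrix_one_equiv]
  refine ⟨V.submatrix id σ, hO, mul_eq_one_comm.1 hO, ?_⟩
  have hd : diagonal lam = (diagonal hH.eigenvalues).submatrix σ σ := by
    rw [← hσ]; ext i j; simp [diagonal_apply]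
  rw [transpose_submatrix, hd, submatrix_mul_equiv, submatrix_mul_equiv, submatrix_id_id]
  exact hsp

/-- Schur's theorem on the diagonal of a symmetric matrix, in dual form. -/
theorem IsEigenvalueVector.le_sum_diag {A : Matrix (Fin n) (Fin n) ℝ} {lam α : Fin n → ℝ}
    (h : IsEigenvalueVector A lam) (hA : Aᵀ = A) {m : ℝ}
    (hm : ∀ σ : Equiv.Perm (Fin n), m ≤ ∑ i, α i * lam (σ i)) : m ≤ ∑ i, α i * A i i := by
  obtain ⟨O, h1, h2, h3⟩ := h.exists_orthogonal hA
  have hdiag : ∀ i, A i i = ∑ j, (O i j) ^ 2 * lam j := by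
    intro i
    rw [h3, mul_apply]
    refine Finset.sum_congr rfl fun j _ => ?_
    rw [mul_diagonal, transpose_apply]; ring
  -- The squares of the entries of an orthogonal matrix form a doubly stochastic matrix, which by
  -- Birkhoff's theorem is a convex combination of permutation matrices.
  have hD : (of fun i j => (O i j) ^ 2) ∈ doublyStochastic ℝ (Fin n) := by
    rw [mem_doublyStochastic_iff_sum]
    refine ⟨fun i j => sq_nonneg _, fun i => ?_, fun j => ?_⟩
    · have := congrFun (congrFun h2 i) i
      simpa [mul_apply, sq] using this
    · have := congrFun (congrFun h1 j) j
      simpa [mul_apply, sq] using this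
  obtain ⟨w, hw0, hw1, hw⟩ := exists_eq_sum_perm_of_mem_doublyStochastic hD
  have hent : ∀ i j, (O i j) ^ 2 = ∑ σ, w σ * (if σ i = j then 1 else 0) := by
    intro i j
    have := congrFun (congrFun hw i) j
    simpa [Matrix.sum_apply, Equiv.Perm.permMatrix, PEquiv.toMatrix_apply] using this.symm
  have hsum : ∑ i, α i * A i i = ∑ σ, w σ * ∑ i, α i * lam (σ i) := by
    simp_rw [hdiag, hent, Finset.sum_mul, Finset.mul_sum]
    have : ∀ i, ∑ j, ∑ σ : Equiv.Perm (Fin n), α i * (w σ * (if σ i = j then 1 else 0) * lam j)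
        = ∑ σ : Equiv.Perm (Fin n), w σ * (α i * lam (σ i)) := by
      intro i
      rw [Finset.sum_comm]
      refine Finset.sum_congr rfl fun σ _ => ?_
      simp
      ring
    simp_rw [this]
    rw [Finset.sum_comm]
  rw [hsum]
  calc m = ∑ σ, w σ * m := by rw [← Finset.sum_mul, hw1, one_mul]
    _ ≤ _ := Finset.sum_le_sum fun σ _ => mul_le_mul_of_nonneg_left (hm σ) (hw0 σ)

/-- In a `G`-orthonormal frame the matrix of `G⁻¹ W` is `Sᵀ W S`. -/
theorem IsEigenvalueVector.frame {G W S : Matrix (Fin n) (Fin n) ℝ} {lam : Fin n → ℝ}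
    (h : IsEigenvalueVector (G⁻¹ * W) lam) (hS : Sᵀ * G * S = 1) :
    IsEigenvalueVector (Sᵀ * W * S) lam := by
  have h1 : S * (Sᵀ * G) = 1 := mul_eq_one_comm.1 hS
  have h2 : G⁻¹ = S * Sᵀ := by
    apply inv_eq_left_inv
    rw [Matrix.mul_assoc, h1]
  have h3 : Sᵀ * W * S = (Sᵀ * G) * (G⁻¹ * W) * S := by
    rw [h2]
    calc Sᵀ * W * S = (1 : Matrix (Fin n) (Fin n) ℝ) * (Sᵀ * W * S) := by rw [Matrix.one_mul]
      _ = _ := by rw [← hS]; simp only [Matrix.mul_assoc]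
  unfold IsEigenvalueVector at *
  rw [h3, charpoly_mul_comm, ← Matrix.mul_assoc, h1, Matrix.one_mul, h]

open scoped MatrixOrder in
theorem exists_orthonormal_frame {G : Matrix (Fin n) (Fin n) ℝ} (hG : G.PosDef) :
    ∃ S : Matrix (Fin n) (Fin n) ℝ, Sᵀ * G * S = 1 := by
  obtain ⟨B, hB⟩ := CStarAlgebra.nonneg_iff_eq_star_mul_self.mp hG.posSemidef.nonneg
  rw [star_eq_conjTranspose, conjTranspose_eq_transpose_of_trivial] at hB
  have hdet : IsUnit B.det := by
    have h1 := hG.det_pos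
    rw [hB, det_mul, det_transpose] at h1
    exact isUnit_iff_ne_zero.2 fun h0 => by simp [h0] at h1
  refine ⟨B⁻¹, ?_⟩
  rw [hB, Matrix.mul_assoc, Matrix.mul_assoc, mul_nonsing_inv _ hdet, Matrix.mul_one,
    ← transpose_mul, mul_nonsing_inv _ hdet, transpose_one]

/-- Simultaneous diagonalization of `G` and `W` in a `G`-orthonormal frame. -/
theorem IsEigenvalueVector.exists_eigenframe {G W : Matrix (Fin n) (Fin n) ℝ} {lam : Fin n → ℝ}
    (h : IsEigenvalueVector (G⁻¹ * W) lam) (hG : G.PosDef) (hW : Wᵀ = W) :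
    ∃ S : Matrix (Fin n) (Fin n) ℝ, Sᵀ * G * S = 1 ∧ Sᵀ * W * S = diagonal lam := by
  obtain ⟨T, hT⟩ := exists_orthonormal_frame hG
  have hsym : (Tᵀ * W * T)ᵀ = Tᵀ * W * T := by
    rw [transpose_mul, transpose_mul, transpose_transpose, hW, Matrix.mul_assoc]
  obtain ⟨O, h1, h2, h3⟩ := (h.frame hT).exists_orthogonal hsym
  refine ⟨T * O, ?_, ?_⟩
  · calc (T * O)ᵀ * G * (T * O) = Oᵀ * (Tᵀ * G * T) * O := by
          rw [transpose_mul]; simp only [Matrix.mul_assoc]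
      _ = 1 := by rw [hT, Matrix.mul_one, h1]
  · calc (T * O)ᵀ * W * (T * O) = Oᵀ * (Tᵀ * W * T) * O := by
          rw [transpose_mul]; simp only [Matrix.mul_assoc]
      _ = (Oᵀ * O) * diagonal lam * (Oᵀ * O) := by rw [h3]; simp only [Matrix.mul_assoc]
      _ = diagonal lam := by rw [h1, Matrix.one_mul, Matrix.mul_one]

section Sqrt

/-- The derivative of X ↦ X² at 1 is multiplication by 2, so the inverse function theorem applies.
The left inverse property gives local uniqueness of the root, from which its symmetry follows. -/
theorem exists_local_sqrt {A : Type*} [NormedRing A] [NormedAlgebra ℝ A] [CompleteSpace A] :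
    ∃ g : A → A, DifferentiableAt ℝ g 1 ∧ g 1 = 1 ∧ (∀ᶠ Y in 𝓝 (1 : A), g Y * g Y = Y) ∧
      ∀ᶠ X in 𝓝 (1 : A), g (X * X) = X := by
  let F : A → A := fun X => X * X
  let e : A ≃L[ℝ] A := ContinuousLinearEquiv.smulLeft (Units.mk0 (2 : ℝ) two_ne_zero)
  have hF : HasStrictFDerivAt F (e : A →L[ℝ] A) 1 := by
    have h1 := (hasStrictFDerivAt_id (𝕜 := ℝ) (1 : A)).mul'
      (hasStrictFDerivAt_id (𝕜 := ℝ) (1 : A))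
    refine h1.congr_fderiv ?_
    ext X
    change (1 : A) * X + X * (1 : A) = (2 : ℝ) • X
    rw [two_smul, one_mul, mul_one]
  have hF1 : F 1 = 1 := by simp [F]
  refine ⟨hF.localInverse F e 1, ?_, ?_, ?_, hF.eventually_left_inverse⟩
  · have := hF.to_localInverse
    rw [hF1] at this
    exact this.hasFDerivAt.differentiableAt
  · have := hF.localInverse_apply_image
    rwa [hF1] at this
  · have := hF.eventually_right_inverse
    rwa [hF1] at this

attribute [local instance] Matrix.linftyOpNormedRing Matrix.linftyOpNormedAlgebra

/-- A differentiable square root of a curve of symmetric matrices through the identity. -/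
theorem exists_hasDerivAt_sqrt {Q : ℝ → Matrix (Fin n) (Fin n) ℝ} {Q' : Matrix (Fin n) (Fin n) ℝ}
    (hQ : HasDerivAt Q Q' 0) (hQ0 : Q 0 = 1) (hsym : ∀ᶠ t in 𝓝 0, (Q t)ᵀ = Q t) :
    ∃ (R : ℝ → Matrix (Fin n) (Fin n) ℝ) (R' : Matrix (Fin n) (Fin n) ℝ),
      HasDerivAt R R' 0 ∧ R 0 = 1 ∧ ∀ᶠ t in 𝓝 0, (R t)ᵀ = R t ∧ R t * R t = Q t := by
  obtain ⟨g, hg, hg1, hright, hleft⟩ := exists_local_sqrt (A := Matrix (Fin n) (Fin n) ℝ)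
  have hR : HasDerivAt (fun t => g (Q t)) (fderiv ℝ g 1 Q') 0 := by
    have h2 : HasFDerivAt g (fderiv ℝ g 1) (Q 0) := by rw [hQ0]; exact hg.hasFDerivAt
    exact h2.comp_hasDerivAt 0 hQ
  have hQt : Tendsto Q (𝓝 0) (𝓝 1) := by
    have := hQ.continuousAt.tendsto
    rwa [hQ0] at this
  have hRt : Tendsto (fun t => g (Q t)) (𝓝 0) (𝓝 1) := by
    have := hR.continuousAt.tendsto
    rwa [hQ0, hg1] at this
  have hRt' : Tendsto (fun t => (g (Q t))ᵀ) (𝓝 0) (𝓝 1) := by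
    have h3 : Continuous fun X : Matrix (Fin n) (Fin n) ℝ => Xᵀ :=
      continuous_id.matrix_transpose
    have := (h3.tendsto 1).comp hRt
    rwa [transpose_one] at this
  refine ⟨fun t => g (Q t), fderiv ℝ g 1 Q', hR, by simp only [hQ0, hg1], ?_⟩
  -- The transpose of the root is also a root of the symmetric matrix Q t and is close to 1, so it
  -- equals the root.
  filter_upwards [hQt.eventually hright, hRt'.eventually hleft, hsym] with t h1 h2 h3
  refine ⟨?_, h1⟩
  have h4 : (g (Q t))ᵀ * (g (Q t))ᵀ = Q t := by
    rw [← transpose_mul, h1, h3]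
  rw [h4] at h2
  exact h2.symm

theorem hasDerivAt_matrix_iff {Q : ℝ → Matrix (Fin n) (Fin n) ℝ} {Q' : Matrix (Fin n) (Fin n) ℝ}
    {x : ℝ} : HasDerivAt Q Q' x ↔ ∀ i j, HasDerivAt (fun t => Q t i j) (Q' i j) x := by
  constructor
  · intro h i j
    let L : Matrix (Fin n) (Fin n) ℝ →L[ℝ] ℝ := LinearMap.toContinuousLinearMap
      { toFun := fun X => X i j, map_add' := fun _ _ => rfl, map_smul' := fun _ _ => rfl }
    exact L.hasFDerivAt.comp_hasDerivAt x h
  · intro h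
    have h1 : HasDerivAt (fun t => ∑ i, ∑ j, Q t i j • single i j (1 : ℝ))
        (∑ i, ∑ j, Q' i j • single i j (1 : ℝ)) x :=
      HasDerivAt.fun_sum fun i _ => HasDerivAt.fun_sum fun j _ => (h i j).smul_const _
    have e : ∀ X : Matrix (Fin n) (Fin n) ℝ, ∑ i, ∑ j, X i j • single i j (1 : ℝ) = X := by
      intro X
      conv_rhs => rw [matrix_eq_sum_single X]
      simp
    simpa only [e] using h1

/-- A `G`-orthonormal frame at one point of a curve extends to a differentiable orthonormal frame
along the curve. -/
theorem exists_differentiable_frame {G : ℝ → Matrix (Fin n) (Fin n) ℝ}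
    {G' S₀ : Matrix (Fin n) (Fin n) ℝ} (hG : ∀ i j, HasDerivAt (fun t => G t i j) (G' i j) 0)
    (hsym : ∀ᶠ t in 𝓝 0, (G t)ᵀ = G t) (hS₀ : S₀ᵀ * G 0 * S₀ = 1) :
    ∃ (S : ℝ → Matrix (Fin n) (Fin n) ℝ) (S' : Matrix (Fin n) (Fin n) ℝ),
      (∀ i j, HasDerivAt (fun t => S t i j) (S' i j) 0) ∧ S 0 = S₀ ∧
        ∀ᶠ t in 𝓝 0, (S t)ᵀ * G t * S t = 1 := by
  have hQ : HasDerivAt (fun t => S₀ᵀ * G t * S₀) (S₀ᵀ * G' * S₀) 0 :=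
    (((hasDerivAt_const (0 : ℝ) S₀ᵀ).mul (hasDerivAt_matrix_iff.2 hG)).mul
      (hasDerivAt_const (0 : ℝ) S₀)).congr_deriv (by simp)
  obtain ⟨R, R', hR, hR0, hRe⟩ := exists_hasDerivAt_sqrt hQ hS₀ (hsym.mono fun t ht => by
    rw [transpose_mul, transpose_mul, transpose_transpose, ht, Matrix.mul_assoc])
  obtain ⟨I', hI⟩ : ∃ I', HasDerivAt (fun t => Ring.inverse (R t)) I' 0 := by
    have h1 := hasFDerivAt_ringInverse (𝕜 := ℝ) (1 : (Matrix (Fin n) (Fin n) ℝ)ˣ)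
    rw [Units.val_one, ← hR0] at h1
    exact ⟨_, h1.comp_hasDerivAt 0 hR⟩
  have hunit : ∀ᶠ t in 𝓝 0, IsUnit (R t) := by
    have h1 : Tendsto R (𝓝 0) (𝓝 1) := by
      have := hR.continuousAt.tendsto; rwa [hR0] at this
    exact h1.eventually (Units.nhds 1)
  -- With R² = S₀ᵀ G S₀ and R symmetric, the frame S₀ R⁻¹ is G-orthonormal and equals S₀ at t = 0.
  refine ⟨fun t => S₀ * Ring.inverse (R t), S₀ * I',
    fun i j => hasDerivAt_matrix_iff.1 (((hasDerivAt_const (0 : ℝ) S₀).mul hI).congr_deriv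
      (by simp)) i j, by simp [hR0], ?_⟩
  filter_upwards [hRe, hunit] with t ht hu
  obtain ⟨h1, h2⟩ := ht
  have h3 : R t * Ring.inverse (R t) = 1 := Ring.mul_inverse_cancel _ hu
  have h4 : (Ring.inverse (R t))ᵀ * R t = 1 := by
    have := congrArg transpose h3
    rwa [transpose_mul, transpose_one, h1] at this
  calc (S₀ * Ring.inverse (R t))ᵀ * G t * (S₀ * Ring.inverse (R t))
      = (Ring.inverse (R t))ᵀ * (S₀ᵀ * G t * S₀) * Ring.inverse (R t) := by
        rw [transpose_mul]; simp only [Matrix.mul_assoc]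
    _ = ((Ring.inverse (R t))ᵀ * R t) * (R t * Ring.inverse (R t)) := by
        rw [← h2]; simp only [Matrix.mul_assoc]
    _ = 1 := by rw [h3, h4, Matrix.one_mul]

end Sqrt

end LinearAlgebra

/-! ### Calculus -/

section Calculus

open Filter Topology

variable {n : ℕ}

theorem fderiv_apply_eq_sum_partialD (h : EuclideanSpace ℝ (Fin n) → ℝ)
    (y ξ : EuclideanSpace ℝ (Fin n)) : fderiv ℝ h y ξ = ∑ i, ξ i * partialD i h y := by
  have h1 : ξ = ∑ i, ξ i • EuclideanSpace.single i (1 : ℝ) := by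
    ext j
    simp [Finset.sum_apply, Pi.single_apply]
  conv_lhs => rw [h1]
  simp [map_sum, partialD]

theorem hasDerivAt_line {h : EuclideanSpace ℝ (Fin n) → ℝ} {y ξ : EuclideanSpace ℝ (Fin n)}
    {t : ℝ} (hd : DifferentiableAt ℝ h (y + t • ξ)) :
    HasDerivAt (fun t : ℝ => h (y + t • ξ)) (∑ i, ξ i * partialD i h (y + t • ξ)) t := by
  rw [← fderiv_apply_eq_sum_partialD]
  have h2 : HasDerivAt (fun t : ℝ => y + t • ξ) ξ t := by
    simpa using ((hasDerivAt_id t).smul_const ξ).const_add y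
  exact hd.hasFDerivAt.comp_hasDerivAt t h2

theorem hasDerivAt_line_zero {h : EuclideanSpace ℝ (Fin n) → ℝ} {y : EuclideanSpace ℝ (Fin n)}
    (ξ : EuclideanSpace ℝ (Fin n)) (hd : DifferentiableAt ℝ h y) :
    HasDerivAt (fun t : ℝ => h (y + t • ξ)) (∑ i, ξ i * partialD i h y) 0 := by
  have := hasDerivAt_line (h := h) (y := y) (ξ := ξ) (t := 0) (by simpa using hd)
  simpa using this

theorem eventually_line_mem {S : Set (EuclideanSpace ℝ (Fin n))} {y : EuclideanSpace ℝ (Fin n)}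
    (hS : S ∈ 𝓝 y) (ξ : EuclideanSpace ℝ (Fin n)) : ∀ᶠ t : ℝ in 𝓝 0, y + t • ξ ∈ S := by
  have hc : Continuous fun t : ℝ => y + t • ξ := by fun_prop
  exact hc.continuousAt.preimage_mem_nhds (by simpa using hS)

theorem ContDiffOn.partialD {S : Set (EuclideanSpace ℝ (Fin n))} (hS : IsOpen S)
    {h : EuclideanSpace ℝ (Fin n) → ℝ} {m k : WithTop ℕ∞} (hh : ContDiffOn ℝ m h S)
    (hk : k + 1 ≤ m) (i : Fin n) : ContDiffOn ℝ k (partialD i h) S :=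
  (hh.fderiv_of_isOpen hS hk).clm_apply contDiffOn_const

theorem partialD_comm {S : Set (EuclideanSpace ℝ (Fin n))} (hS : IsOpen S)
    {h : EuclideanSpace ℝ (Fin n) → ℝ} (hh : ContDiffOn ℝ 2 h S)
    {y : EuclideanSpace ℝ (Fin n)} (hy : y ∈ S) (i j : Fin n) :
    partialD i (partialD j h) y = partialD j (partialD i h) y := by
  have hc : ContDiffAt ℝ 2 h y := hh.contDiffAt (hS.mem_nhds hy)
  have hs := hc.isSymmSndFDerivAt (by simp)
  have hd : DifferentiableAt ℝ (fderiv ℝ h) y :=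
    (hc.fderiv_right (m := 1) (by norm_num)).differentiableAt (by simp)
  have e : ∀ a b : Fin n, partialD a (partialD b h) y
      = fderiv ℝ (fderiv ℝ h) y (EuclideanSpace.single a 1) (EuclideanSpace.single b 1) := by
    intro a b
    unfold partialD
    rw [fderiv_clm_apply hd (differentiableAt_const _)]
    simp
  rw [e, e]
  exact hs _ _

theorem partialD_congr {S : Set (EuclideanSpace ℝ (Fin n))} (hS : IsOpen S)
    {h₁ h₂ : EuclideanSpace ℝ (Fin n) → ℝ} (hh : ∀ y ∈ S, h₁ y = h₂ y)
    {y : EuclideanSpace ℝ (Fin n)} (hy : y ∈ S) (i : Fin n) :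
    partialD i h₁ y = partialD i h₂ y := by
  have : h₁ =ᶠ[𝓝 y] h₂ := Filter.eventuallyEq_of_mem (hS.mem_nhds hy) hh
  rw [partialD, this.fderiv_eq, partialD]

/-- The necessary second order condition at a local maximum on the line. -/
theorem IsLocalMax.deriv_deriv_nonpos {g g₁ : ℝ → ℝ} {g₂ : ℝ} (hmax : IsLocalMax g 0)
    (h1 : ∀ᶠ t in 𝓝 0, HasDerivAt g (g₁ t) t) (h2 : HasDerivAt g₁ g₂ 0) :
    g₁ 0 = 0 ∧ g₂ ≤ 0 := by
  have h0 : g₁ 0 = 0 := hmax.hasDerivAt_eq_zero h1.self_of_nhds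
  refine ⟨h0, not_lt.1 fun hpos => ?_⟩
  have hd : deriv g =ᶠ[𝓝 0] g₁ := h1.mono fun t ht => ht.deriv
  have hd2 : deriv (deriv g) 0 = g₂ := by rw [hd.deriv_eq, h2.deriv]
  have hmin := isLocalMin_of_deriv_deriv_pos (f := g) (x₀ := 0) (by rw [hd2]; exact hpos)
    (by rw [hd.self_of_nhds, h0]) h1.self_of_nhds.continuousAt
  -- A positive second derivative would make 0 a local minimum as well, hence g locally constant and
  -- its second derivative zero.
  have hconst : g =ᶠ[𝓝 0] fun _ => g 0 := by
    filter_upwards [hmax, hmin] with t ht1 ht2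
    exact le_antisymm ht1 ht2
  have h3 : deriv (deriv g) 0 = 0 := by
    rw [hconst.deriv.deriv_eq]; simp
  linarith

/-- The first and second order conditions at an interior maximum of `ρ² |Du|²`, where
`ρ = s² - |y - y₀|²`. -/
theorem max_conditions {S : Set (EuclideanSpace ℝ (Fin n))} (hS : IsOpen S)
    {w : EuclideanSpace ℝ (Fin n) → ℝ} (hw : ContDiffOn ℝ 3 w S)
    {y₀ y₁ : EuclideanSpace ℝ (Fin n)} (hy₁ : y₁ ∈ S) {s : ℝ} (hs : ‖y₁ - y₀‖ < s)
    (hmax : IsLocalMax (fun y => (s ^ 2 - ‖y - y₀‖ ^ 2) ^ 2 * ∑ k, partialD k w y ^ 2) y₁) :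
    (∀ j, ∑ k, partialD j (partialD k w) y₁ * partialD k w y₁
        = 2 * (∑ k, partialD k w y₁ ^ 2) * (y₁ - y₀) j / (s ^ 2 - ‖y₁ - y₀‖ ^ 2)) ∧
    ∀ ξ : EuclideanSpace ℝ (Fin n),
      ∑ k, (∑ i, ξ i * partialD i (partialD k w) y₁) ^ 2
        + ∑ k, partialD k w y₁ * ∑ j, ξ j * ∑ i, ξ i * partialD j (partialD i (partialD k w)) y₁
      ≤ 14 * (s / (s ^ 2 - ‖y₁ - y₀‖ ^ 2)) ^ 2 * (∑ k, partialD k w y₁ ^ 2) * ‖ξ‖ ^ 2 := by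
  set ρ := s ^ 2 - ‖y₁ - y₀‖ ^ 2 with hρdef
  have hρ : 0 < ρ := by
    have := pow_lt_pow_left₀ hs (norm_nonneg _) two_ne_zero
    linarith
  set v := ∑ k, partialD k w y₁ ^ 2 with hvdef
  have hv : 0 ≤ v := Finset.sum_nonneg fun k _ => sq_nonneg _
  have hw1 : ∀ k, ContDiffOn ℝ 2 (partialD k w) S := fun k => hw.partialD hS (by norm_num) k
  have hw2 : ∀ i k, ContDiffOn ℝ 1 (partialD i (partialD k w)) S :=
    fun i k => (hw1 k).partialD hS (by norm_num) i
  -- Both conditions are read off from the restriction to the line y₁ + tξ; ρ', v', v'' are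
  -- derivatives of ρ and |Dw|² along it at t = 0.
  have key : ∀ ξ : EuclideanSpace ℝ (Fin n),
      let ρ' := -2 * inner ℝ (y₁ - y₀) ξ
      let v' := 2 * ∑ k, partialD k w y₁ * ∑ i, ξ i * partialD i (partialD k w) y₁
      let v'' := 2 * (∑ k, (∑ i, ξ i * partialD i (partialD k w) y₁) ^ 2
        + ∑ k, partialD k w y₁ * ∑ j, ξ j * ∑ i, ξ i * partialD j (partialD i (partialD k w)) y₁)
      2 * ρ * ρ' * v + ρ ^ 2 * v' = 0 ∧
        2 * ρ' ^ 2 * v - 4 * ρ * ‖ξ‖ ^ 2 * v + 4 * ρ * ρ' * v' + ρ ^ 2 * v'' ≤ 0 := by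
    intro ξ ρ' v' v''
    let r : ℝ → ℝ := fun t => s ^ 2 - ‖y₁ - y₀‖ ^ 2 - 2 * t * inner ℝ (y₁ - y₀) ξ
      - t ^ 2 * ‖ξ‖ ^ 2
    let r1 : ℝ → ℝ := fun t => - 2 * inner ℝ (y₁ - y₀) ξ - 2 * t * ‖ξ‖ ^ 2
    let a : Fin n → ℝ → ℝ := fun k t => partialD k w (y₁ + t • ξ)
    let a1 : Fin n → ℝ → ℝ := fun k t => ∑ i, ξ i * partialD i (partialD k w) (y₁ + t • ξ)
    have hr : ∀ t, s ^ 2 - ‖y₁ + t • ξ - y₀‖ ^ 2 = r t := by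
      intro t
      have : y₁ + t • ξ - y₀ = (y₁ - y₀) + t • ξ := by abel
      rw [this, norm_add_sq_real, inner_smul_right, norm_smul, mul_pow, Real.norm_eq_abs, sq_abs]
      simp only [r]; ring
    have hr1 : ∀ t, HasDerivAt r (r1 t) t := by
      intro t
      have h1 := (((hasDerivAt_const t (s ^ 2 - ‖y₁ - y₀‖ ^ 2)).sub
        (((hasDerivAt_id t).const_mul 2).mul_const (inner ℝ (y₁ - y₀) ξ))).sub
        (((hasDerivAt_id t).pow 2).mul_const (‖ξ‖ ^ 2)))
      refine h1.congr_deriv ?_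
      simp [r1]
    have hr2 : HasDerivAt r1 (-2 * ‖ξ‖ ^ 2) 0 := by
      have h1 := (hasDerivAt_const (0 : ℝ) (-2 * inner ℝ (y₁ - y₀) ξ)).sub
        (((hasDerivAt_id (0 : ℝ)).const_mul 2).mul_const (‖ξ‖ ^ 2))
      refine h1.congr_deriv ?_
      simp
    have hev := eventually_line_mem (hS.mem_nhds hy₁) ξ
    have ha : ∀ᶠ t in 𝓝 0, ∀ k, HasDerivAt (a k) (a1 k t) t := by
      filter_upwards [hev] with t ht k
      exact hasDerivAt_line (((hw1 k).contDiffAt (hS.mem_nhds ht)).differentiableAt (by simp))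
    have ha1 : ∀ k, HasDerivAt (a1 k) (∑ i, ξ i * ∑ j, ξ j *
        partialD j (partialD i (partialD k w)) y₁) 0 := by
      intro k
      refine HasDerivAt.fun_sum fun i _ => HasDerivAt.const_mul _ ?_
      exact hasDerivAt_line_zero ξ
        (((hw2 i k).contDiffAt (hS.mem_nhds hy₁)).differentiableAt (by simp))
    have hmax' : IsLocalMax (fun t => r t ^ 2 * ∑ k, a k t ^ 2) 0 := by
      have hc : ContinuousAt (fun t : ℝ => y₁ + t • ξ) 0 := by fun_prop
      have h1 : Tendsto (fun t : ℝ => y₁ + t • ξ) (𝓝 0) (𝓝 y₁) := by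
        simpa using hc.tendsto
      have h2 := h1.eventually hmax
      filter_upwards [h2] with t ht
      have e0 := hr t
      have e1 := hr 0
      simp only [a]
      rw [← e0, ← e1]
      simpa using ht
    have hg1 : ∀ᶠ t in 𝓝 0, HasDerivAt (fun t => r t ^ 2 * ∑ k, a k t ^ 2)
        (2 * r t * r1 t * ∑ k, a k t ^ 2 + r t ^ 2 * (2 * ∑ k, a k t * a1 k t)) t := by
      filter_upwards [ha] with t ht
      have h1 := ((hr1 t).pow 2).mul (HasDerivAt.fun_sum (u := Finset.univ)
        fun k _ => (ht k).pow 2)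
      refine h1.congr_deriv ?_
      simp only [Finset.mul_sum]
      simp
      ring_nf
    have hsum1 : HasDerivAt (fun t => ∑ k, a k t ^ 2) (2 * ∑ k, a k 0 * a1 k 0) 0 := by
      have h1 := HasDerivAt.fun_sum (u := Finset.univ) fun k _ => (ha.self_of_nhds k).pow 2
      refine h1.congr_deriv ?_
      rw [Finset.mul_sum]
      refine Finset.sum_congr rfl fun k _ => ?_
      simp; ring
    have hsum2 : HasDerivAt (fun t => 2 * ∑ k, a k t * a1 k t) v'' 0 := by
      have h1 := (HasDerivAt.fun_sum (u := Finset.univ)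
        fun k _ => (ha.self_of_nhds k).mul (ha1 k)).const_mul 2
      refine h1.congr_deriv ?_
      rw [Finset.sum_add_distrib]
      simp only [v'', a, a1, zero_smul, add_zero, sq]
      congr 2
      refine Finset.sum_congr rfl fun k _ => ?_
      congr 1
      simp only [Finset.mul_sum]
      rw [Finset.sum_comm]
      refine Finset.sum_congr rfl fun j _ => Finset.sum_congr rfl fun i _ => by ring
    have hg2 := ((((hr1 0).const_mul 2).mul hr2).mul hsum1).add (((hr1 0).pow 2).mul hsum2)
    have := hmax'.deriv_deriv_nonpos hg1 hg2
    have er : r 0 = ρ := by simp [r, ρ]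
    have er1 : r1 0 = ρ' := by simp [r1, ρ']
    have ea : ∀ k, a k 0 = partialD k w y₁ := by intro k; simp [a]
    have ea1 : ∀ k, a1 k 0 = ∑ i, ξ i * partialD i (partialD k w) y₁ := by intro k; simp [a1]
    simp only [er, er1, ea, ea1, Pi.pow_apply, Pi.mul_apply] at this
    refine ⟨this.1, le_trans (le_of_eq ?_) this.2⟩
    simp only [v', v]
    push_cast
    ring
  have hcrit : ∀ ξ : EuclideanSpace ℝ (Fin n),
      ∑ k, partialD k w y₁ * ∑ i, ξ i * partialD i (partialD k w) y₁
        = 2 * v * inner ℝ (y₁ - y₀) ξ / ρ := by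
    intro ξ
    have h1 := (key ξ).1
    rw [eq_div_iff hρ.ne']
    have h2 : ρ * (2 * (∑ k, partialD k w y₁ * ∑ i, ξ i * partialD i (partialD k w) y₁) * ρ)
        = ρ * (2 * (2 * v * inner ℝ (y₁ - y₀) ξ)) := by linear_combination h1
    have h3 := mul_left_cancel₀ hρ.ne' h2
    linarith
  refine ⟨fun j => ?_, fun ξ => ?_⟩
  · have h1 := hcrit (EuclideanSpace.single j 1)
    rw [EuclideanSpace.inner_single_right] at h1
    simp only [PiLp.single_apply, ite_mul, one_mul, zero_mul, Finset.sum_ite_eq',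
      Finset.mem_univ, if_true] at h1
    simp only [mul_comm (partialD _ (partialD _ w) y₁)]
    simpa using h1
  · have h1 := hcrit ξ
    have h2 := (key ξ).2
    simp only at h2
    rw [h1] at h2
    have h3 : (inner ℝ (y₁ - y₀) ξ) ^ 2 ≤ s ^ 2 * ‖ξ‖ ^ 2 := by
      have h4 := abs_real_inner_le_norm (y₁ - y₀) ξ
      calc (inner ℝ (y₁ - y₀) ξ) ^ 2 = |inner ℝ (y₁ - y₀) ξ| ^ 2 := (sq_abs _).symm
        _ ≤ (‖y₁ - y₀‖ * ‖ξ‖) ^ 2 := pow_le_pow_left₀ (abs_nonneg _) h4 2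
        _ ≤ (s * ‖ξ‖) ^ 2 := by gcongr
        _ = _ := by ring
    have hρs : ρ ≤ s ^ 2 := by
      have := sq_nonneg ‖y₁ - y₀‖
      linarith
    set X := ∑ k, (∑ i, ξ i * partialD i (partialD k w) y₁) ^ 2
        + ∑ k, partialD k w y₁ * ∑ j, ξ j * ∑ i, ξ i * partialD j (partialD i (partialD k w)) y₁
    set d := inner ℝ (y₁ - y₀) ξ
    -- The first order condition turns 4ρρ'v' into -32d²v, while 2ρ'²v = 8d²v and v'' = 2X: this
    -- gives the coefficients 12 and 2. Their sum 14 appears below, from d² ≤ s²|ξ|² and ρ ≤ s².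
    have h5 : ρ ^ 2 * X ≤ 12 * d ^ 2 * v + 2 * ρ * ‖ξ‖ ^ 2 * v := by
      have e : 4 * ρ * (-2 * d) * (2 * (2 * v * d / ρ)) = -32 * d ^ 2 * v := by
        field_simp; ring
      rw [e] at h2
      linarith
    have h6 : ρ ^ 2 * X ≤ 14 * s ^ 2 * v * ‖ξ‖ ^ 2 := by
      have := mul_le_mul_of_nonneg_right h3 hv
      have := mul_le_mul_of_nonneg_right hρs (mul_nonneg (sq_nonneg ‖ξ‖) hv)
      linarith
    have h7 : 14 * (s / ρ) ^ 2 * v * ‖ξ‖ ^ 2 = (14 * s ^ 2 * v * ‖ξ‖ ^ 2) / ρ ^ 2 := by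
      field_simp
    rw [h7, le_div_iff₀ (by positivity)]
    linarith

end Calculus

/-! ### The equation differentiated along a curve -/

section DifferentiatedEquation

open Matrix Filter Topology

variable {n : ℕ} {f : (Fin n → ℝ) → ℝ} {Γ : Set (Fin n → ℝ)}

/-- The equation differentiated along a curve. The operator is not differentiated: it is compared
with its supporting functional. -/
theorem IsAdmissiblePair.deriv_equation (h : IsAdmissiblePair f Γ) {τ : ℝ}
    {G W : ℝ → Matrix (Fin n) (Fin n) ℝ} {G' W' S₀ : Matrix (Fin n) (Fin n) ℝ}
    {lam₀ α : Fin n → ℝ} {F : ℝ → ℝ} {F' : ℝ}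
    (hG : ∀ i j, HasDerivAt (fun t => G t i j) (G' i j) 0)
    (hW : ∀ i j, HasDerivAt (fun t => W t i j) (W' i j) 0)
    (hF : HasDerivAt F F' 0)
    (hGs : ∀ᶠ t in 𝓝 0, (G t)ᵀ = G t) (hWs : ∀ᶠ t in 𝓝 0, (W t)ᵀ = W t)
    (hS₀ : S₀ᵀ * G 0 * S₀ = 1) (hS₀W : S₀ᵀ * W 0 * S₀ = diagonal lam₀)
    (hα : ∀ V ∈ coneTau τ Γ, fTau τ f V ≤ ∑ i, α i * V i)
    (hF0 : F 0 = ∑ i, α i * lam₀ i)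
    (heq : ∀ᶠ t in 𝓝 0, ∃ lam, IsEigenvalueVector ((G t)⁻¹ * W t) lam ∧ lam ∈ coneTau τ Γ ∧
      fTau τ f lam = F t) :
    F' = ∑ a, α a * ((S₀ᵀ * W' * S₀) a a - lam₀ a * (S₀ᵀ * G' * S₀) a a) := by
  obtain ⟨S, S', hS, hS0, hSe⟩ := exists_differentiable_frame hG hGs hS₀
  have hquad : ∀ {N : ℝ → Matrix (Fin n) (Fin n) ℝ} {N' : Matrix (Fin n) (Fin n) ℝ},
      (∀ i j, HasDerivAt (fun t => N t i j) (N' i j) 0) → ∀ a,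
      HasDerivAt (fun t => ((S t)ᵀ * N t * S t) a a)
        ((S'ᵀ * N 0 * S₀) a a + (S₀ᵀ * N' * S₀) a a + (S₀ᵀ * N 0 * S') a a) 0 := by
    intro N N' hN a
    have h1 : ∀ X Y Z : Matrix (Fin n) (Fin n) ℝ,
        (Xᵀ * Y * Z) a a = ∑ j, ∑ i, X i a * Y i j * Z j a := by
      intro X Y Z
      simp [mul_apply, Finset.sum_mul]
    simp only [h1]
    have h2 := HasDerivAt.fun_sum (u := Finset.univ) fun j (_ : j ∈ Finset.univ) =>
      HasDerivAt.fun_sum (u := Finset.univ) fun i (_ : i ∈ Finset.univ) =>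
        ((hS i a).mul (hN i j)).mul (hS j a)
    refine h2.congr_deriv ?_
    simp only [← Finset.sum_add_distrib, hS0]
    refine Finset.sum_congr rfl fun j _ => Finset.sum_congr rfl fun i _ => ?_
    simp only [Pi.mul_apply, hS0]
    ring
  have htr : ∀ (N : Matrix (Fin n) (Fin n) ℝ) (a : Fin n), Nᵀ = N →
      (S'ᵀ * N * S₀) a a = (S₀ᵀ * N * S') a a := by
    intro N a hN
    have : (S'ᵀ * N * S₀)ᵀ = S₀ᵀ * N * S' := by
      rw [transpose_mul, transpose_mul, transpose_transpose, hN, Matrix.mul_assoc]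
    rw [← this, transpose_apply]
  -- Differentiating SᵀGS = 1 determines the diagonal of S₀ᵀ G S'. With the next identity, valid
  -- because S₀ diagonalizes W, it eliminates the unknown S'.
  have hGrel : ∀ a, 2 * (S₀ᵀ * G 0 * S') a a + (S₀ᵀ * G' * S₀) a a = 0 := by
    intro a
    have h1 := hquad hG a
    have h2 : HasDerivAt (fun t => ((S t)ᵀ * G t * S t) a a) 0 0 := by
      refine (hasDerivAt_const (0 : ℝ) (1 : ℝ)).congr_of_eventuallyEq ?_
      filter_upwards [hSe] with t ht
      rw [ht]; simp
    have h3 := h1.unique h2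
    rw [htr _ a hGs.self_of_nhds] at h3
    linarith
  have hWS : ∀ a, (S₀ᵀ * W 0 * S') a a = lam₀ a * (S₀ᵀ * G 0 * S') a a := by
    intro a
    have h1 : S₀ * (S₀ᵀ * G 0) = 1 := mul_eq_one_comm.1 hS₀
    have h2 : S₀ᵀ * W 0 * S' = diagonal lam₀ * (S₀ᵀ * G 0 * S') := by
      rw [← hS₀W]
      calc S₀ᵀ * W 0 * S' = S₀ᵀ * W 0 * (1 : Matrix (Fin n) (Fin n) ℝ) * S' := by
            rw [Matrix.mul_one]
        _ = _ := by rw [← h1]; simp only [Matrix.mul_assoc]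
    rw [h2, diagonal_mul]
  -- φ is nonnegative by Schur's theorem and the supporting inequality, and φ(0) = 0. So 0 is a
  -- minimum, and the vanishing of φ'(0) is the differentiated equation.
  let φ : ℝ → ℝ := fun t => ∑ a, α a * ((S t)ᵀ * W t * S t) a a - F t
  have hφ := (HasDerivAt.fun_sum (u := Finset.univ)
    fun a (_ : a ∈ Finset.univ) => (hquad hW a).const_mul (α a)).sub hF
  have hmin : IsLocalMin φ 0 := by
    have h0 : φ 0 = 0 := by
      simp only [φ, hS0, hS₀W, hF0, diagonal_apply_eq, sub_self]
    filter_upwards [heq, hSe, hWs] with t ht hSt hWt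
    obtain ⟨lam, hl1, hl2, hl3⟩ := ht
    rw [h0]
    refine sub_nonneg.2 ?_
    have hsym : ((S t)ᵀ * W t * S t)ᵀ = (S t)ᵀ * W t * S t := by
      rw [transpose_mul, transpose_mul, transpose_transpose, hWt, Matrix.mul_assoc]
    refine (hl1.frame hSt).le_sum_diag hsym fun σ => ?_
    rw [← hl3, ← h.fTau_comp_perm hl2 σ]
    exact hα _ (h.comp_perm_mem_coneTau hl2 σ)
  have hz := hmin.hasDerivAt_eq_zero hφ
  rw [sub_eq_zero] at hz
  rw [← hz]
  refine Finset.sum_congr rfl fun a _ => ?_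
  rw [htr _ a hWs.self_of_nhds, hWS]
  linear_combination (α a * lam₀ a) * hGrel a

end DifferentiatedEquation

/-! ### Elementary estimates in an orthonormal frame -/

section Estimates

open Matrix

variable {n : ℕ}

theorem abs_sum_le_card_mul {a : Fin n → ℝ} {M : ℝ} (h : ∀ i, |a i| ≤ M) :
    |∑ i, a i| ≤ n * M := by
  calc |∑ i, a i| ≤ ∑ i, |a i| := Finset.abs_sum_le_sum_abs _ _
    _ ≤ ∑ _i : Fin n, M := Finset.sum_le_sum fun i _ => h i
    _ = n * M := by simp

theorem abs_mul_le_mul {a b A B : ℝ} (ha : |a| ≤ A) (hb : |b| ≤ B) : |a * b| ≤ A * B := by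
  rw [abs_mul]
  exact mul_le_mul ha hb (abs_nonneg _) ((abs_nonneg _).trans ha)

theorem abs_quadratic_le {S N : Matrix (Fin n) (Fin n) ℝ} {B M : ℝ} (hS : ∀ i j, |S i j| ≤ B)
    (hN : ∀ i j, |N i j| ≤ M) (a : Fin n) : |(Sᵀ * N * S) a a| ≤ n * (n * (B * M * B)) := by
  simp only [mul_apply, transpose_apply, Finset.sum_mul]
  exact abs_sum_le_card_mul fun j => abs_sum_le_card_mul fun i =>
    abs_mul_le_mul (abs_mul_le_mul (hS i a) (hN i j)) (hS j a)

/-- Used with U the Euclidean Hessian: a diagonal entry in the eigenframe is controlled by the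
length of the one column U T_a, the quantity appearing in the second order condition. -/
theorem abs_quadratic_le_of_column {S U : Matrix (Fin n) (Fin n) ℝ} {B M : ℝ}
    (hS : ∀ i j, |S i j| ≤ B) {a : Fin n} (hU : ∀ i, |(U * S) i a| ≤ M) :
    |(Sᵀ * U * S) a a| ≤ n * (B * M) := by
  rw [Matrix.mul_assoc, mul_apply]
  exact abs_sum_le_card_mul fun i => abs_mul_le_mul (hS i a) (hU i)

theorem abs_le_sqrt_sum_sq (x : Fin n → ℝ) (i : Fin n) : |x i| ≤ √(∑ k, x k ^ 2) := by
  rw [← Real.sqrt_sq_eq_abs]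
  exact Real.sqrt_le_sqrt (Finset.single_le_sum (f := fun k => x k ^ 2)
    (fun k _ => sq_nonneg _) (Finset.mem_univ i))

/-- A `G`-orthonormal frame has entries bounded in terms of `G⁻¹`. -/
theorem abs_frame_le {G S : Matrix (Fin n) (Fin n) ℝ} (hS : Sᵀ * G * S = 1) {B : ℝ} (hB : 1 ≤ B)
    (hG : ∀ i j, |G⁻¹ i j| ≤ B) (i j : Fin n) : |S i j| ≤ B := by
  have h1 : S * (Sᵀ * G) = 1 := mul_eq_one_comm.1 hS
  have h2 : G⁻¹ = S * Sᵀ := inv_eq_left_inv (by rw [Matrix.mul_assoc, h1])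
  have h3 : S i j ^ 2 ≤ G⁻¹ i i := by
    rw [h2, mul_apply]
    simp only [transpose_apply, ← sq]
    exact Finset.single_le_sum (f := fun k => S i k ^ 2) (fun k _ => sq_nonneg _)
      (Finset.mem_univ j)
  have h4 : S i j ^ 2 ≤ B ^ 2 :=
    h3.trans ((le_abs_self _).trans ((hG i i).trans (by nlinarith)))
  exact abs_le_of_sq_le_sq h4 (by linarith)

/-- Compares the Euclidean length of a covector with its length in the metric. Since P = (GS)(SᵀP)
and the entries of GS are at most nB², Cauchy–Schwarz gives the constant. -/
theorem abs_cosq_le {G S : Matrix (Fin n) (Fin n) ℝ} (hS : Sᵀ * G * S = 1) {B : ℝ} (hB : 1 ≤ B)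
    (hG : ∀ i j, |G i j| ≤ B) (hGi : ∀ i j, |G⁻¹ i j| ≤ B) (P : Fin n → ℝ) :
    ∑ i, P i ^ 2 ≤ n * (n * (n * (B * B)) ^ 2) * ∑ a, (Sᵀ *ᵥ P) a ^ 2 := by
  have h1 : S * (Sᵀ * G) = 1 := mul_eq_one_comm.1 hS
  have h2 : (G * S) * Sᵀ = 1 := by
    have h3 : G * (S * Sᵀ) = 1 := mul_eq_one_comm.1 (by rw [Matrix.mul_assoc, h1])
    rw [Matrix.mul_assoc, h3]
  have h3 : P = (G * S) *ᵥ (Sᵀ *ᵥ P) := by rw [mulVec_mulVec, h2, one_mulVec]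
  have h4 : ∀ i a, |(G * S) i a| ≤ n * (B * B) := fun i a => by
    rw [mul_apply]
    exact abs_sum_le_card_mul fun k => abs_mul_le_mul (hG i k) (abs_frame_le hS hB hGi k a)
  have h5 : ∀ i, P i ^ 2 ≤ n * (n * (B * B)) ^ 2 * ∑ a, (Sᵀ *ᵥ P) a ^ 2 := by
    intro i
    conv_lhs => rw [h3]
    rw [mulVec, dotProduct]
    refine (Finset.sum_mul_sq_le_sq_mul_sq _ _ _).trans ?_
    gcongr
    calc ∑ a, (G * S) i a ^ 2 ≤ ∑ _a : Fin n, (n * (B * B)) ^ 2 := by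
          refine Finset.sum_le_sum fun a _ => ?_
          rw [← sq_abs]
          exact pow_le_pow_left₀ (abs_nonneg _) (h4 i a) 2
      _ = n * (n * (B * B)) ^ 2 := by simp
  calc ∑ i, P i ^ 2 ≤ ∑ _i : Fin n, n * (n * (B * B)) ^ 2 * ∑ a, (Sᵀ *ᵥ P) a ^ 2 :=
        Finset.sum_le_sum fun i _ => h5 i
    _ = _ := by simp; ring

theorem quadratic_vecMulVec (S : Matrix (Fin n) (Fin n) ℝ) (P : Fin n → ℝ) (a : Fin n) :
    (Sᵀ * vecMulVec P P * S) a a = (Sᵀ *ᵥ P) a ^ 2 := by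
  rw [Matrix.mul_vecMulVec, Matrix.vecMulVec_mul, vecMulVec_apply, sq]
  congr 1
  rw [← mulVec_transpose]

theorem sum_inv_eq_sum_sq {G S : Matrix (Fin n) (Fin n) ℝ} (hS : Sᵀ * G * S = 1)
    (P : Fin n → ℝ) : ∑ k, ∑ l, G⁻¹ k l * P k * P l = ∑ a, (Sᵀ *ᵥ P) a ^ 2 := by
  have h1 : S * (Sᵀ * G) = 1 := mul_eq_one_comm.1 hS
  have h2 : G⁻¹ = S * Sᵀ := inv_eq_left_inv (by rw [Matrix.mul_assoc, h1])
  have h3 : ∀ a, (Sᵀ *ᵥ P) a ^ 2 = ∑ k, ∑ l, S k a * S l a * P k * P l := by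
    intro a
    rw [sq, mulVec, dotProduct, Finset.sum_mul_sum]
    refine Finset.sum_congr rfl fun k _ => Finset.sum_congr rfl fun l _ => ?_
    simp only [transpose_apply]; ring
  simp_rw [h3, h2, mul_apply, transpose_apply, Finset.sum_mul]
  calc _ = ∑ k, ∑ a, ∑ l, S k a * S l a * P k * P l :=
        Finset.sum_congr rfl fun k _ => Finset.sum_comm
    _ = _ := Finset.sum_comm

/-- If `½ (1, …, -1, …, 1) - δ (1, …, 1)` are in the cone, then the supporting functional is
positive on `½ |P|² g - P ⊗ P`. -/
theorem margin_le {α z : Fin n → ℝ} {δ : ℝ} (hz : ∀ a, 0 ≤ z a)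
    (hα : ∀ b, 0 ≤ ∑ a, α a * ((if a = b then -1 / 2 else 1 / 2) - δ)) :
    δ * (∑ a, z a) * ∑ a, α a ≤ ∑ a, α a * (1 / 2 * (∑ b, z b) - z a) := by
  have h1 : 0 ≤ ∑ b, z b * ∑ a, α a * ((if a = b then -1 / 2 else 1 / 2) - δ) :=
    Finset.sum_nonneg fun b _ => mul_nonneg (hz b) (hα b)
  have h2 : ∑ b, z b * ∑ a, α a * ((if a = b then -1 / 2 else 1 / 2) - δ)
      = ∑ a, α a * (1 / 2 * (∑ b, z b) - z a) - δ * (∑ a, z a) * ∑ a, α a := by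
    simp_rw [Finset.mul_sum]
    rw [Finset.sum_comm, ← Finset.sum_sub_distrib]
    refine Finset.sum_congr rfl fun a _ => ?_
    -- The underlying decomposition is ½(Σ z)(1, …, 1) - z = Σ_b z_b (½(1, …, 1) - e_b), a
    -- nonnegative combination of the margin vectors before the shift by δ.
    have h3 : ∀ b, z b * (α a * ((if a = b then -1 / 2 else 1 / 2) - δ))
        = α a * (1 / 2 * z b - (if a = b then z b else 0)) - δ * z b * α a := by
      intro b
      split_ifs <;> ring
    simp_rw [h3]
    rw [Finset.sum_sub_distrib, ← Finset.mul_sum, Finset.sum_sub_distrib, ← Finset.sum_mul,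
      ← Finset.mul_sum, ← Finset.mul_sum]
    simp
  linarith

/-- The final contradiction: all quantities are normalized by the trace `T`. -/
theorem bound_of_inequalities {C₁ C₂ δ : ℝ} (hC₁ : 1 ≤ C₁) (hC₂ : 1 ≤ C₂) (hδ : 0 < δ) :
    ∃ Λ : ℝ, 1 ≤ Λ ∧ ∀ {p q E x y : ℝ}, 1 ≤ p → 0 ≤ q → 0 ≤ E → x ^ 2 ≤ y →
      y ≤ C₁ * (q ^ 2 * p ^ 2 + p ^ 3 + q * p ^ 3 + E ^ 2 * p + p * x) →
      δ * p ^ 2 ≤ C₂ * (p + E ^ 2 + x) → p ≤ Λ * (1 + q + E) := by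
  set M := 8 * C₁ + C₁ ^ 2 with hM
  -- The summand 4C₂/δ lets C₂(p + E²) be absorbed by half of δp². The summand 4C₂²M/δ² contradicts
  -- the resulting inequality δ²p⁴ ≤ 4C₂²M r p³, in which p = Λr.
  refine ⟨1 + 4 * C₂ / δ + 4 * C₂ ^ 2 * M / δ ^ 2, ?_, ?_⟩
  · have : 0 < M := by positivity
    have : 0 ≤ 4 * C₂ / δ := by positivity
    have : 0 ≤ 4 * C₂ ^ 2 * M / δ ^ 2 := by positivity
    linarith
  intro p q E x y hp hq hE hxy h1 h2
  set Λ := 1 + 4 * C₂ / δ + 4 * C₂ ^ 2 * M / δ ^ 2 with hΛ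
  have hM0 : 0 < M := by positivity
  have t1 : 0 ≤ 4 * C₂ / δ := by positivity
  have t2 : 0 ≤ 4 * C₂ ^ 2 * M / δ ^ 2 := by positivity
  have hΛ1 : 1 ≤ Λ := by linarith
  by_contra! hlt
  have hΛ0 : 0 < Λ := by linarith
  set r := p / Λ with hr
  have hpr : p = Λ * r := by rw [hr]; field_simp
  -- If the bound fails, r = p/Λ dominates 1, q and E, and every term of the first inequality except
  -- p x is at most r p³.
  have hbr : 1 + q + E < r := by rw [hr, lt_div_iff₀ hΛ0]; linarith
  have hr1 : 1 ≤ r := by linarith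
  have hqr : q ≤ r := by linarith
  have hEr : E ≤ r := by linarith
  have hrp : r ≤ p := by rw [hpr]; nlinarith
  have hp0 : 0 < p := by linarith
  have hr0 : 0 < r := by linarith
  have e1 : q ^ 2 * p ^ 2 ≤ r * p ^ 3 := by
    have : q ^ 2 ≤ r * p := by rw [sq]; exact mul_le_mul hqr (hqr.trans hrp) hq hr0.le
    calc q ^ 2 * p ^ 2 ≤ (r * p) * p ^ 2 := by gcongr
      _ = r * p ^ 3 := by ring
  have e2 : p ^ 3 ≤ r * p ^ 3 := le_mul_of_one_le_left (by positivity) hr1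
  have e3 : q * p ^ 3 ≤ r * p ^ 3 := by gcongr
  have e4 : E ^ 2 * p ≤ r * p ^ 3 := by
    have : E ^ 2 ≤ r * p := by rw [sq]; exact mul_le_mul hEr (hEr.trans hrp) hE hr0.le
    calc E ^ 2 * p ≤ (r * p) * p := by gcongr
      _ = r * p ^ 2 * 1 := by ring
      _ ≤ r * p ^ 2 * p := by gcongr
      _ = r * p ^ 3 := by ring
  have e5 : p ^ 2 ≤ r * p ^ 3 := by
    calc p ^ 2 = 1 * (p ^ 2 * 1) := by ring
      _ ≤ r * (p ^ 2 * p) := by gcongr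
      _ = r * p ^ 3 := by ring
  have hx2 : x ^ 2 ≤ M * (r * p ^ 3) := by
    -- Young's inequality absorbs the term linear in x; M = 8C₁ + C₁² results on doubling.
    have h3 : C₁ * (p * x) ≤ x ^ 2 / 2 + C₁ ^ 2 * p ^ 2 / 2 := by
      nlinarith [sq_nonneg (x - C₁ * p)]
    have h4 : C₁ * (q ^ 2 * p ^ 2 + p ^ 3 + q * p ^ 3 + E ^ 2 * p) ≤ C₁ * (4 * (r * p ^ 3)) := by
      gcongr; linarith
    have h5 : C₁ ^ 2 * p ^ 2 ≤ C₁ ^ 2 * (r * p ^ 3) := by gcongr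
    have : x ^ 2 ≤ C₁ * (4 * (r * p ^ 3)) + (x ^ 2 / 2 + C₁ ^ 2 * p ^ 2 / 2) := by
      linarith
    rw [hM]; linarith
  have hx : δ * p ^ 2 ≤ 2 * C₂ * x := by
    have h3 : p + E ^ 2 ≤ 2 * (r * p) := by
      have e6 : E ^ 2 ≤ r * p := by rw [sq]; exact mul_le_mul hEr (hEr.trans hrp) hE hr0.le
      have e7 : p ≤ r * p := le_mul_of_one_le_left hp0.le hr1
      linarith
    have h4 : C₂ * (p + E ^ 2) ≤ C₂ * (2 * (r * p)) := by gcongr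
    have h5 : 4 * C₂ * r ≤ δ * p := by
      have h6 : 4 * C₂ ≤ δ * Λ := by
        have : δ * (4 * C₂ / δ) = 4 * C₂ := by field_simp
        rw [hΛ, mul_add, mul_add, this]
        have := mul_nonneg hδ.le t2
        linarith
      calc 4 * C₂ * r ≤ δ * Λ * r := by gcongr
        _ = δ * p := by rw [hpr]; ring
    have h7 : C₂ * (2 * (r * p)) ≤ δ * p ^ 2 / 2 := by
      have := mul_le_mul_of_nonneg_right h5 hp0.le
      linarith
    linarith
  have hx0 : 0 ≤ x := by
    by_contra! hneg
    have : 0 < δ * p ^ 2 := by positivity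
    have : 2 * C₂ * x < 0 := mul_neg_of_pos_of_neg (by linarith) hneg
    linarith
  have hsq : (δ * p ^ 2) ^ 2 ≤ (2 * C₂ * x) ^ 2 := pow_le_pow_left₀ (by positivity) hx 2
  have h8 : δ ^ 2 * p ^ 4 ≤ 4 * C₂ ^ 2 * (M * (r * p ^ 3)) := by
    have : 4 * C₂ ^ 2 * x ^ 2 ≤ 4 * C₂ ^ 2 * (M * (r * p ^ 3)) := by gcongr
    have e8 : (δ * p ^ 2) ^ 2 = δ ^ 2 * p ^ 4 := by ring
    have e9 : (2 * C₂ * x) ^ 2 = 4 * C₂ ^ 2 * x ^ 2 := by ring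
    linarith
  have h9 : 4 * C₂ ^ 2 * M < δ ^ 2 * Λ := by
    have : δ ^ 2 * (4 * C₂ ^ 2 * M / δ ^ 2) = 4 * C₂ ^ 2 * M := by field_simp
    have e10 : 0 < δ ^ 2 := by positivity
    have := mul_nonneg e10.le t1
    have e11 : δ ^ 2 * Λ = δ ^ 2 + δ ^ 2 * (4 * C₂ / δ) + δ ^ 2 * (4 * C₂ ^ 2 * M / δ ^ 2) := by
      rw [hΛ]; ring
    rw [e11]
    clear_value M
    linarith
  have h10 : δ ^ 2 * p ^ 4 = δ ^ 2 * Λ * (r * p ^ 3) := by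
    have : p ^ 4 = Λ * r * p ^ 3 := by rw [← hpr]; ring
    rw [this]; ring
  have h11 : 0 < r * p ^ 3 := by positivity
  have h12 := mul_lt_mul_of_pos_right h9 h11
  linarith

end Estimates

/-! ### The equation in coordinates and the derivative of the conformal Hessian -/

noncomputable section

section LocalEstimate

open Matrix Filter Topology

variable {n : ℕ} {f : (Fin n → ℝ) → ℝ} {Γ : Set (Fin n → ℝ)}

/-- `c` is differentiable on `S`, and `c` and its first derivatives are bounded by `B` there. -/
def C1Bound (B : ℝ) (c : EuclideanSpace ℝ (Fin n) → ℝ) (S : Set (EuclideanSpace ℝ (Fin n))) :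
    Prop :=
  ∀ y ∈ S, DifferentiableAt ℝ c y ∧ |c y| ≤ B ∧ ∀ i, |partialD i c y| ≤ B

/-- The tensor `∇²w - dw ⊗ dw + ½ |dw|² g - A` in coordinates. -/
def conformalHessian (Gam : Fin n → Fin n → Fin n → EuclideanSpace ℝ (Fin n) → ℝ)
    (G A : EuclideanSpace ℝ (Fin n) → Matrix (Fin n) (Fin n) ℝ)
    (w : EuclideanSpace ℝ (Fin n) → ℝ) (y : EuclideanSpace ℝ (Fin n)) :
    Matrix (Fin n) (Fin n) ℝ :=
  Matrix.of fun i j => partialD j (partialD i w) y - ∑ k, Gam k i j y * partialD k w y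
    - partialD i w y * partialD j w y
    + 1 / 2 * (∑ k, ∑ l, (G y)⁻¹ k l * partialD k w y * partialD l w y) * G y i j - A y i j

/-- A solution of the conformal equation on an open subset of `ℝⁿ`, with bounded data. -/
structure IsLocalSolution (f : (Fin n → ℝ) → ℝ) (Γ : Set (Fin n → ℝ)) (B L τ m : ℝ)
    (Gam : Fin n → Fin n → Fin n → EuclideanSpace ℝ (Fin n) → ℝ)
    (G A : EuclideanSpace ℝ (Fin n) → Matrix (Fin n) (Fin n) ℝ)
    (ψ w : EuclideanSpace ℝ (Fin n) → ℝ) (S : Set (EuclideanSpace ℝ (Fin n))) : Prop where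
  isOpen : IsOpen S
  tau_pos : 0 < τ
  tau_le : τ ≤ 1
  bound_gam : ∀ k i j, C1Bound B (Gam k i j) S
  bound_metric : ∀ i j, C1Bound B (fun y => G y i j) S
  bound_inv : ∀ i j, C1Bound B (fun y => (G y)⁻¹ i j) S
  bound_schouten : ∀ i j, C1Bound B (fun y => A y i j) S
  posDef : ∀ y ∈ S, (G y).PosDef
  gam_symm : ∀ y ∈ S, ∀ k i j, Gam k i j y = Gam k j i y
  schouten_symm : ∀ y ∈ S, ∀ i j, A y i j = A y j i
  psi_pos : ∀ y ∈ S, 0 < ψ y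
  psi_le : ∀ y ∈ S, ψ y ≤ L
  psi_diff : ∀ y ∈ S, DifferentiableAt ℝ ψ y
  dpsi_le : ∀ y ∈ S, ∀ i, |partialD i ψ y| ≤ L
  smooth : ContDiffOn ℝ 3 w S
  le_sup : ∀ y ∈ S, w y ≤ m
  equation : ∀ y ∈ S, ∃ lam, IsEigenvalueVector ((G y)⁻¹ * conformalHessian Gam G A w y) lam ∧
    lam ∈ coneTau τ Γ ∧ fTau τ f lam = ψ y * Real.exp (2 * w y)

variable {B L τ m : ℝ} {Gam : Fin n → Fin n → Fin n → EuclideanSpace ℝ (Fin n) → ℝ}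
    {G A : EuclideanSpace ℝ (Fin n) → Matrix (Fin n) (Fin n) ℝ}
    {ψ w : EuclideanSpace ℝ (Fin n) → ℝ} {S : Set (EuclideanSpace ℝ (Fin n))}

theorem C1Bound.abs_deriv_le {c : EuclideanSpace ℝ (Fin n) → ℝ} (h : C1Bound B c S)
    {y P : EuclideanSpace ℝ (Fin n)} (hy : y ∈ S) {p : ℝ} (hP : ∀ i, |P i| ≤ p) :
    |∑ i, P i * partialD i c y| ≤ n * (p * B) :=
  abs_sum_le_card_mul fun i => abs_mul_le_mul (hP i) ((h y hy).2.2 i)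

namespace IsLocalSolution

theorem contDiffOn_one (h : IsLocalSolution f Γ B L τ m Gam G A ψ w S) (i : Fin n) :
    ContDiffOn ℝ 2 (partialD i w) S := h.smooth.partialD h.isOpen (by norm_num) i

theorem contDiffOn_two (h : IsLocalSolution f Γ B L τ m Gam G A ψ w S) (i j : Fin n) :
    ContDiffOn ℝ 1 (partialD j (partialD i w)) S :=
  (h.contDiffOn_one i).partialD h.isOpen (by norm_num) j

theorem hess_symm (h : IsLocalSolution f Γ B L τ m Gam G A ψ w S)
    {y : EuclideanSpace ℝ (Fin n)} (hy : y ∈ S) (i j : Fin n) :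
    partialD i (partialD j w) y = partialD j (partialD i w) y :=
  partialD_comm h.isOpen (h.smooth.of_le (by norm_num)) hy i j

/-- Reconciles the order of derivatives produced by the second order condition with that produced by
differentiating the equation in the direction of the gradient. -/
theorem third_symm (h : IsLocalSolution f Γ B L τ m Gam G A ψ w S)
    {y : EuclideanSpace ℝ (Fin n)} (hy : y ∈ S) (i j k : Fin n) :
    partialD j (partialD i (partialD k w)) y = partialD k (partialD j (partialD i w)) y := by
  rw [partialD_congr h.isOpen (fun z hz => h.hess_symm hz i k) hy j,
    partialD_comm h.isOpen (h.contDiffOn_one i) hy j k]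

theorem metric_symm (h : IsLocalSolution f Γ B L τ m Gam G A ψ w S)
    {y : EuclideanSpace ℝ (Fin n)} (hy : y ∈ S) : (G y)ᵀ = G y := by
  have := (h.posDef y hy).isHermitian
  rwa [IsHermitian, conjTranspose_eq_transpose_of_trivial] at this

theorem conformalHessian_symm (h : IsLocalSolution f Γ B L τ m Gam G A ψ w S)
    {y : EuclideanSpace ℝ (Fin n)} (hy : y ∈ S) :
    (conformalHessian Gam G A w y)ᵀ = conformalHessian Gam G A w y := by
  ext i j
  have h1 : G y j i = G y i j := congrFun (congrFun (h.metric_symm hy) i) j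
  simp only [transpose_apply, conformalHessian, of_apply]
  rw [h.hess_symm hy i j, h.schouten_symm y hy i j, h1]
  simp only [h.gam_symm y hy _ i j]
  ring

/-- The derivative of the conformal Hessian in the direction of the gradient is, up to lower order
terms, the third derivative of the solution. -/
theorem deriv_conformalHessian (h : IsLocalSolution f Γ B L τ m Gam G A ψ w S) (hB : 1 ≤ B)
    {y P : EuclideanSpace ℝ (Fin n)} (hy : y ∈ S) {p q : ℝ} (hp : 1 ≤ p) (hq : 0 ≤ q)
    (hPw : ∀ i, P i = partialD i w y) (hP : ∀ i, |P i| ≤ p)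
    (hV : ∀ k, |∑ i, P i * partialD i (partialD k w) y| ≤ 2 * q * p ^ 2) (i j : Fin n) :
    ∃ d : ℝ, HasDerivAt (fun t : ℝ => conformalHessian Gam G A w (y + t • P) i j) d 0 ∧
      |d - ∑ k, P k * partialD k (partialD j (partialD i w)) y|
        ≤ (n ^ 2 * B + 3 * n * B + 4 + 2 * n ^ 3 * B ^ 2 + 4 * n ^ 2 * B ^ 2)
          * (p ^ 3 + q * p ^ 3) := by
  have hu : ∀ k, HasDerivAt (fun t : ℝ => partialD k w (y + t • P))
      (∑ i, P i * partialD i (partialD k w) y) 0 := fun k =>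
    hasDerivAt_line_zero P
      (((h.contDiffOn_one k).contDiffAt (h.isOpen.mem_nhds hy)).differentiableAt (by simp))
  have huu : HasDerivAt (fun t : ℝ => partialD j (partialD i w) (y + t • P))
      (∑ k, P k * partialD k (partialD j (partialD i w)) y) 0 :=
    hasDerivAt_line_zero P
      (((h.contDiffOn_two i j).contDiffAt (h.isOpen.mem_nhds hy)).differentiableAt (by simp))
  have hΓ := fun k => hasDerivAt_line_zero P (h.bound_gam k i j y hy).1
  have hI := fun k l => hasDerivAt_line_zero P (h.bound_inv k l y hy).1
  have hG := hasDerivAt_line_zero P (h.bound_metric i j y hy).1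
  have hA := hasDerivAt_line_zero P (h.bound_schouten i j y hy).1
  set V : Fin n → ℝ := fun k => ∑ i, P i * partialD i (partialD k w) y with hVdef
  have hsum1 := HasDerivAt.fun_sum (u := Finset.univ) fun k (_ : k ∈ Finset.univ) =>
    (hΓ k).mul (hu k)
  have hsum2 := HasDerivAt.fun_sum (u := Finset.univ) fun k (_ : k ∈ Finset.univ) =>
    HasDerivAt.fun_sum (u := Finset.univ) fun l (_ : l ∈ Finset.univ) =>
      ((hI k l).mul (hu k)).mul (hu l)
  have hd := ((((huu.sub hsum1).sub ((hu i).mul (hu j))).add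
    ((hsum2.const_mul (1 / 2)).mul hG)).sub hA)
  refine ⟨_, hd, ?_⟩
  -- P is the constant vector Dw(y). By `hV` the derivative of Dw along P is at most 2qp², so the
  -- terms quadratic in Dw contribute order qp³ and no free second derivative remains.
  simp only [Pi.mul_apply, zero_smul, add_zero, ← hPw]
  have bΓ' : ∀ k, |∑ x, P x * partialD x (Gam k i j) y| ≤ n * (p * B) := fun k =>
    (h.bound_gam k i j).abs_deriv_le hy hP
  have bI' : ∀ k l, |∑ x, P x * partialD x (fun y => (G y)⁻¹ k l) y| ≤ n * (p * B) := fun k l =>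
    (h.bound_inv k l).abs_deriv_le hy hP
  have bG' : |∑ x, P x * partialD x (fun y => G y i j) y| ≤ n * (p * B) :=
    (h.bound_metric i j).abs_deriv_le hy hP
  have bA' : |∑ x, P x * partialD x (fun y => A y i j) y| ≤ n * (p * B) :=
    (h.bound_schouten i j).abs_deriv_le hy hP
  have e1 : |∑ k, ((∑ x, P x * partialD x (Gam k i j) y) * P k + Gam k i j y * V k)|
      ≤ n * (n * (p * B) * p + B * (2 * q * p ^ 2)) :=
    abs_sum_le_card_mul fun k => (abs_add_le _ _).trans
      (add_le_add (abs_mul_le_mul (bΓ' k) (hP k))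
        (abs_mul_le_mul (h.bound_gam k i j y hy).2.1 (hV k)))
  have e2 : |V i * P j + P i * V j| ≤ 2 * q * p ^ 2 * p + p * (2 * q * p ^ 2) :=
    (abs_add_le _ _).trans
      (add_le_add (abs_mul_le_mul (hV i) (hP j)) (abs_mul_le_mul (hP i) (hV j)))
  have e3 : |∑ k, ∑ l, (((∑ x, P x * partialD x (fun y => (G y)⁻¹ k l) y) * P k
        + (G y)⁻¹ k l * V k) * P l + (G y)⁻¹ k l * P k * V l)|
      ≤ n * (n * ((n * (p * B) * p + B * (2 * q * p ^ 2)) * p + B * p * (2 * q * p ^ 2))) :=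
    abs_sum_le_card_mul fun k => abs_sum_le_card_mul fun l => (abs_add_le _ _).trans
      (add_le_add (abs_mul_le_mul ((abs_add_le _ _).trans (add_le_add
        (abs_mul_le_mul (bI' k l) (hP k))
        (abs_mul_le_mul (h.bound_inv k l y hy).2.1 (hV k)))) (hP l))
        (abs_mul_le_mul (abs_mul_le_mul (h.bound_inv k l y hy).2.1 (hP k)) (hV l)))
  have e4 : |∑ k, ∑ l, (G y)⁻¹ k l * P k * P l| ≤ n * (n * (B * p * p)) :=
    abs_sum_le_card_mul fun k => abs_sum_le_card_mul fun l =>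
      abs_mul_le_mul (abs_mul_le_mul (h.bound_inv k l y hy).2.1 (hP k)) (hP l)
  have e5 := abs_mul_le_mul e3 (h.bound_metric i j y hy).2.1
  have e6 := abs_mul_le_mul e4 bG'
  generalize (∑ k, ((∑ x, P x * partialD x (Gam k i j) y) * P k + Gam k i j y * V k)) = X1 at *
  generalize (∑ k, ∑ l, (((∑ x, P x * partialD x (fun y => (G y)⁻¹ k l) y) * P k
        + (G y)⁻¹ k l * V k) * P l + (G y)⁻¹ k l * P k * V l)) = X3 at *
  generalize (∑ k, ∑ l, (G y)⁻¹ k l * P k * P l) = X4 at *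
  generalize (∑ x, P x * partialD x (fun y => G y i j) y) = X5 at *
  generalize (∑ x, P x * partialD x (fun y => A y i j) y) = X6 at *
  generalize (∑ k, P k * partialD k (partialD j (partialD i w)) y) = X7 at *
  have e7 : X7 - X1 - (V i * P j + P i * V j) + (1 / 2 * X3 * G y i j + 1 / 2 * X4 * X5) - X6 - X7
      = -X1 - (V i * P j + P i * V j) + 1 / 2 * (X3 * G y i j) + 1 / 2 * (X4 * X5) - X6 := by ring
  rw [e7]
  have p0 : 0 ≤ p := by linarith
  have B0 : 0 ≤ B := by linarith
  have hn0 : (0 : ℝ) ≤ n := Nat.cast_nonneg n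
  have p1 : p ≤ p ^ 3 := le_self_pow₀ hp (by norm_num)
  have p2 : p ^ 2 ≤ p ^ 3 := pow_le_pow_right₀ hp (by norm_num)
  have qp : q * p ^ 2 ≤ q * p ^ 3 := by gcongr
  have m1 : n ^ 2 * B * p ^ 2 ≤ n ^ 2 * B * p ^ 3 := by gcongr
  have m2 : n * B * (q * p ^ 2) ≤ n * B * (q * p ^ 3) := by gcongr
  have m3 : n * B * p ≤ n * B * p ^ 3 := by gcongr
  have q3 : 0 ≤ q * p ^ 3 := by positivity
  have m4 : 0 ≤ n ^ 2 * B * (q * p ^ 3) := by positivity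
  have m5 : 0 ≤ n * B * (q * p ^ 3) := by positivity
  have m6 : 0 ≤ n * B * p ^ 3 := by positivity
  have m7 : 0 ≤ n ^ 3 * B ^ 2 * (q * p ^ 3) := by positivity
  have m8 : 0 ≤ n ^ 2 * B ^ 2 * p ^ 3 := by positivity
  have m9 : 0 ≤ p ^ 3 := by positivity
  have m10 : 0 ≤ n ^ 3 * B ^ 2 * p ^ 3 := by positivity
  have m11 : 0 ≤ n ^ 2 * B ^ 2 * (q * p ^ 3) := by positivity
  -- Each error is a monomial in p and q; since p ≥ 1, lower powers of p are dominated by p³ and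
  -- qp³.
  rw [abs_le] at *
  constructor <;> ring_nf at * <;> linarith [e1.1, e1.2, e2.1, e2.2, e5.1, e5.2, e6.1, e6.2,
    bA'.1, bA'.2]

end IsLocalSolution

end LocalEstimate

end

/-! ### The pointwise gradient bound and the estimate on Euclidean balls -/

noncomputable section

section LocalEstimate

open Matrix Filter Topology

variable {n : ℕ} {f : (Fin n → ℝ) → ℝ} {Γ : Set (Fin n → ℝ)}

theorem sum_mul_le_of_abs_le {α a : Fin n → ℝ} {M : ℝ} (hα : ∀ i, 0 ≤ α i)
    (h : ∀ i, |a i| ≤ M) : |∑ i, α i * a i| ≤ M * ∑ i, α i := by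
  calc |∑ i, α i * a i| ≤ ∑ i, |α i * a i| := Finset.abs_sum_le_sum_abs _ _
    _ ≤ ∑ i, M * α i := Finset.sum_le_sum fun i _ => by
        rw [abs_mul, abs_of_nonneg (hα i), mul_comm]
        exact mul_le_mul_of_nonneg_right (h i) (hα i)
    _ = _ := by rw [Finset.mul_sum]

set_option maxHeartbeats 2000000 in
/-- The gradient bound at a point where the first and second order conditions of
`max_conditions` hold. -/
theorem IsAdmissiblePair.exists_pointwise_bound (hf : IsAdmissiblePair f Γ) (hn : 0 < n) {μ : ℝ}
    (hμ : IsMuPlus Γ μ) (hμ1 : 1 < μ) {B L : ℝ} (hB : 1 ≤ B) (hL : 0 ≤ L) :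
    ∃ Λ : ℝ, 1 ≤ Λ ∧ ∀ (τ m : ℝ) (Gam : Fin n → Fin n → Fin n → EuclideanSpace ℝ (Fin n) → ℝ)
      (G A : EuclideanSpace ℝ (Fin n) → Matrix (Fin n) (Fin n) ℝ)
      (ψ w : EuclideanSpace ℝ (Fin n) → ℝ) (S : Set (EuclideanSpace ℝ (Fin n))),
      IsLocalSolution f Γ B L τ m Gam G A ψ w S → ∀ y ∈ S, ∀ q : ℝ, 0 ≤ q →
      (∀ j, |∑ k, partialD j (partialD k w) y * partialD k w y|
        ≤ 2 * q * ∑ k, partialD k w y ^ 2) →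
      (∀ ξ : EuclideanSpace ℝ (Fin n),
        ∑ k, (∑ i, ξ i * partialD i (partialD k w) y) ^ 2
          + ∑ k, partialD k w y * ∑ j, ξ j * ∑ i, ξ i * partialD j (partialD i (partialD k w)) y
        ≤ 14 * q ^ 2 * (∑ k, partialD k w y ^ 2) * ‖ξ‖ ^ 2) →
      √(∑ k, partialD k w y ^ 2) ≤ Λ * (1 + q + Real.exp m) := by
  obtain ⟨δ, hδ, hmargin⟩ := hf.exists_margin hμ hμ1
  have hf1 : 0 < f 1 := hf.f_pos _ hf.one_mem
  have B0 : 0 ≤ B := by linarith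
  have hn' : (0 : ℝ) < n := Nat.cast_pos.2 hn
  have hn1 : (1 : ℝ) ≤ n := by exact_mod_cast hn
  set C₃ : ℝ := n ^ 2 * B + 3 * n * B + 4 + 2 * n ^ 3 * B ^ 2 + 4 * n ^ 2 * B ^ 2 with hC₃
  set C₆ : ℝ := n * (n * (B * C₃ * B)) with hC₆
  set C₄ : ℝ := n ^ 2 * B + n ^ 2 * B ^ 2 * (n + 1) * B with hC₄
  set C₅ : ℝ := n * (n * (B * (n * B) * B)) with hC₅
  set C₇ : ℝ := n * (n * (n * (B * B)) ^ 2) with hC₇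
  set C₁ : ℝ := 14 * (n * B ^ 2) + n * L / f 1 + C₆ + C₄ * C₅ + C₅ * (n * B) + 1 with hC₁
  set C₂ : ℝ := L / f 1 + n * B + n ^ 2 * B ^ 2 * (n + 1) * B + 1 with hC₂
  have C₃0 : 0 ≤ C₃ := by positivity
  have C₆0 : 0 ≤ C₆ := by positivity
  have C₄0 : 0 ≤ C₄ := by positivity
  have C₅0 : 0 ≤ C₅ := by positivity
  have C₇0 : 0 < C₇ := by
    have : 0 < B := by linarith
    positivity
  have hC₁1 : 1 ≤ C₁ := by
    have : 0 ≤ 14 * (n * B ^ 2) + n * L / f 1 + C₆ + C₄ * C₅ + C₅ * (n * B) := by positivity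
    linarith
  have hC₂1 : 1 ≤ C₂ := by
    have : 0 ≤ L / f 1 + n * B + n ^ 2 * B ^ 2 * (n + 1) * B := by positivity
    linarith
  -- The margin controls the Riemannian length of dw; dividing δ by C₇ converts it to the Euclidean
  -- length p.
  obtain ⟨Λ, hΛ1, hΛ⟩ := bound_of_inequalities hC₁1 hC₂1 (show 0 < δ / C₇ by positivity)
  refine ⟨Λ, hΛ1, ?_⟩
  clear_value C₁ C₂ C₃ C₄ C₅ C₆ C₇
  intro τ m Gam G A ψ w S h y hy q hq hcrit hsec
  set v := ∑ k, partialD k w y ^ 2 with hv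
  have hv0 : 0 ≤ v := Finset.sum_nonneg fun k _ => sq_nonneg _
  set p := √v with hp
  have hpv : p ^ 2 = v := Real.sq_sqrt hv0
  rcases lt_or_ge p 1 with hlt | hp1
  · have : 1 ≤ 1 + q + Real.exp m := by
      have := Real.exp_pos m
      linarith
    exact hlt.le.trans (one_le_mul_of_one_le_of_one_le hΛ1 this)
  have p0 : 0 ≤ p := by linarith
  set P : EuclideanSpace ℝ (Fin n) := WithLp.toLp 2 fun i => partialD i w y with hPdef
  have hPw : ∀ i, P i = partialD i w y := fun i => rfl
  have hP : ∀ i, |P i| ≤ p := fun i => abs_le_sqrt_sum_sq (fun k => partialD k w y) i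
  have hV : ∀ k, |∑ i, P i * partialD i (partialD k w) y| ≤ 2 * q * p ^ 2 := by
    intro k
    rw [hpv]
    refine le_trans (le_of_eq ?_) (hcrit k)
    congr 1
    refine Finset.sum_congr rfl fun i _ => ?_
    rw [h.hess_symm hy, hPw]; ring
  obtain ⟨lam, hl1, hl2, hl3⟩ := h.equation y hy
  obtain ⟨α, hα0, hαlam, hα⟩ := hf.exists_supporting hn h.tau_pos h.tau_le hl2
  obtain ⟨T, hTG, hTW⟩ := hl1.exists_eigenframe (h.posDef y hy) (h.conformalHessian_symm hy)
  set t := ∑ i, α i with ht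
  -- Testing the supporting functional on (1, …, 1) bounds its trace below, so bounded quantities
  -- can be written as multiples of t.
  have hft : f 1 ≤ t := by
    have := hα 1 (hf.subset_coneTau h.tau_pos h.tau_le hf.one_mem)
    rw [hf.fTau_one hn h.tau_pos h.tau_le] at this
    simpa using this
  have t0 : 0 < t := hf1.trans_le hft
  have hTB : ∀ i j, |T i j| ≤ B :=
    abs_frame_le hTG hB fun i j => (h.bound_inv i j y hy).2.1
  set E := Real.exp m with hE
  have E0 : 0 < E := Real.exp_pos m
  have hexp : Real.exp (2 * w y) ≤ E ^ 2 := by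
    rw [hE, ← Real.exp_nat_mul]
    exact Real.exp_le_exp.2 (by push_cast; linarith [h.le_sup y hy])
  have hexp0 := Real.exp_pos (2 * w y)
  -- the eigenframe applied to the Hessian
  set U : Matrix (Fin n) (Fin n) ℝ := Matrix.of fun i j => partialD j (partialD i w) y with hU
  set D : Matrix (Fin n) (Fin n) ℝ :=
    Matrix.of fun i j => ∑ k, P k * partialD k (partialD j (partialD i w)) y with hD
  set Y : Fin n → ℝ := fun a => √(∑ k, (U * T) k a ^ 2) with hY
  have hY0 : ∀ a, 0 ≤ Y a := fun a => Real.sqrt_nonneg _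
  have hYsq : ∀ a, Y a ^ 2 = ∑ k, (U * T) k a ^ 2 := fun a =>
    Real.sq_sqrt (Finset.sum_nonneg fun k _ => sq_nonneg _)
  have hUT : ∀ a, |(Tᵀ * U * T) a a| ≤ n * (B * Y a) := fun a =>
    abs_quadratic_le_of_column hTB fun i => abs_le_sqrt_sum_sq (fun k => (U * T) k a) i
  -- the second order condition
  have hsec' : ∀ a, Y a ^ 2 + (Tᵀ * D * T) a a ≤ 14 * (n * B ^ 2) * (q ^ 2 * p ^ 2) := by
    intro a
    have h1 := hsec (WithLp.toLp 2 fun i => T i a)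
    have h2 : ‖(WithLp.toLp 2 fun i => T i a : EuclideanSpace ℝ (Fin n))‖ ^ 2 ≤ n * B ^ 2 := by
      rw [EuclideanSpace.norm_sq_eq]
      calc ∑ i, ‖T i a‖ ^ 2 ≤ ∑ _i : Fin n, B ^ 2 := by
            refine Finset.sum_le_sum fun i _ => ?_
            exact pow_le_pow_left₀ (norm_nonneg _) (hTB i a) 2
        _ = n * B ^ 2 := by simp
    have h3 : Y a ^ 2 = ∑ k, (∑ i, T i a * partialD i (partialD k w) y) ^ 2 := by
      rw [hYsq]
      refine Finset.sum_congr rfl fun k _ => ?_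
      rw [mul_apply]
      congr 1
      refine Finset.sum_congr rfl fun i _ => ?_
      simp only [hU, of_apply]; ring
    have h4 : (Tᵀ * D * T) a a = ∑ k, partialD k w y *
        ∑ j, T j a * ∑ i, T i a * partialD j (partialD i (partialD k w)) y := by
      simp only [mul_apply, transpose_apply, hD, of_apply, Finset.sum_mul, Finset.mul_sum]
      conv_rhs => rw [Finset.sum_comm]
      refine Finset.sum_congr rfl fun j _ => ?_
      rw [Finset.sum_comm]
      refine Finset.sum_congr rfl fun k _ => Finset.sum_congr rfl fun i _ => ?_
      rw [h.third_symm hy i j k, hPw]; ring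
    rw [h3, h4]
    refine h1.trans ?_
    rw [hpv]
    calc 14 * q ^ 2 * v * ‖(WithLp.toLp 2 fun i => T i a : EuclideanSpace ℝ (Fin n))‖ ^ 2
        ≤ 14 * q ^ 2 * v * (n * B ^ 2) := by gcongr
      _ = _ := by ring
  -- the value of the conformal Hessian
  set z : Fin n → ℝ := fun a => (Tᵀ *ᵥ P.ofLp) a ^ 2 with hz
  set N := ∑ a, z a with hN
  have hz0 : ∀ a, 0 ≤ z a := fun a => sq_nonneg _
  have hN0 : 0 ≤ N := Finset.sum_nonneg fun a _ => hz0 a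
  have hzN : ∀ a, z a ≤ N := fun a =>
    Finset.single_le_sum (f := z) (fun a _ => hz0 a) (Finset.mem_univ a)
  have hNinv : ∑ k, ∑ l, (G y)⁻¹ k l * P k * P l = N := sum_inv_eq_sum_sq hTG _
  have hNle : N ≤ n ^ 2 * B * p ^ 2 := by
    rw [← hNinv]
    refine (le_abs_self _).trans (le_trans (abs_sum_le_card_mul fun k => abs_sum_le_card_mul fun l =>
      abs_mul_le_mul (abs_mul_le_mul (h.bound_inv k l y hy).2.1 (hP k)) (hP l)) (le_of_eq ?_))
    ring
  have hpN : p ^ 2 ≤ C₇ * N := by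
    rw [hpv, hC₇]
    exact abs_cosq_le hTG hB (fun i j => (h.bound_metric i j y hy).2.1)
      (fun i j => (h.bound_inv i j y hy).2.1) P.ofLp
  set Er : Matrix (Fin n) (Fin n) ℝ := Matrix.of fun i j => ∑ k, Gam k i j y * P k + A y i j
    with hEr
  have hErB : ∀ i j, |Er i j| ≤ (n + 1) * B * p := by
    intro i j
    refine ((abs_add_le _ _).trans (add_le_add (abs_sum_le_card_mul fun k =>
      abs_mul_le_mul (h.bound_gam k i j y hy).2.1 (hP k)) (h.bound_schouten i j y hy).2.1)).trans ?_
    have : B * 1 ≤ B * p := by gcongr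
    linarith
  have hWdecomp : conformalHessian Gam G A w y
      = U + (1 / 2 * N) • G y - vecMulVec P.ofLp P.ofLp - Er := by
    ext i j
    simp only [conformalHessian, of_apply, Matrix.add_apply, Matrix.sub_apply, Matrix.smul_apply, smul_eq_mul,
      vecMulVec_apply, hU, hEr, ← hNinv, hPw]
    ring
  have hErq : ∀ a, |(Tᵀ * Er * T) a a| ≤ n ^ 2 * B ^ 2 * (n + 1) * B * p := by
    intro a
    refine (abs_quadratic_le hTB hErB a).trans (le_of_eq ?_)
    ring
  -- In the eigenframe the metric is the identity and dw ⊗ dw has diagonal z, so λ splits into the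
  -- Hessian, the quadratic gradient part ½N - z_a and an error of order p.
  have hlam : ∀ a, lam a = (Tᵀ * U * T) a a + (1 / 2 * N - z a) - (Tᵀ * Er * T) a a := by
    intro a
    have h1 : lam a = (Tᵀ * conformalHessian Gam G A w y * T) a a := by
      rw [hTW, diagonal_apply_eq]
    rw [h1, hWdecomp]
    simp only [Matrix.mul_add, Matrix.mul_sub, Matrix.add_mul, Matrix.sub_mul, Matrix.mul_smul,
      Matrix.smul_mul, hTG, Matrix.add_apply, Matrix.sub_apply, Matrix.smul_apply, quadratic_vecMulVec,
      one_apply_eq, smul_eq_mul]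
    simp only [hz]
    ring
  -- Needed for the term λ_a G'(T_a, T_a) in the differentiated equation: its Hessian part is only
  -- linear in Y_a and becomes the p X term.
  have hlamB : ∀ a, |lam a| ≤ n * B * Y a + C₄ * p ^ 2 := by
    intro a
    have h1 := hUT a
    have h2 := hErq a
    have h3 : n ^ 2 * B ^ 2 * (n + 1) * B * p ≤ n ^ 2 * B ^ 2 * (n + 1) * B * p ^ 2 := by
      have : p ≤ p ^ 2 := le_self_pow₀ hp1 two_ne_zero
      gcongr
    have h4 := hzN a
    have h5 := hz0 a
    rw [hlam a]
    simp only [hC₄]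
    rw [abs_le] at *
    constructor <;> linarith [h1.1, h1.2, h2.1, h2.2]
  -- the ellipticity inequality
  have hX : ∑ a, α a * Y a * (∑ a, α a * Y a) ≤ t * ∑ a, α a * Y a ^ 2 := by
    rw [← Finset.sum_mul, ← sq, ht]
    exact Finset.sum_sq_le_sum_mul_sum_of_sq_le_mul _ (fun i _ => hα0 i)
      (fun i _ => mul_nonneg (hα0 i) (sq_nonneg _)) (fun i _ => le_of_eq (by ring))
  set X := ∑ a, α a * Y a with hXdef
  set Z := ∑ a, α a * Y a ^ 2 with hZdef
  have hX0 : 0 ≤ X := Finset.sum_nonneg fun a _ => mul_nonneg (hα0 a) (hY0 a)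
  -- The undifferentiated equation paired with α: the margin bounds the gradient terms below, so a
  -- large gradient forces a large weighted Hessian X.
  have hfour : δ / C₇ * p ^ 2 * t ≤ C₂ * (p + E ^ 2) * t + C₂ * X := by
    have h1 : δ * N * t ≤ ∑ a, α a * (1 / 2 * N - z a) := by
      refine margin_le hz0 fun b => ?_
      have hm := hf.subset_coneTau h.tau_pos h.tau_le (hmargin b)
      exact (hf.fTau_nonneg hn h.tau_pos h.tau_le hm).trans (hα _ hm)
    have h2 : ∑ a, α a * (1 / 2 * N - z a) = ψ y * Real.exp (2 * w y)
        - ∑ a, α a * (Tᵀ * U * T) a a + ∑ a, α a * (Tᵀ * Er * T) a a := by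
      rw [← hl3, ← hαlam, ← Finset.sum_sub_distrib, ← Finset.sum_add_distrib]
      refine Finset.sum_congr rfl fun a _ => ?_
      rw [hlam a]; ring
    have h3 : |∑ a, α a * (Tᵀ * Er * T) a a| ≤ n ^ 2 * B ^ 2 * (n + 1) * B * p * t :=
      sum_mul_le_of_abs_le hα0 hErq
    have h4 : -∑ a, α a * (Tᵀ * U * T) a a ≤ n * B * X := by
      rw [← Finset.sum_neg_distrib, hXdef, Finset.mul_sum]
      refine Finset.sum_le_sum fun a _ => ?_
      have := mul_le_mul_of_nonneg_left ((neg_le_abs _).trans (hUT a)) (hα0 a)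
      linarith
    have h5 : ψ y * Real.exp (2 * w y) ≤ L / f 1 * E ^ 2 * t := by
      have h6 : ψ y * Real.exp (2 * w y) ≤ L * E ^ 2 :=
        mul_le_mul (h.psi_le y hy) hexp hexp0.le hL
      have h7 : L / f 1 * E ^ 2 * f 1 = L * E ^ 2 := by field_simp
      have h8 : L / f 1 * E ^ 2 * f 1 ≤ L / f 1 * E ^ 2 * t := by gcongr
      linarith
    have h6 : δ / C₇ * p ^ 2 * t ≤ δ * N * t := by
      have : δ / C₇ * p ^ 2 ≤ δ / C₇ * (C₇ * N) := by gcongr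
      have e : δ / C₇ * (C₇ * N) = δ * N := by field_simp
      rw [e] at this
      gcongr
    have h7 : L / f 1 * E ^ 2 * t + n ^ 2 * B ^ 2 * (n + 1) * B * p * t ≤ C₂ * (p + E ^ 2) * t := by
      rw [← add_mul]
      refine mul_le_mul_of_nonneg_right ?_ t0.le
      have a1 : L / f 1 ≤ C₂ := by
        have : 0 ≤ n * B + n ^ 2 * B ^ 2 * (n + 1) * B := by positivity
        linarith
      have a2 : n ^ 2 * B ^ 2 * (n + 1) * B ≤ C₂ := by
        have : 0 ≤ L / f 1 + n * B := by positivity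
        linarith
      have := mul_le_mul_of_nonneg_right a1 (sq_nonneg E)
      have := mul_le_mul_of_nonneg_right a2 p0
      linarith
    have h8 : n * B * X ≤ C₂ * X := by
      refine mul_le_mul_of_nonneg_right ?_ hX0
      have : 0 ≤ L / f 1 + n ^ 2 * B ^ 2 * (n + 1) * B := by positivity
      linarith
    have := (abs_le.1 h3).2
    linarith
  -- the differentiated equation
  have hthree : Z ≤ C₁ * (q ^ 2 * p ^ 2 + p ^ 3 + q * p ^ 3 + E ^ 2 * p) * t + C₁ * (p * X) := by
    choose W' hW' hW'B using fun i j => h.deriv_conformalHessian hB hy hp1 hq hPw hP hV i j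
    have hline := eventually_line_mem (h.isOpen.mem_nhds hy) P
    have hF := ((hasDerivAt_line_zero P (h.psi_diff y hy)).mul
      (((hasDerivAt_line_zero P ((h.smooth.contDiffAt
        (h.isOpen.mem_nhds hy)).differentiableAt (by simp))).const_mul 2).exp))
    have hderiv := hf.deriv_equation (τ := τ) (G := fun t => G (y + t • P))
      (W := fun t => conformalHessian Gam G A w (y + t • P)) (W' := Matrix.of W')
      (G' := Matrix.of fun i j => ∑ k, P k * partialD k (fun y => G y i j) y)
      (S₀ := T) (lam₀ := lam) (α := α)
      (fun i j => hasDerivAt_line_zero P (h.bound_metric i j y hy).1) hW' hF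
      (hline.mono fun t ht => h.metric_symm ht)
      (hline.mono fun t ht => h.conformalHessian_symm ht)
      (by simpa using hTG) (by simpa using hTW) hα
      (by simp only [Pi.mul_apply, zero_smul, add_zero]; rw [hαlam, hl3])
      (hline.mono fun t ht => h.equation _ ht)
    simp only [zero_smul, add_zero] at hderiv
    -- Only a lower bound for the derivative of ψe^{2w} is required. The part from e^{2w} is
    -- 2ψe^{2w}|Dw|² ≥ 0 and is discarded; the part from Dψ is at least -nLE²p.
    have h1 : -(n * L / f 1 * (E ^ 2 * p) * t) ≤ ∑ a, α a * ((Tᵀ * Matrix.of W' * T) a a - lam a *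
        (Tᵀ * (Matrix.of fun i j => ∑ k, P k * partialD k (fun y => G y i j) y) * T) a a) := by
      rw [← hderiv]
      have h2 : |∑ i, P i * partialD i ψ y| ≤ n * (p * L) :=
        abs_sum_le_card_mul fun i => abs_mul_le_mul (hP i) (h.dpsi_le y hy i)
      have h3 : 0 ≤ ∑ i, P i * partialD i w y :=
        Finset.sum_nonneg fun i _ => by rw [hPw]; exact mul_self_nonneg _
      have h4 : 0 ≤ ψ y * (Real.exp (2 * w y) * (2 * ∑ i, P i * partialD i w y)) :=
        mul_nonneg (h.psi_pos y hy).le (mul_nonneg hexp0.le (by linarith))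
      have h5 : -(n * (p * L) * E ^ 2) ≤ (∑ i, P i * partialD i ψ y) * Real.exp (2 * w y) := by
        have h6 := abs_mul_le_mul h2 (show |Real.exp (2 * w y)| ≤ E ^ 2 by
          rw [abs_of_pos hexp0]; exact hexp)
        exact (abs_le.1 h6).1
      have h7 : n * (p * L) * E ^ 2 ≤ n * L / f 1 * (E ^ 2 * p) * t := by
        have e : n * (p * L) * E ^ 2 = n * L / f 1 * (E ^ 2 * p) * f 1 := by field_simp
        rw [e]
        gcongr
      linarith
    have hG'B : ∀ a, |(Tᵀ * (Matrix.of fun i j =>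
        ∑ k, P k * partialD k (fun y => G y i j) y) * T) a a| ≤ C₅ * p := by
      intro a
      refine (abs_quadratic_le hTB (M := n * (p * B)) (fun i j =>
        (h.bound_metric i j).abs_deriv_le hy hP) a).trans (le_of_eq ?_)
      simp only [hC₅]; ring
    have hWD : ∀ a, |(Tᵀ * Matrix.of W' * T) a a - (Tᵀ * D * T) a a| ≤ C₆ * (p ^ 3 + q * p ^ 3) := by
      intro a
      have e : (Tᵀ * Matrix.of W' * T) a a - (Tᵀ * D * T) a a
          = (Tᵀ * (Matrix.of W' - D) * T) a a := by
        rw [Matrix.mul_sub, Matrix.sub_mul, Matrix.sub_apply]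
      rw [e]
      refine (abs_quadratic_le hTB (M := C₃ * (p ^ 3 + q * p ^ 3)) (fun i j => ?_) a).trans
        (le_of_eq ?_)
      · rw [hC₃]; exact hW'B i j
      · simp only [hC₆]; ring
    -- The α-weighted sum of the second order conditions in the directions T_a, after replacing the
    -- third derivatives by W'.
    have h2 : Z + ∑ a, α a * ((Tᵀ * Matrix.of W' * T) a a - lam a *
        (Tᵀ * (Matrix.of fun i j => ∑ k, P k * partialD k (fun y => G y i j) y) * T) a a)
        ≤ (14 * (n * B ^ 2) * (q ^ 2 * p ^ 2) + C₆ * (p ^ 3 + q * p ^ 3) + C₄ * C₅ * p ^ 3) * t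
          + C₅ * (n * B) * (p * X) := by
      rw [hZdef, hXdef, ht, ← Finset.sum_add_distrib, Finset.mul_sum, Finset.mul_sum,
        Finset.mul_sum, ← Finset.sum_add_distrib]
      refine Finset.sum_le_sum fun a _ => ?_
      have b1 := hsec' a
      have b2 := (abs_le.1 (hWD a)).2
      have b3 := (abs_le.1 (abs_mul_le_mul (hlamB a) (hG'B a))).1
      have b4 : (n * B * Y a + C₄ * p ^ 2) * (C₅ * p)
        = C₅ * (n * B) * (p * Y a) + C₄ * C₅ * p ^ 3 := by ring
      rw [b4] at b3
      have b5 : Y a ^ 2 + ((Tᵀ * Matrix.of W' * T) a a - lam a *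
          (Tᵀ * (Matrix.of fun i j => ∑ k, P k * partialD k (fun y => G y i j) y) * T) a a)
          ≤ 14 * (n * B ^ 2) * (q ^ 2 * p ^ 2) + C₆ * (p ^ 3 + q * p ^ 3) + C₄ * C₅ * p ^ 3
            + C₅ * (n * B) * (p * Y a) := by linarith
      have b6 := mul_le_mul_of_nonneg_left b5 (hα0 a)
      linarith
    have a0 : 0 ≤ 14 * (n * B ^ 2) := by positivity
    have a1 : 0 ≤ n * L / f 1 := by positivity
    have a2 : 0 ≤ C₄ * C₅ := by positivity
    have a3 : 0 ≤ C₅ * (n * B) := by positivity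
    have c1 : 14 * (n * B ^ 2) * (q ^ 2 * p ^ 2) ≤ C₁ * (q ^ 2 * p ^ 2) :=
      mul_le_mul_of_nonneg_right (by linarith) (by positivity)
    have c2 : (C₆ + C₄ * C₅) * p ^ 3 ≤ C₁ * p ^ 3 :=
      mul_le_mul_of_nonneg_right (by linarith) (by positivity)
    have c3 : C₆ * (q * p ^ 3) ≤ C₁ * (q * p ^ 3) :=
      mul_le_mul_of_nonneg_right (by linarith) (by positivity)
    have c4 : n * L / f 1 * (E ^ 2 * p) ≤ C₁ * (E ^ 2 * p) :=
      mul_le_mul_of_nonneg_right (by linarith) (by positivity)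
    have c5 : C₅ * (n * B) * (p * X) ≤ C₁ * (p * X) :=
      mul_le_mul_of_nonneg_right (by linarith) (by positivity)
    have c6 : (14 * (n * B ^ 2) * (q ^ 2 * p ^ 2) + C₆ * (p ^ 3 + q * p ^ 3) + C₄ * C₅ * p ^ 3
        + n * L / f 1 * (E ^ 2 * p)) * t
        ≤ C₁ * (q ^ 2 * p ^ 2 + p ^ 3 + q * p ^ 3 + E ^ 2 * p) * t :=
      mul_le_mul_of_nonneg_right (by linarith) t0.le
    linarith
  -- After division by t the hypothesis x² ≤ y is the Cauchy–Schwarz inequality `hX`.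
  refine hΛ (x := X / t) (y := Z / t) hp1 hq E0.le ?_ ?_ ?_
  · rw [div_pow, div_le_div_iff₀ (by positivity) t0]
    have : X ^ 2 ≤ t * Z := by
      rw [← Finset.sum_mul] at hX
      rw [sq]; exact hX
    calc X ^ 2 * t ≤ t * Z * t := by gcongr
      _ = Z * t ^ 2 := by ring
  · rw [div_le_iff₀ t0]
    refine hthree.trans (le_of_eq ?_)
    field_simp
  · have e : C₂ * (p + E ^ 2 + X / t) = (C₂ * (p + E ^ 2) * t + C₂ * X) / t := by
      field_simp
    rw [e, le_div_iff₀ t0]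
    exact hfour

/-- The interior gradient estimate on Euclidean balls in coordinates. -/
theorem IsAdmissiblePair.exists_ball_bound (hf : IsAdmissiblePair f Γ) (hn : 0 < n) {μ : ℝ}
    (hμ : IsMuPlus Γ μ) (hμ1 : 1 < μ) {B L : ℝ} (hB : 1 ≤ B) (hL : 0 ≤ L) :
    ∃ Λ : ℝ, 1 ≤ Λ ∧ ∀ (τ m : ℝ) (Gam : Fin n → Fin n → Fin n → EuclideanSpace ℝ (Fin n) → ℝ)
      (G A : EuclideanSpace ℝ (Fin n) → Matrix (Fin n) (Fin n) ℝ)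
      (ψ w : EuclideanSpace ℝ (Fin n) → ℝ) (y₀ : EuclideanSpace ℝ (Fin n)) (s : ℝ), 0 < s →
      IsLocalSolution f Γ B L τ m Gam G A ψ w (Metric.ball y₀ s) →
      √(∑ k, partialD k w y₀ ^ 2) ≤ Λ * (1 + 2 / s + Real.exp m) := by
  obtain ⟨Λ, hΛ1, hΛ⟩ := hf.exists_pointwise_bound hn hμ hμ1 hB hL
  refine ⟨Λ, hΛ1, fun τ m Gam G A ψ w y₀ s hs h => ?_⟩
  -- Halving the radius puts the closed ball inside the domain of w, so that the maximum is
  -- attained. The weight vanishes on its boundary, so the maximum is interior.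
  set r := s / 2 with hr
  have hr0 : 0 < r := by positivity
  have hsub : Metric.closedBall y₀ r ⊆ Metric.ball y₀ s :=
    Metric.closedBall_subset_ball (by linarith)
  set H : EuclideanSpace ℝ (Fin n) → ℝ :=
    fun y => (r ^ 2 - ‖y - y₀‖ ^ 2) ^ 2 * ∑ k, partialD k w y ^ 2 with hH
  have hcont : ContinuousOn H (Metric.closedBall y₀ r) := by
    refine ContinuousOn.mul (by fun_prop) (continuousOn_finsetSum _ fun k _ => ?_)
    exact ((h.contDiffOn_one k).continuousOn.mono hsub).pow 2
  obtain ⟨y₁, hy₁, hmax⟩ := (isCompact_closedBall y₀ r).exists_isMaxOn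
    ⟨y₀, Metric.mem_closedBall_self hr0.le⟩ hcont
  have hv0 : ∀ y, 0 ≤ ∑ k, partialD k w y ^ 2 := fun y => Finset.sum_nonneg fun k _ => sq_nonneg _
  have hbase : H y₀ = (r ^ 2) ^ 2 * ∑ k, partialD k w y₀ ^ 2 := by simp [hH]
  have hle : H y₀ ≤ H y₁ := hmax (Metric.mem_closedBall_self hr0.le)
  have hpos : 0 < Λ * (1 + 2 / s + Real.exp m) := by positivity
  rcases (hv0 y₀).eq_or_lt with hz | hvpos
  · rw [← hz, Real.sqrt_zero]; exact hpos.le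
  have hHpos : 0 < H y₁ := lt_of_lt_of_le (by rw [hbase]; positivity) hle
  have hn1 : ‖y₁ - y₀‖ ≤ r := by rw [← dist_eq_norm]; exact hy₁
  have hlt : ‖y₁ - y₀‖ < r := by
    refine lt_of_le_of_ne hn1 fun heq => ?_
    simp [hH, heq] at hHpos
  have hmem : y₁ ∈ Metric.ball y₀ s := hsub hy₁
  have hloc : IsLocalMax H y₁ := by
    refine hmax.isLocalMax ?_
    refine Filter.mem_of_superset (Metric.isOpen_ball.mem_nhds ?_) Metric.ball_subset_closedBall
    rwa [Metric.mem_ball, dist_eq_norm]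
  obtain ⟨hc1, hc2⟩ := max_conditions Metric.isOpen_ball h.smooth hmem hlt hloc
  set ρ := r ^ 2 - ‖y₁ - y₀‖ ^ 2 with hρ
  have hρ0 : 0 < ρ := by
    have := pow_lt_pow_left₀ hlt (norm_nonneg _) two_ne_zero
    linarith
  have hρr : ρ ≤ r ^ 2 := by
    have := sq_nonneg ‖y₁ - y₀‖
    linarith
  have hb := hΛ τ m Gam G A ψ w _ h y₁ hmem (r / ρ) (by positivity) (fun j => ?_) hc2
  · set p := √(∑ k, partialD k w y₁ ^ 2)
    -- At the centre the weight is r²; comparing with the maximum and multiplying the pointwise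
    -- bound by ρ ≤ r² turns q = r/ρ into r, hence 1/r = 2/s after division by r².
    have h1 : r ^ 2 * √(∑ k, partialD k w y₀ ^ 2) ≤ ρ * p := by
      rw [← Real.sqrt_sq (sq_nonneg r), ← Real.sqrt_mul (sq_nonneg _), ← Real.sqrt_sq hρ0.le,
        ← Real.sqrt_mul (sq_nonneg _)]
      refine Real.sqrt_le_sqrt ?_
      rw [hbase] at hle
      exact hle
    have h2 : ρ * p ≤ Λ * (ρ + r + ρ * Real.exp m) := by
      calc ρ * p ≤ ρ * (Λ * (1 + r / ρ + Real.exp m)) := by gcongr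
        _ = Λ * (ρ + r + ρ * Real.exp m) := by field_simp
    have h3 : Λ * (ρ + r + ρ * Real.exp m) ≤ Λ * (r ^ 2 + r + r ^ 2 * Real.exp m) := by
      gcongr
    have h4 : Λ * (r ^ 2 + r + r ^ 2 * Real.exp m) = r ^ 2 * (Λ * (1 + 2 / s + Real.exp m)) := by
      rw [hr]; field_simp
    exact le_of_mul_le_mul_left (by linarith) (show 0 < r ^ 2 by positivity)
  · rw [hc1 j, abs_div, abs_of_pos hρ0, abs_mul, abs_of_nonneg (by linarith [hv0 y₁])]
    have h1 : |(y₁ - y₀) j| ≤ r := by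
      have := EuclideanSpace.norm_eq (y₁ - y₀)
      refine le_trans ?_ hn1
      simpa using PiLp.norm_apply_le (y₁ - y₀) j
    calc 2 * (∑ k, partialD k w y₁ ^ 2) * |(y₁ - y₀) j| / ρ
        ≤ 2 * (∑ k, partialD k w y₁ ^ 2) * r / ρ := by
          have := hv0 y₁
          gcongr
      _ = 2 * (r / ρ) * ∑ k, partialD k w y₁ ^ 2 := by ring

end LocalEstimate

end

/-! ### Rules for partial derivatives -/

section PartialDerivatives

variable {n : ℕ} {h h₁ h₂ : EuclideanSpace ℝ (Fin n) → ℝ} {y : EuclideanSpace ℝ (Fin n)}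

theorem partialD_mul (hh₁ : DifferentiableAt ℝ h₁ y) (hh₂ : DifferentiableAt ℝ h₂ y) (i : Fin n) :
    partialD i (fun z => h₁ z * h₂ z) y = partialD i h₁ y * h₂ y + h₁ y * partialD i h₂ y := by
  unfold partialD
  rw [fderiv_fun_mul hh₁ hh₂]
  simp
  ring

theorem partialD_add (hh₁ : DifferentiableAt ℝ h₁ y) (hh₂ : DifferentiableAt ℝ h₂ y) (i : Fin n) :
    partialD i (fun z => h₁ z + h₂ z) y = partialD i h₁ y + partialD i h₂ y := by
  unfold partialD
  rw [fderiv_fun_add hh₁ hh₂]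
  simp

theorem partialD_sub (hh₁ : DifferentiableAt ℝ h₁ y) (hh₂ : DifferentiableAt ℝ h₂ y) (i : Fin n) :
    partialD i (fun z => h₁ z - h₂ z) y = partialD i h₁ y - partialD i h₂ y := by
  unfold partialD
  rw [fderiv_fun_sub hh₁ hh₂]
  simp

theorem partialD_const (c : ℝ) (i : Fin n) : partialD i (fun _ => c) y = 0 := by
  simp [partialD]

theorem partialD_const_mul (c : ℝ) (hh : DifferentiableAt ℝ h y) (i : Fin n) :
    partialD i (fun z => c * h z) y = c * partialD i h y := by
  rw [partialD_mul (differentiableAt_const c) hh, partialD_const, zero_mul, zero_add]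

theorem partialD_sum {ι : Type*} {s : Finset ι} {F : ι → EuclideanSpace ℝ (Fin n) → ℝ}
    (hF : ∀ k ∈ s, DifferentiableAt ℝ (F k) y) (i : Fin n) :
    partialD i (fun z => ∑ k ∈ s, F k z) y = ∑ k ∈ s, partialD i (F k) y := by
  unfold partialD
  rw [fderiv_fun_sum hF]
  simp

theorem partialD_exp (hh : DifferentiableAt ℝ h y) (i : Fin n) :
    partialD i (fun z => Real.exp (h z)) y = Real.exp (h y) * partialD i h y := by
  unfold partialD
  rw [fderiv_exp hh]
  simp

end PartialDerivatives

/-! ### Christoffel symbols and the symmetry of the Ricci tensor -/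

section Metric

open Matrix

variable {n : ℕ} {G : EuclideanSpace ℝ (Fin n) → Matrix (Fin n) (Fin n) ℝ}
  {S : Set (EuclideanSpace ℝ (Fin n))}

theorem contDiffOn_matrix_det {m : WithTop ℕ∞} (hG : ∀ i j, ContDiffOn ℝ m (fun y => G y i j) S) :
    ContDiffOn ℝ m (fun y => (G y).det) S := by
  simp only [det_apply]
  refine ContDiffOn.sum fun σ _ => ?_
  refine ContDiffOn.const_smul _ ?_
  exact contDiffOn_prod fun i _ => hG _ _

/-- Cramer's rule: the entries of the inverse are quotients of determinants. -/
theorem contDiffOn_matrix_inv {m : WithTop ℕ∞} (hG : ∀ i j, ContDiffOn ℝ m (fun y => G y i j) S)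
    (hdet : ∀ y ∈ S, (G y).det ≠ 0) (i j : Fin n) :
    ContDiffOn ℝ m (fun y => (G y)⁻¹ i j) S := by
  have h1 : ∀ y, (G y)⁻¹ i j = (G y).det⁻¹ * ((G y).updateRow j (Pi.single i 1)).det := by
    intro y
    rw [inv_def, Matrix.smul_apply, adjugate_apply, Ring.inverse_eq_inv', smul_eq_mul]
  simp only [h1]
  refine ContDiffOn.mul ((contDiffOn_matrix_det hG).inv hdet) (contDiffOn_matrix_det fun a b => ?_)
  by_cases ha : a = j
  · subst ha
    simp only [updateRow_self]
    exact contDiffOn_const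
  · simp only [updateRow_ne ha]
    exact hG a b

/-- `G` is the coefficient matrix of a smooth Riemannian metric on the open set `S`. -/
structure IsMetricOn (G : EuclideanSpace ℝ (Fin n) → Matrix (Fin n) (Fin n) ℝ)
    (S : Set (EuclideanSpace ℝ (Fin n))) : Prop where
  isOpen : IsOpen S
  smooth : ∀ i j, ContDiffOn ℝ ∞ (fun y => G y i j) S
  posDef : ∀ y ∈ S, (G y).PosDef

namespace IsMetricOn

variable {y : EuclideanSpace ℝ (Fin n)}

theorem symm (h : IsMetricOn G S) (hy : y ∈ S) (i j : Fin n) : G y i j = G y j i := by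
  have := (h.posDef y hy).isHermitian.apply i j
  simpa using this.symm

theorem inv_symm (h : IsMetricOn G S) (hy : y ∈ S) (i j : Fin n) :
    (G y)⁻¹ i j = (G y)⁻¹ j i := by
  have := (h.posDef y hy).isHermitian.inv.apply i j
  simpa using this.symm

theorem isUnit_det (h : IsMetricOn G S) (hy : y ∈ S) : IsUnit (G y).det :=
  isUnit_iff_ne_zero.2 (h.posDef y hy).det_pos.ne'

theorem sum_inv_mul (h : IsMetricOn G S) (hy : y ∈ S) (i j : Fin n) :
    ∑ k, (G y)⁻¹ i k * G y k j = if i = j then 1 else 0 := by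
  rw [← mul_apply, nonsing_inv_mul _ (h.isUnit_det hy), one_apply]

theorem sum_mul_inv (h : IsMetricOn G S) (hy : y ∈ S) (i j : Fin n) :
    ∑ k, G y i k * (G y)⁻¹ k j = if i = j then 1 else 0 := by
  rw [← mul_apply, mul_nonsing_inv _ (h.isUnit_det hy), one_apply]

theorem smooth_inv (h : IsMetricOn G S) (i j : Fin n) :
    ContDiffOn ℝ ∞ (fun y => (G y)⁻¹ i j) S :=
  contDiffOn_matrix_inv h.smooth (fun _ hy => (h.posDef _ hy).det_pos.ne') i j

theorem smooth_partialD (h : IsMetricOn G S) (k i j : Fin n) :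
    ContDiffOn ℝ ∞ (partialD k (fun z => G z i j)) S :=
  (h.smooth i j).partialD h.isOpen (by simp) k

theorem smooth_christoffel (h : IsMetricOn G S) (k i j : Fin n) :
    ContDiffOn ℝ ∞ (christoffel G k i j) S := by
  unfold christoffel
  refine contDiffOn_const.mul (ContDiffOn.sum fun l _ => (h.smooth_inv k l).mul ?_)
  exact ((h.smooth_partialD i j l).add (h.smooth_partialD j i l)).sub (h.smooth_partialD l i j)

theorem differentiableAt (h : IsMetricOn G S) (hy : y ∈ S)
    {c : EuclideanSpace ℝ (Fin n) → ℝ} (hc : ContDiffOn ℝ ∞ c S) : DifferentiableAt ℝ c y :=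
  (hc.contDiffAt (h.isOpen.mem_nhds hy)).differentiableAt (by simp)

theorem partialD_symm (h : IsMetricOn G S) (hy : y ∈ S) (k i j : Fin n) :
    partialD k (fun z => G z i j) y = partialD k (fun z => G z j i) y :=
  partialD_congr h.isOpen (fun _ hz => h.symm hz i j) hy k

theorem christoffel_symm (h : IsMetricOn G S) (hy : y ∈ S) (k i j : Fin n) :
    christoffel G k i j y = christoffel G k j i y := by
  unfold christoffel
  congr 1
  refine Finset.sum_congr rfl fun l _ => ?_
  rw [h.partialD_symm hy l i j]
  ring

theorem sum_mul_christoffel (h : IsMetricOn G S) (hy : y ∈ S) (m i j : Fin n) :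
    ∑ k, G y m k * christoffel G k i j y = 1 / 2 * (partialD i (fun z => G z j m) y
      + partialD j (fun z => G z i m) y - partialD m (fun z => G z i j) y) := by
  unfold christoffel
  have h1 : ∀ k, G y m k * (1 / 2 * ∑ l, (G y)⁻¹ k l * (partialD i (fun z => G z j l) y
      + partialD j (fun z => G z i l) y - partialD l (fun z => G z i j) y))
      = ∑ l, (G y m k * (G y)⁻¹ k l) * (1 / 2 * (partialD i (fun z => G z j l) y
      + partialD j (fun z => G z i l) y - partialD l (fun z => G z i j) y)) := by
    intro k
    rw [Finset.mul_sum, Finset.mul_sum]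
    refine Finset.sum_congr rfl fun l _ => by ring
  simp_rw [h1]
  rw [Finset.sum_comm]
  simp_rw [← Finset.sum_mul, h.sum_mul_inv hy]
  simp

/-- The Levi-Civita connection is compatible with the metric. -/
theorem partialD_eq (h : IsMetricOn G S) (hy : y ∈ S) (l i j : Fin n) :
    partialD l (fun z => G z i j) y = ∑ k, (G y i k * christoffel G k j l y
      + G y j k * christoffel G k i l y) := by
  rw [Finset.sum_add_distrib, h.sum_mul_christoffel hy, h.sum_mul_christoffel hy,
    h.partialD_symm hy l j i, h.partialD_symm hy j i l, h.partialD_symm hy i j l]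
  ring

/-- Differentiate G⁻¹G = 1 and multiply by G⁻¹ on the right. -/
theorem partialD_inv (h : IsMetricOn G S) (hy : y ∈ S) (a i j : Fin n) :
    partialD a (fun z => (G z)⁻¹ i j) y
      = -∑ k, ∑ l, (G y)⁻¹ i k * partialD a (fun z => G z k l) y * (G y)⁻¹ l j := by
  have h1 : ∀ l, ∑ k, partialD a (fun z => (G z)⁻¹ i k) y * G y k l
      = -∑ k, (G y)⁻¹ i k * partialD a (fun z => G z k l) y := by
    intro l
    have h2 : partialD a (fun z => ∑ k, (G z)⁻¹ i k * G z k l) y = 0 := by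
      rw [partialD_congr h.isOpen (h₂ := fun _ => if i = l then 1 else 0)
        (fun z hz => h.sum_inv_mul hz i l) hy, partialD_const]
    have d1 := fun k => h.differentiableAt hy (h.smooth_inv i k)
    have d2 := fun k => h.differentiableAt hy (h.smooth k l)
    rw [partialD_sum (fun k _ => (d1 k).fun_mul (d2 k))] at h2
    simp_rw [partialD_mul (d1 _) (d2 _)] at h2
    rw [Finset.sum_add_distrib] at h2
    linarith
  calc partialD a (fun z => (G z)⁻¹ i j) y
      = ∑ k, partialD a (fun z => (G z)⁻¹ i k) y * (if k = j then 1 else 0) := by simp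
    _ = ∑ k, ∑ l, partialD a (fun z => (G z)⁻¹ i k) y * G y k l * (G y)⁻¹ l j := by
        refine Finset.sum_congr rfl fun k _ => ?_
        rw [← h.sum_mul_inv hy, Finset.mul_sum]
        refine Finset.sum_congr rfl fun l _ => by ring
    _ = ∑ l, (∑ k, partialD a (fun z => (G z)⁻¹ i k) y * G y k l) * (G y)⁻¹ l j := by
        rw [Finset.sum_comm]
        simp_rw [Finset.sum_mul]
    _ = _ := by
        simp_rw [h1, neg_mul, Finset.sum_neg_distrib, Finset.sum_mul]
        rw [Finset.sum_comm]

/-- The right side is half the derivative of log det G in the direction i. In the contraction, the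
two other derivative terms cancel by symmetry of G⁻¹. -/
theorem sum_christoffel (h : IsMetricOn G S) (hy : y ∈ S) (i : Fin n) :
    ∑ k, christoffel G k i k y = 1 / 2 * ∑ k, ∑ l, (G y)⁻¹ k l * partialD i (fun z => G z k l) y := by
  unfold christoffel
  rw [← Finset.mul_sum]
  congr 1
  have h1 : ∑ k, ∑ l, (G y)⁻¹ k l * partialD k (fun z => G z i l) y
      = ∑ k, ∑ l, (G y)⁻¹ k l * partialD l (fun z => G z i k) y := by
    rw [Finset.sum_comm]
    refine Finset.sum_congr rfl fun k _ => Finset.sum_congr rfl fun l _ => ?_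
    rw [h.inv_symm hy]
  simp_rw [mul_sub, mul_add, Finset.sum_sub_distrib, Finset.sum_add_distrib]
  rw [h1]
  ring

/-- The only part of the Ricci tensor whose symmetry is not visible: it is a second derivative of ½
log det G. Expanded, it consists of tr(G⁻¹ ∂_jG G⁻¹ ∂_iG), symmetric by cyclicity of the trace, and
of contracted second derivatives of G. -/
theorem sum_partialD_christoffel_symm (h : IsMetricOn G S) (hy : y ∈ S) (i j : Fin n) :
    ∑ k, partialD j (christoffel G k i k) y = ∑ k, partialD i (christoffel G k j k) y := by
  have key : ∀ i j, ∑ k, partialD j (christoffel G k i k) y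
      = 1 / 2 * (-((G y)⁻¹ * (Matrix.of fun k l => partialD j (fun z => G z k l) y) * (G y)⁻¹
          * (Matrix.of fun k l => partialD i (fun z => G z k l) y)).trace
        + ∑ k, ∑ l, (G y)⁻¹ k l * partialD j (partialD i (fun z => G z k l)) y) := by
    intro i j
    rw [← partialD_sum (fun k _ => h.differentiableAt hy (h.smooth_christoffel k i k)),
      partialD_congr h.isOpen (fun z hz => h.sum_christoffel hz i) hy]
    have d1 := fun k l => h.differentiableAt hy (h.smooth_inv k l)
    have d2 := fun k l => h.differentiableAt hy (h.smooth_partialD i k l)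
    have d3 := fun k => DifferentiableAt.fun_sum (u := Finset.univ)
      fun l (_ : l ∈ Finset.univ) => (d1 k l).fun_mul (d2 k l)
    rw [partialD_const_mul _ (DifferentiableAt.fun_sum fun k _ => d3 k)]
    congr 1
    rw [partialD_sum (fun k _ => d3 k)]
    simp_rw [partialD_sum (fun l _ => (d1 _ l).fun_mul (d2 _ l)), partialD_mul (d1 _ _) (d2 _ _),
      Finset.sum_add_distrib]
    congr 1
    rw [trace, ← Finset.sum_neg_distrib]
    refine Finset.sum_congr rfl fun k _ => ?_
    rw [diag_apply, mul_apply, ← Finset.sum_neg_distrib]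
    refine Finset.sum_congr rfl fun l _ => ?_
    rw [h.partialD_inv hy, mul_apply, of_apply, h.partialD_symm hy i k l, neg_mul]
    congr 2
    rw [Finset.sum_comm]
    refine Finset.sum_congr rfl fun b _ => ?_
    rw [mul_apply, Finset.sum_mul]
    simp only [of_apply]
  rw [key, key]
  congr 2
  · congr 1
    rw [Matrix.mul_assoc, trace_mul_comm]
    simp only [Matrix.mul_assoc]
  · refine Finset.sum_congr rfl fun k _ => Finset.sum_congr rfl fun l _ => ?_
    rw [partialD_comm h.isOpen ((h.smooth k l).of_le (by norm_cast)) hy]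

theorem ricci_symm (h : IsMetricOn G S) (hy : y ∈ S) (i j : Fin n) :
    ricci G y i j = ricci G y j i := by
  simp only [ricci, of_apply, Finset.sum_sub_distrib]
  rw [h.sum_partialD_christoffel_symm hy i j]
  have h1 : ∀ k, partialD k (christoffel G k i j) y = partialD k (christoffel G k j i) y :=
    fun k => partialD_congr h.isOpen (fun z hz => h.christoffel_symm hz k i j) hy k
  have h2 : ∑ k, ∑ l, christoffel G k j l y * christoffel G l i k y
      = ∑ k, ∑ l, christoffel G k i l y * christoffel G l j k y := by
    rw [Finset.sum_comm]
    refine Finset.sum_congr rfl fun k _ => Finset.sum_congr rfl fun l _ => mul_comm _ _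
  rw [h2]
  simp_rw [h1, h.christoffel_symm hy _ i j]

theorem schouten_symm (h : IsMetricOn G S) (hy : y ∈ S) (i j : Fin n) :
    schouten G y i j = schouten G y j i := by
  simp only [schouten, Matrix.smul_apply, Matrix.sub_apply]
  rw [h.ricci_symm hy i j, h.symm hy i j]

end IsMetricOn

end Metric

/-! ### Conformal change of the connection and of the curvature -/

noncomputable section

section ConformalChange

open Matrix

variable {n : ℕ}

/-- The change of the Christoffel symbols under a conformal change of the metric; `g` is the
metric, `u` the differential and `W` the gradient of the conformal factor. -/
def conformalShift (g : Fin n → Fin n → ℝ) (u W : Fin n → ℝ) (k i j : Fin n) : ℝ :=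
  (if k = i then u j else 0) + (if k = j then u i else 0) - g i j * W k

theorem sum_mul_conformalShift (g : Fin n → Fin n → ℝ) (u W : Fin n → ℝ)
    (F : Fin n → Fin n → ℝ) (i : Fin n) :
    ∑ k, ∑ l, F k l * conformalShift g u W l i k
      = ∑ k, F k i * u k + (∑ k, F k k) * u i - ∑ k, ∑ l, F k l * g i k * W l := by
  have h1 : ∀ k, ∑ l, F k l * conformalShift g u W l i k
      = F k i * u k + F k k * u i - ∑ l, F k l * g i k * W l := by
    intro k
    have h2 : ∀ l, F k l * conformalShift g u W l i k
        = ((if l = i then F k l * u k else 0) + (if l = k then F k l * u i else 0))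
          - F k l * g i k * W l := by
      intro l
      unfold conformalShift
      split_ifs <;> ring
    simp_rw [h2, Finset.sum_sub_distrib, Finset.sum_add_distrib]
    simp
  simp_rw [h1, Finset.sum_sub_distrib, Finset.sum_add_distrib, Finset.sum_mul]

theorem sum_mul_conformalShift_single (g : Fin n → Fin n → ℝ) (u W X : Fin n → ℝ) (i j : Fin n) :
    ∑ l, X l * conformalShift g u W l i j = X i * u j + X j * u i - g i j * ∑ l, X l * W l := by
  have h2 : ∀ l, X l * conformalShift g u W l i j
      = ((if l = i then X l * u j else 0) + (if l = j then X l * u i else 0))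
        - g i j * (X l * W l) := by
    intro l
    unfold conformalShift
    split_ifs <;> ring
  simp_rw [h2, Finset.sum_sub_distrib, Finset.sum_add_distrib, ← Finset.mul_sum]
  simp

theorem sum_conformalShift_diag {g : Fin n → Fin n → ℝ} {u W : Fin n → ℝ}
    (hlow : ∀ i, ∑ k, g i k * W k = u i) (hg : ∀ i j, g i j = g j i) (l : Fin n) :
    ∑ k, conformalShift g u W k k l = n * u l := by
  unfold conformalShift
  rw [Finset.sum_sub_distrib, Finset.sum_add_distrib]
  have : ∑ k, g k l * W k = u l := by simp_rw [hg _ l]; exact hlow l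
  rw [this]
  simp

theorem sum_conformalShift_diag' {g : Fin n → Fin n → ℝ} {u W : Fin n → ℝ}
    (hlow : ∀ i, ∑ k, g i k * W k = u i) (l : Fin n) :
    ∑ k, conformalShift g u W k l k = n * u l := by
  unfold conformalShift
  rw [Finset.sum_sub_distrib, Finset.sum_add_distrib, hlow l]
  simp

/-- The quadratic part of the Ricci tensor under `Γ ↦ Γ + D`. -/
theorem conformal_quadratic {g : Fin n → Fin n → ℝ} {u W : Fin n → ℝ}
    {Γ : Fin n → Fin n → Fin n → ℝ} (hlow : ∀ i, ∑ k, g i k * W k = u i)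
    (hg : ∀ i j, g i j = g j i) (hΓ : ∀ k i j, Γ k i j = Γ k j i) (i j : Fin n) :
    ∑ k, ∑ l, ((Γ k k l + conformalShift g u W k k l) * (Γ l i j + conformalShift g u W l i j)
        - (Γ k j l + conformalShift g u W k j l) * (Γ l i k + conformalShift g u W l i k))
      = ∑ k, ∑ l, (Γ k k l * Γ l i j - Γ k j l * Γ l i k) + (n - 2) * ∑ l, Γ l i j * u l
        - g i j * ∑ l, (∑ k, Γ k k l) * W l
        + ∑ l, (∑ k, (g i k * Γ k j l + g j k * Γ k i l)) * W l
        + (n - 2) * (u i * u j - g i j * ∑ l, u l * W l) := by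
  set D := conformalShift g u W with hD
  have hDs : ∀ k i j, D k i j = D k j i := by
    intro k i j
    simp only [hD, conformalShift, hg i j]
    ring
  -- The shift has trace n u_l. The sums `q2`, `q3`, `q4` expand the other product; the traces of Γ
  -- times u cancel against those in `q1`.
  have q1 : ∑ k, ∑ l, (Γ k k l + D k k l) * (Γ l i j + D l i j)
      = ∑ k, ∑ l, Γ k k l * Γ l i j + (∑ k, Γ k k i) * u j + (∑ k, Γ k k j) * u i
        - g i j * ∑ l, (∑ k, Γ k k l) * W l + n * ∑ l, Γ l i j * u l
        + n * (2 * (u i * u j) - g i j * ∑ l, u l * W l) := by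
    rw [Finset.sum_comm]
    have h1 : ∀ l, ∑ k, (Γ k k l + D k k l) * (Γ l i j + D l i j)
        = ∑ k, Γ k k l * Γ l i j + (∑ k, Γ k k l) * D l i j + n * (Γ l i j * u l)
          + n * (u l * D l i j) := by
      intro l
      rw [← Finset.sum_mul, Finset.sum_add_distrib, sum_conformalShift_diag hlow hg,
        ← Finset.sum_mul]
      ring
    simp_rw [h1, Finset.sum_add_distrib, ← Finset.mul_sum]
    rw [hD, sum_mul_conformalShift_single, sum_mul_conformalShift_single]
    rw [Finset.sum_comm (f := fun l k => Γ k k l * Γ l i j)]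
    ring
  have q2 : ∑ k, ∑ l, Γ k j l * D l i k = ∑ k, Γ k i j * u k + (∑ k, Γ k k j) * u i
        - ∑ l, (∑ k, g i k * Γ k j l) * W l := by
    rw [hD, sum_mul_conformalShift]
    congr 1
    · congr 1
      · exact Finset.sum_congr rfl fun k _ => by rw [hΓ k j i]
      · congr 1
        exact Finset.sum_congr rfl fun k _ => hΓ k j k
    · rw [Finset.sum_comm]
      refine Finset.sum_congr rfl fun l _ => ?_
      rw [Finset.sum_mul]
      exact Finset.sum_congr rfl fun k _ => by ring
  have q3 : ∑ k, ∑ l, D k j l * Γ l i k = ∑ k, Γ k i j * u k + (∑ k, Γ k k i) * u j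
        - ∑ l, (∑ k, g j k * Γ k i l) * W l := by
    rw [Finset.sum_comm]
    have h1 : ∀ l, ∑ k, D k j l * Γ l i k = ∑ k, Γ l i k * D k j l := fun l =>
      Finset.sum_congr rfl fun k _ => mul_comm _ _
    simp_rw [h1]
    rw [hD, sum_mul_conformalShift g u W (fun l k => Γ l i k) j]
    congr 1
    · congr 2
      exact Finset.sum_congr rfl fun k _ => hΓ k i k
    · rw [Finset.sum_comm]
      refine Finset.sum_congr rfl fun l _ => ?_
      rw [Finset.sum_mul]
      exact Finset.sum_congr rfl fun k _ => by ring
  have q4 : ∑ k, ∑ l, D k j l * D l i k = (n + 2) * (u i * u j)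
      - 2 * (g i j * ∑ l, u l * W l) := by
    rw [hD, sum_mul_conformalShift, sum_conformalShift_diag' hlow]
    have h1 : ∑ k, conformalShift g u W k j i * u k
        = u j * u i + u i * u j - g i j * ∑ l, u l * W l := by
      have := sum_mul_conformalShift_single g u W u j i
      rw [hg j i] at this
      rw [← this]
      exact Finset.sum_congr rfl fun k _ => mul_comm _ _
    have h2 : ∑ k, ∑ l, conformalShift g u W k j l * g i k * W l = g i j * ∑ l, u l * W l := by
      rw [Finset.sum_comm]
      have h3 : ∀ l, ∑ k, conformalShift g u W k j l * g i k * W l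
          = (g i j * u l + g i l * u j - g j l * u i) * W l := by
        intro l
        have h4 := sum_mul_conformalShift_single g u W (fun k => g i k) j l
        rw [hlow] at h4
        rw [← h4, Finset.sum_mul]
        exact Finset.sum_congr rfl fun k _ => by ring
      simp_rw [h3, sub_mul, add_mul, Finset.sum_sub_distrib, Finset.sum_add_distrib]
      have h5 : ∑ l, g i l * u j * W l = u i * u j := by
        rw [← hlow i, Finset.sum_mul]
        exact Finset.sum_congr rfl fun k _ => by ring
      have h6 : ∑ l, g j l * u i * W l = u i * u j := by
        rw [← hlow j, Finset.mul_sum]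
        exact Finset.sum_congr rfl fun k _ => by ring
      rw [h5, h6, Finset.mul_sum]
      rw [add_sub_cancel_right]
      exact Finset.sum_congr rfl fun k _ => by ring
    rw [h1, h2]
    ring
  have q0 : ∑ k, ∑ l, (Γ k j l + D k j l) * (Γ l i k + D l i k)
      = ∑ k, ∑ l, Γ k j l * Γ l i k + ∑ k, ∑ l, Γ k j l * D l i k + ∑ k, ∑ l, D k j l * Γ l i k
        + ∑ k, ∑ l, D k j l * D l i k := by
    simp_rw [← Finset.sum_add_distrib]
    exact Finset.sum_congr rfl fun k _ => Finset.sum_congr rfl fun l _ => by ring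
  simp_rw [Finset.sum_sub_distrib]
  rw [q1, q0, q2, q3, q4]
  simp_rw [Finset.sum_add_distrib, add_mul, Finset.sum_add_distrib]
  ring

variable {G : EuclideanSpace ℝ (Fin n) → Matrix (Fin n) (Fin n) ℝ}
  {w : EuclideanSpace ℝ (Fin n) → ℝ} {S : Set (EuclideanSpace ℝ (Fin n))}
  {y : EuclideanSpace ℝ (Fin n)}

/-- The coordinates of the gradient of `w` in the metric `G`. -/
def gradCoord (G : EuclideanSpace ℝ (Fin n) → Matrix (Fin n) (Fin n) ℝ)
    (w : EuclideanSpace ℝ (Fin n) → ℝ) (k : Fin n) (y : EuclideanSpace ℝ (Fin n)) : ℝ :=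
  ∑ l, (G y)⁻¹ k l * partialD l w y

/-- The Hessian of `w` in the metric `G`. -/
def covHessian (G : EuclideanSpace ℝ (Fin n) → Matrix (Fin n) (Fin n) ℝ)
    (w : EuclideanSpace ℝ (Fin n) → ℝ) (i j : Fin n) (y : EuclideanSpace ℝ (Fin n)) : ℝ :=
  partialD j (partialD i w) y - ∑ k, christoffel G k i j y * partialD k w y

namespace IsMetricOn

theorem lower_gradCoord (h : IsMetricOn G S) (hy : y ∈ S) (i : Fin n) :
    ∑ k, G y i k * gradCoord G w k y = partialD i w y := by
  unfold gradCoord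
  simp_rw [Finset.mul_sum]
  rw [Finset.sum_comm]
  simp_rw [← mul_assoc, ← Finset.sum_mul, h.sum_mul_inv hy]
  simp

theorem differentiableAt_partialD (h : IsMetricOn G S) (hw : ContDiffOn ℝ 2 w S) (hy : y ∈ S)
    (i : Fin n) : DifferentiableAt ℝ (partialD i w) y :=
  ((hw.partialD h.isOpen (k := 1) (by norm_num) i).contDiffAt
    (h.isOpen.mem_nhds hy)).differentiableAt (by simp)

theorem differentiableAt_gradCoord (h : IsMetricOn G S) (hw : ContDiffOn ℝ 2 w S) (hy : y ∈ S)
    (k : Fin n) : DifferentiableAt ℝ (gradCoord G w k) y := by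
  unfold gradCoord
  exact DifferentiableAt.fun_sum fun l _ => (h.differentiableAt hy (h.smooth_inv k l)).fun_mul
    (h.differentiableAt_partialD hw hy l)

theorem inv_conformal (h : IsMetricOn G S) (hy : y ∈ S) :
    (Real.exp (2 * w y) • G y)⁻¹ = Real.exp (-(2 * w y)) • (G y)⁻¹ := by
  have : IsUnit (Real.exp (2 * w y)) := (Real.exp_pos _).ne'.isUnit
  refine inv_eq_left_inv ?_
  rw [smul_mul_smul_comm, nonsing_inv_mul _ (h.isUnit_det hy), ← Real.exp_add]
  simp

/-- The derivative of e^{2w}G is e^{2w}(2 dw ⊗ G + ∂G), and the exponential cancels against that of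
the inverse; contracting G⁻¹ with G leaves the Kronecker deltas of the shift. -/
theorem christoffel_conformal (h : IsMetricOn G S) (hw : ContDiffOn ℝ 2 w S) (hy : y ∈ S)
    (k i j : Fin n) :
    christoffel (fun z => Real.exp (2 * w z) • G z) k i j y = christoffel G k i j y
      + conformalShift (G y) (fun a => partialD a w y) (fun a => gradCoord G w a y) k i j := by
  have dw : DifferentiableAt ℝ w y :=
    (hw.contDiffAt (h.isOpen.mem_nhds hy)).differentiableAt (by simp)
  have e1 : ∀ a b c, partialD a (fun z => (Real.exp (2 * w z) • G z) b c) y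
      = Real.exp (2 * w y) * (2 * partialD a w y * G y b c + partialD a (fun z => G z b c) y) := by
    intro a b c
    simp only [Matrix.smul_apply, smul_eq_mul]
    rw [partialD_mul (dw.const_mul 2).exp (h.differentiableAt hy (h.smooth b c)),
      partialD_exp (dw.const_mul 2), partialD_const_mul _ dw]
    ring
  unfold christoffel
  simp_rw [e1, h.inv_conformal hy, Matrix.smul_apply, smul_eq_mul]
  have e2 : Real.exp (-(2 * w y)) * Real.exp (2 * w y) = 1 := by
    rw [← Real.exp_add]; simp
  have e3 : ∀ l, Real.exp (-(2 * w y)) * (G y)⁻¹ k l *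
      (Real.exp (2 * w y) * (2 * partialD i w y * G y j l + partialD i (fun z => G z j l) y)
        + Real.exp (2 * w y) * (2 * partialD j w y * G y i l + partialD j (fun z => G z i l) y)
        - Real.exp (2 * w y) * (2 * partialD l w y * G y i j + partialD l (fun z => G z i j) y))
      = (G y)⁻¹ k l * (partialD i (fun z => G z j l) y + partialD j (fun z => G z i l) y
          - partialD l (fun z => G z i j) y)
        + 2 * partialD i w y * ((G y)⁻¹ k l * G y l j) + 2 * partialD j w y
          * ((G y)⁻¹ k l * G y l i) - 2 * G y i j * ((G y)⁻¹ k l * partialD l w y) := by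
    intro l
    rw [h.symm hy l j, h.symm hy l i]
    linear_combination ((G y)⁻¹ k l * (2 * partialD i w y * G y j l
      + partialD i (fun z => G z j l) y + (2 * partialD j w y * G y i l
      + partialD j (fun z => G z i l) y) - (2 * partialD l w y * G y i j
      + partialD l (fun z => G z i j) y))) * e2
  simp_rw [e3, Finset.sum_sub_distrib, Finset.sum_add_distrib, ← Finset.mul_sum,
    h.sum_inv_mul hy, conformalShift, gradCoord]
  split_ifs <;> ring

/-- The Ricci tensor of the conformal metric `e^{2w} G`. -/
theorem ricci_conformal (h : IsMetricOn G S) (hw : ContDiffOn ℝ 2 w S) (hy : y ∈ S)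
    (i j : Fin n) :
    ricci (fun z => Real.exp (2 * w z) • G z) y i j = ricci G y i j
      + (n - 2) * (partialD i w y * partialD j w y - covHessian G w i j y)
      - (∑ k, partialD k (gradCoord G w k) y
          + ∑ l, (∑ k, christoffel G k k l y) * gradCoord G w l y
          + (n - 2) * ∑ l, partialD l w y * gradCoord G w l y) * G y i j := by
  have hsm : ∀ i j, partialD i (partialD j w) y = partialD j (partialD i w) y :=
    fun i j => partialD_comm h.isOpen hw hy i j
  have dG := fun a b => h.differentiableAt hy (h.smooth a b)
  have dW := fun a => h.differentiableAt_gradCoord hw hy a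
  have dP := fun a => h.differentiableAt_partialD hw hy a
  have e1 : ∀ m k i j, partialD m (christoffel (fun z => Real.exp (2 * w z) • G z) k i j) y
      = partialD m (christoffel G k i j) y + ((if k = i then partialD m (partialD j w) y else 0)
        + (if k = j then partialD m (partialD i w) y else 0)
        - (partialD m (fun z => G z i j) y * gradCoord G w k y
          + G y i j * partialD m (gradCoord G w k) y)) := by
    intro m k i j
    rw [partialD_congr h.isOpen (fun z hz => h.christoffel_conformal hw hz k i j) hy]
    unfold conformalShift
    have d1 : DifferentiableAt ℝ (fun z => if k = i then partialD j w z else 0) y := by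
      split_ifs
      · exact dP j
      · exact differentiableAt_const _
    have d2 : DifferentiableAt ℝ (fun z => if k = j then partialD i w z else 0) y := by
      split_ifs
      · exact dP i
      · exact differentiableAt_const _
    have d3 := (dG i j).fun_mul (dW k)
    rw [partialD_add (h.differentiableAt hy (h.smooth_christoffel k i j)) ((d1.fun_add d2).fun_sub d3),
      partialD_sub (d1.fun_add d2) d3, partialD_add d1 d2, partialD_mul (dG i j) (dW k)]
    congr 3
    · split_ifs
      · rfl
      · exact partialD_const _ _
    · split_ifs
      · rfl
      · exact partialD_const _ _
  -- Differentiating g_{ik} W^k = ∂_i w: the derivative of the contracted shift becomes a plain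
  -- second derivative of w.
  have hlow' : ∑ k, (partialD j (fun z => G z i k) y * gradCoord G w k y
      + G y i k * partialD j (gradCoord G w k) y) = partialD j (partialD i w) y := by
    rw [← partialD_congr h.isOpen (fun z hz => h.lower_gradCoord (w := w) hz i) hy,
      partialD_sum (fun k _ => (dG i k).fun_mul (dW k))]
    simp_rw [partialD_mul (dG i _) (dW _)]
  have e2 : ∑ k, (partialD k (christoffel (fun z => Real.exp (2 * w z) • G z) k i j) y
        - partialD j (christoffel (fun z => Real.exp (2 * w z) • G z) k i k) y)
      = ∑ k, (partialD k (christoffel G k i j) y - partialD j (christoffel G k i k) y)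
        + (2 - n) * partialD j (partialD i w) y
        - ∑ k, partialD k (fun z => G z i j) y * gradCoord G w k y
        - G y i j * ∑ k, partialD k (gradCoord G w k) y := by
    simp_rw [e1, Finset.sum_sub_distrib, Finset.sum_add_distrib, Finset.sum_sub_distrib, hlow',
      Finset.sum_add_distrib, ← Finset.mul_sum]
    simp only [Finset.sum_ite_eq', Finset.mem_univ, if_true,
      Finset.sum_const, Finset.card_univ, Fintype.card_fin, nsmul_eq_mul]
    rw [hsm i j]
    ring
  have e3 := conformal_quadratic (g := G y) (u := fun a => partialD a w y)
    (W := fun a => gradCoord G w a y) (Γ := fun k i j => christoffel G k i j y)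
    (fun i => h.lower_gradCoord hy i) (h.symm hy) (h.christoffel_symm hy) i j
  simp only [ricci, of_apply]
  simp_rw [e2, h.christoffel_conformal hw hy]
  rw [e3]
  -- Metric compatibility cancels ∂_l g_{ij} W^l from the derivative part against the Γ·W terms of
  -- the quadratic part.
  simp_rw [h.partialD_eq hy, covHessian]
  ring

/-- The two expressions for the Laplacian of `w`. -/
theorem sum_partialD_gradCoord (h : IsMetricOn G S) (hw : ContDiffOn ℝ 2 w S) (hy : y ∈ S) :
    ∑ k, partialD k (gradCoord G w k) y
        + ∑ l, (∑ k, christoffel G k k l y) * gradCoord G w l y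
      = ∑ i, ∑ j, (G y)⁻¹ i j * covHessian G w i j y := by
  have dG := fun a b => h.differentiableAt hy (h.smooth a b)
  have dW := fun a => h.differentiableAt_gradCoord hw hy a
  have hlow' : ∀ i j, partialD j (partialD i w) y
      = ∑ k, (partialD j (fun z => G z i k) y * gradCoord G w k y
        + G y i k * partialD j (gradCoord G w k) y) := by
    intro i j
    rw [← partialD_congr h.isOpen (fun z hz => h.lower_gradCoord (w := w) hz i) hy,
      partialD_sum (fun k _ => (dG i k).fun_mul (dW k))]
    simp_rw [partialD_mul (dG i _) (dW _)]
  -- The Hessian is the covariant derivative of the gradient with an index lowered; raising it again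
  -- in `hfin` makes its trace a divergence.
  have hcov : ∀ i j, covHessian G w i j y
      = ∑ k, G y i k * (partialD j (gradCoord G w k) y
          + ∑ l, christoffel G k l j y * gradCoord G w l y) := by
    intro i j
    unfold covHessian
    rw [hlow']
    simp_rw [h.partialD_eq hy, Finset.sum_add_distrib, mul_add, add_mul, Finset.sum_add_distrib]
    have f1 : ∑ k, (∑ a, G y i a * christoffel G a k j y) * gradCoord G w k y
        = ∑ k, G y i k * ∑ l, christoffel G k l j y * gradCoord G w l y := by
      simp_rw [Finset.sum_mul, Finset.mul_sum]
      rw [Finset.sum_comm]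
      exact Finset.sum_congr rfl fun a _ => Finset.sum_congr rfl fun b _ => by ring
    have f2 : ∑ k, (∑ a, G y k a * christoffel G a i j y) * gradCoord G w k y
        = ∑ k, christoffel G k i j y * partialD k w y := by
      simp_rw [← h.lower_gradCoord (w := w) hy, Finset.sum_mul, Finset.mul_sum]
      rw [Finset.sum_comm]
      refine Finset.sum_congr rfl fun a _ => Finset.sum_congr rfl fun b _ => ?_
      rw [h.symm hy b a]; ring
    rw [f1, f2]
    ring
  have hfin : ∀ j, ∑ i, (G y)⁻¹ i j * covHessian G w i j y
      = partialD j (gradCoord G w j) y + ∑ l, christoffel G j l j y * gradCoord G w l y := by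
    intro j
    have h1 : ∀ i, (G y)⁻¹ i j * covHessian G w i j y
        = ∑ k, ((G y)⁻¹ j i * G y i k) * (partialD j (gradCoord G w k) y
          + ∑ l, christoffel G k l j y * gradCoord G w l y) := by
      intro i
      rw [hcov, Finset.mul_sum, h.inv_symm hy i j]
      exact Finset.sum_congr rfl fun k _ => by ring
    simp_rw [h1]
    rw [Finset.sum_comm]
    simp_rw [← Finset.sum_mul, h.sum_inv_mul hy]
    simp
  rw [Finset.sum_comm]
  simp_rw [hfin, Finset.sum_add_distrib]
  congr 1
  simp_rw [Finset.sum_mul]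
  rw [Finset.sum_comm]
  refine Finset.sum_congr rfl fun a _ => Finset.sum_congr rfl fun b _ => ?_
  rw [h.christoffel_symm hy]

/-- The Schouten tensor of the conformal metric `e^{2w} G`. -/
theorem schouten_conformal (h : IsMetricOn G S) (hn : 3 ≤ n) (hw : ContDiffOn ℝ 2 w S)
    (hy : y ∈ S) :
    schouten (fun z => Real.exp (2 * w z) • G z) y
      = -conformalHessian (christoffel G) G (schouten G) w y := by
  have hn2 : (n : ℝ) - 2 ≠ 0 := by
    have : (3 : ℝ) ≤ n := by exact_mod_cast hn
    linarith
  have hn1 : (n : ℝ) - 1 ≠ 0 := by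
    have : (3 : ℝ) ≤ n := by exact_mod_cast hn
    linarith
  set N := ∑ l, partialD l w y * gradCoord G w l y with hN
  set Lap := ∑ i, ∑ j, (G y)⁻¹ i j * covHessian G w i j y with hLap
  have hric := fun i j => h.ricci_conformal hw hy i j
  simp_rw [h.sum_partialD_gradCoord hw hy, ← hLap, ← hN] at hric
  have e2 : Real.exp (-(2 * w y)) * Real.exp (2 * w y) = 1 := by
    rw [← Real.exp_add]; simp
  have hNinv : ∑ k, ∑ l, (G y)⁻¹ k l * partialD k w y * partialD l w y = N := by
    rw [hN]
    refine Finset.sum_congr rfl fun k _ => ?_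
    rw [gradCoord, Finset.mul_sum]
    exact Finset.sum_congr rfl fun l _ => by ring
  have htr : ∑ i, ∑ j, (G y)⁻¹ i j * G y i j = n := by
    have : ∀ i, ∑ j, (G y)⁻¹ i j * G y i j = 1 := by
      intro i
      have := h.sum_inv_mul hy i i
      rw [if_pos rfl] at this
      rw [← this]
      exact Finset.sum_congr rfl fun j _ => by rw [h.symm hy i j]
    simp [this]
  -- The factor e^{-2w} here cancels against e^{2w} in the product of scalar curvature and metric,
  -- so the Schouten tensor changes without an exponential.
  have hscal : scalarCurvature (fun z => Real.exp (2 * w z) • G z) y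
      = Real.exp (-(2 * w y)) * (scalarCurvature G y + (n - 2) * (N - Lap)
        - (Lap + (n - 2) * N) * n) := by
    unfold scalarCurvature
    simp_rw [h.inv_conformal hy, hric, Matrix.smul_apply, smul_eq_mul, mul_assoc,
      ← Finset.mul_sum]
    congr 1
    have h1 : ∀ i j, (G y)⁻¹ i j * (ricci G y i j
          + (n - 2) * (partialD i w y * partialD j w y - covHessian G w i j y)
          - (Lap + (n - 2) * N) * G y i j)
        = (G y)⁻¹ i j * ricci G y i j
          + (n - 2) * ((G y)⁻¹ i j * partialD i w y * partialD j w y)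
          - (n - 2) * ((G y)⁻¹ i j * covHessian G w i j y)
          - (Lap + (n - 2) * N) * ((G y)⁻¹ i j * G y i j) := fun i j => by ring
    simp_rw [h1, Finset.sum_sub_distrib, Finset.sum_add_distrib, ← Finset.mul_sum, htr, hNinv,
      ← hLap]
    ring
  ext i j
  simp only [schouten, Matrix.smul_apply, Matrix.sub_apply, Matrix.neg_apply, smul_eq_mul,
    conformalHessian, of_apply]
  rw [hscal, hric, hNinv]
  have hcov : covHessian G w i j y = partialD j (partialD i w) y
    - ∑ k, christoffel G k i j y * partialD k w y := rfl
  rw [hcov]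
  have e3 : ∀ x g : ℝ, Real.exp (-(2 * w y)) * x / (2 * (n - 1)) * (Real.exp (2 * w y) * g)
      = x / (2 * (n - 1)) * g := fun x g => by
    linear_combination (x / (2 * (n - 1)) * g) * e2
  rw [e3]
  field_simp
  ring

end IsMetricOn

end ConformalChange

end

/-! ### Uniform bounds on the connection and the curvature -/

noncomputable section

section UniformBounds

open Matrix

variable {n : ℕ} {ι : Type*} {S : ι → Set (EuclideanSpace ℝ (Fin n))}

/-- The functions `h a` are smooth on `S a`, and their partial derivatives up to order `k` are
bounded there, uniformly in `a`. -/
def UniformlyBounded (S : ι → Set (EuclideanSpace ℝ (Fin n))) :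
    ℕ → (ι → EuclideanSpace ℝ (Fin n) → ℝ) → Prop
  | 0, h => (∀ a, ContDiffOn ℝ ∞ (h a) (S a)) ∧ ∃ C, ∀ a, ∀ y ∈ S a, |h a y| ≤ C
  | k + 1, h => ((∀ a, ContDiffOn ℝ ∞ (h a) (S a)) ∧ ∃ C, ∀ a, ∀ y ∈ S a, |h a y| ≤ C) ∧
      ∀ i, UniformlyBounded S k fun a => partialD i (h a)

namespace UniformlyBounded

variable {h h₁ h₂ : ι → EuclideanSpace ℝ (Fin n) → ℝ} {k : ℕ}

theorem zero (hh : UniformlyBounded S k h) : UniformlyBounded S 0 h := by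
  cases k with
  | zero => exact hh
  | succ k => exact hh.1

theorem smooth (hh : UniformlyBounded S k h) (a : ι) : ContDiffOn ℝ ∞ (h a) (S a) := hh.zero.1 a

theorem differentiableAt (hS : ∀ a, IsOpen (S a)) (hh : UniformlyBounded S k h) {a : ι}
    {y : EuclideanSpace ℝ (Fin n)} (hy : y ∈ S a) : DifferentiableAt ℝ (h a) y :=
  ((hh.smooth a).contDiffAt ((hS a).mem_nhds hy)).differentiableAt (by simp)

theorem partialD (hh : UniformlyBounded S (k + 1) h) (i : Fin n) :
    UniformlyBounded S k fun a => partialD i (h a) := hh.2 i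

theorem pred (hh : UniformlyBounded S (k + 1) h) : UniformlyBounded S k h := by
  induction k generalizing h with
  | zero => exact hh.1
  | succ k ih => exact ⟨hh.1, fun i => ih (hh.2 i)⟩

theorem congr (hS : ∀ a, IsOpen (S a)) (hh : UniformlyBounded S k h₁)
    (heq : ∀ a, ∀ y ∈ S a, h₂ a y = h₁ a y) : UniformlyBounded S k h₂ := by
  have h0 : ∀ {h₁ h₂ : ι → EuclideanSpace ℝ (Fin n) → ℝ}, UniformlyBounded S 0 h₁ →
      (∀ a, ∀ y ∈ S a, h₂ a y = h₁ a y) → UniformlyBounded S 0 h₂ := by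
    intro h₁ h₂ hb he
    obtain ⟨hs, C, hC⟩ := hb
    exact ⟨fun a => (hs a).congr (he a), C, fun a y hy => by rw [he a y hy]; exact hC a y hy⟩
  induction k generalizing h₁ h₂ with
  | zero => exact h0 hh heq
  | succ k ih =>
    exact ⟨h0 hh.zero heq, fun i => ih (hh.2 i) fun a y hy => partialD_congr (hS a) (heq a) hy i⟩

theorem const (c : ℝ) : UniformlyBounded S k fun _ _ => c := by
  have h0 : ∀ c : ℝ, UniformlyBounded S 0 fun _ _ => c := fun c =>
    ⟨fun _ => contDiffOn_const, |c|, fun _ _ _ => le_rfl⟩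
  induction k generalizing c with
  | zero => exact h0 c
  | succ k ih =>
    refine ⟨h0 c, fun i => ?_⟩
    have : (fun a : ι => _root_.partialD i (fun _ : EuclideanSpace ℝ (Fin n) => c))
        = fun _ _ => 0 := by
      ext a y; exact partialD_const c i
    rw [this]
    exact ih 0

theorem add (hS : ∀ a, IsOpen (S a)) (hh₁ : UniformlyBounded S k h₁)
    (hh₂ : UniformlyBounded S k h₂) : UniformlyBounded S k fun a y => h₁ a y + h₂ a y := by
  have h0 : ∀ {h₁ h₂ : ι → EuclideanSpace ℝ (Fin n) → ℝ}, UniformlyBounded S 0 h₁ →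
      UniformlyBounded S 0 h₂ → UniformlyBounded S 0 fun a y => h₁ a y + h₂ a y := by
    rintro h₁ h₂ ⟨s₁, C₁, b₁⟩ ⟨s₂, C₂, b₂⟩
    exact ⟨fun a => (s₁ a).add (s₂ a), C₁ + C₂, fun a y hy =>
      (abs_add_le _ _).trans (add_le_add (b₁ a y hy) (b₂ a y hy))⟩
  induction k generalizing h₁ h₂ with
  | zero => exact h0 hh₁ hh₂
  | succ k ih =>
    refine ⟨h0 hh₁.zero hh₂.zero, fun i => (ih (hh₁.2 i) (hh₂.2 i)).congr hS fun a y hy => ?_⟩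
    exact partialD_add (hh₁.differentiableAt hS hy) (hh₂.differentiableAt hS hy) i

theorem mul (hS : ∀ a, IsOpen (S a)) (hh₁ : UniformlyBounded S k h₁)
    (hh₂ : UniformlyBounded S k h₂) : UniformlyBounded S k fun a y => h₁ a y * h₂ a y := by
  have h0 : ∀ {h₁ h₂ : ι → EuclideanSpace ℝ (Fin n) → ℝ}, UniformlyBounded S 0 h₁ →
      UniformlyBounded S 0 h₂ → UniformlyBounded S 0 fun a y => h₁ a y * h₂ a y := by
    rintro h₁ h₂ ⟨s₁, C₁, b₁⟩ ⟨s₂, C₂, b₂⟩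
    exact ⟨fun a => (s₁ a).mul (s₂ a), C₁ * C₂, fun a y hy =>
      abs_mul_le_mul (b₁ a y hy) (b₂ a y hy)⟩
  induction k generalizing h₁ h₂ with
  | zero => exact h0 hh₁ hh₂
  | succ k ih =>
    refine ⟨h0 hh₁.zero hh₂.zero, fun i => ((ih (hh₁.2 i) hh₂.pred).add hS
      (ih hh₁.pred (hh₂.2 i))).congr hS fun a y hy => ?_⟩
    exact partialD_mul (hh₁.differentiableAt hS hy) (hh₂.differentiableAt hS hy) i

theorem const_mul (hS : ∀ a, IsOpen (S a)) (c : ℝ) (hh : UniformlyBounded S k h) :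
    UniformlyBounded S k fun a y => c * h a y := (const c).mul hS hh

theorem sub (hS : ∀ a, IsOpen (S a)) (hh₁ : UniformlyBounded S k h₁)
    (hh₂ : UniformlyBounded S k h₂) : UniformlyBounded S k fun a y => h₁ a y - h₂ a y :=
  (hh₁.add hS (hh₂.const_mul hS (-1))).congr hS fun a y _ => by ring

theorem sum (hS : ∀ a, IsOpen (S a)) {κ : Type*} {s : Finset κ}
    {F : κ → ι → EuclideanSpace ℝ (Fin n) → ℝ} (hF : ∀ j ∈ s, UniformlyBounded S k (F j)) :
    UniformlyBounded S k fun a y => ∑ j ∈ s, F j a y := by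
  classical
  induction s using Finset.induction_on with
  | empty => simpa using const (S := S) (k := k) 0
  | insert j s hj ih =>
    simp only [Finset.sum_insert hj]
    exact (hF j (Finset.mem_insert_self _ _)).add hS
      (ih fun i hi => hF i (Finset.mem_insert_of_mem hi))

/-- Evaluating a derivative on a unit coordinate vector does not increase its norm, so the same K
serves at every order of the induction. -/
theorem of_iteratedFDeriv (hS : ∀ a, IsOpen (S a)) (hs : ∀ a, ContDiffOn ℝ ∞ (h a) (S a)) {K : ℝ}
    (hK : ∀ a, ∀ y ∈ S a, ∀ j ≤ k, ‖iteratedFDeriv ℝ j (h a) y‖ ≤ K) :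
    UniformlyBounded S k h := by
  have h0 : ∀ a, ∀ y ∈ S a, |h a y| ≤ K := fun a y hy => by
    have := hK a y hy 0 (Nat.zero_le _)
    rwa [norm_iteratedFDeriv_zero, Real.norm_eq_abs] at this
  induction k generalizing h with
  | zero => exact ⟨hs, K, h0⟩
  | succ k ih =>
    have step : ∀ i, ∀ a, ∀ y ∈ S a, ∀ j ≤ k,
        ‖iteratedFDeriv ℝ j (_root_.partialD i (h a)) y‖ ≤ K := by
      intro i a y hy j hj
      have hc : ContDiffAt ℝ j (fderiv ℝ (h a)) y :=
        (((hs a).contDiffAt ((hS a).mem_nhds hy)).fderiv_right (m := ∞) (by simp)).of_le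
          (by exact_mod_cast le_top)
      have h1 := norm_iteratedFDeriv_clm_apply_const (𝕜 := ℝ) (c := EuclideanSpace.single i (1 : ℝ))
        hc le_rfl
      rw [norm_iteratedFDeriv_fderiv] at h1
      refine h1.trans ?_
      simpa using hK a y hy (j + 1) (by omega)
    refine ⟨⟨hs, K, h0⟩, fun i => ih (fun a => (hs a).partialD (hS a) (by simp) i) (step i)
      fun a y hy => ?_⟩
    have := step i a y hy 0 (Nat.zero_le _)
    rwa [norm_iteratedFDeriv_zero, Real.norm_eq_abs] at this

theorem exists_c1Bound (hS : ∀ a, IsOpen (S a)) (hh : UniformlyBounded S 1 h) :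
    ∃ B : ℝ, ∀ a, C1Bound B (h a) (S a) := by
  obtain ⟨C, hC⟩ := hh.1.2
  have h1 : ∀ i, ∃ C, ∀ a, ∀ y ∈ S a, |_root_.partialD i (h a) y| ≤ C := fun i => (hh.2 i).2
  choose D hD using h1
  obtain ⟨M, hM⟩ := Finite.bddAbove_range D
  refine ⟨max C M, fun a y hy => ⟨hh.differentiableAt hS hy, (hC a y hy).trans (le_max_left _ _),
    fun i => (hD i a y hy).trans ((hM ⟨i, rfl⟩).trans (le_max_right _ _))⟩⟩

theorem exists_c1Bound_family (hS : ∀ a, IsOpen (S a)) {κ : Type*} [Finite κ]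
    {F : κ → ι → EuclideanSpace ℝ (Fin n) → ℝ} (hF : ∀ j, UniformlyBounded S 1 (F j)) :
    ∃ B : ℝ, ∀ j a, C1Bound B (F j a) (S a) := by
  choose D hD using fun j => (hF j).exists_c1Bound hS
  obtain ⟨M, hM⟩ := Finite.bddAbove_range D
  refine ⟨M, fun j a y hy => ?_⟩
  obtain ⟨h1, h2, h3⟩ := hD j a y hy
  have hj : D j ≤ M := hM ⟨j, rfl⟩
  exact ⟨h1, h2.trans hj, fun i => (h3 i).trans hj⟩

end UniformlyBounded

theorem C1Bound.mono {B B' : ℝ} {c : EuclideanSpace ℝ (Fin n) → ℝ}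
    {T : Set (EuclideanSpace ℝ (Fin n))} (h : C1Bound B c T) (hB : B ≤ B') : C1Bound B' c T :=
  fun y hy => ⟨(h y hy).1, (h y hy).2.1.trans hB, fun i => ((h y hy).2.2 i).trans hB⟩

/-- The connection and the curvature of a metric that is bounded in `C³`, together with its
inverse, are bounded in `C¹`. -/
theorem exists_curvature_bound (n : ℕ) (K : ℝ) :
    ∃ B : ℝ, 1 ≤ B ∧ ∀ (G : EuclideanSpace ℝ (Fin n) → Matrix (Fin n) (Fin n) ℝ)
      (S : Set (EuclideanSpace ℝ (Fin n))), IsMetricOn G S →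
      (∀ y ∈ S, ∀ i j, |(G y)⁻¹ i j| ≤ K ∧
        ∀ k : ℕ, k ≤ 3 → ‖iteratedFDeriv ℝ k (fun z => G z i j) y‖ ≤ K) →
      (∀ k i j, C1Bound B (christoffel G k i j) S) ∧ (∀ i j, C1Bound B (fun y => G y i j) S) ∧
      (∀ i j, C1Bound B (fun y => (G y)⁻¹ i j) S) ∧
      ∀ i j, C1Bound B (fun y => schouten G y i j) S := by
  -- All metrics with the given bounds are treated as one family. A bound uniform over this index
  -- depends only on n and K, and no explicit constants have to be tracked.
  let ι := {a : (EuclideanSpace ℝ (Fin n) → Matrix (Fin n) (Fin n) ℝ) ×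
    Set (EuclideanSpace ℝ (Fin n)) // IsMetricOn a.1 a.2 ∧ ∀ y ∈ a.2, ∀ i j, |(a.1 y)⁻¹ i j| ≤ K ∧
        ∀ k : ℕ, k ≤ 3 → ‖iteratedFDeriv ℝ k (fun z => a.1 z i j) y‖ ≤ K}
  let S : ι → Set (EuclideanSpace ℝ (Fin n)) := fun a => a.1.2
  have hS : ∀ a, IsOpen (S a) := fun a => a.2.1.isOpen
  have hG : ∀ i j, UniformlyBounded S 3 fun a y => a.1.1 y i j := fun i j =>
    .of_iteratedFDeriv hS (fun a => a.2.1.smooth i j) fun a y hy k hk => (a.2.2 y hy i j).2 k hk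
  have hdG : ∀ k i j, UniformlyBounded S 2 fun a => partialD k (fun z => a.1.1 z i j) :=
    fun k i j => (hG i j).partialD k
  have hI0 : ∀ i j, UniformlyBounded S 0 fun a y => (a.1.1 y)⁻¹ i j := fun i j =>
    ⟨fun a => a.2.1.smooth_inv i j, K, fun a y hy => (a.2.2 y hy i j).1⟩
  -- Bootstrap: ∂G⁻¹ = -G⁻¹ ∂G G⁻¹ gains one derivative of the inverse at a time from the pointwise
  -- bound.
  have hIstep : ∀ k : ℕ, (∀ i j c, UniformlyBounded S k fun a => partialD c (fun z => a.1.1 z i j)) →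
      (∀ i j, UniformlyBounded S k fun a y => (a.1.1 y)⁻¹ i j) →
      ∀ i j, UniformlyBounded S (k + 1) fun a y => (a.1.1 y)⁻¹ i j := by
    intro k hd hI i j
    refine ⟨hI0 i j, fun c => ?_⟩
    refine ((UniformlyBounded.sum hS fun p (_ : p ∈ Finset.univ) =>
      UniformlyBounded.sum hS fun q (_ : q ∈ Finset.univ) =>
        ((hI i p).mul hS (hd p q c)).mul hS (hI q j)).const_mul hS (-1)).congr hS fun a y hy => ?_
    rw [a.2.1.partialD_inv hy, neg_one_mul]
  have hI1 := hIstep 0 (fun i j c => (hdG c i j).pred.pred) hI0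
  have hI2 := hIstep 1 (fun i j c => (hdG c i j).pred) hI1
  have hΓ : ∀ k i j, UniformlyBounded S 2 fun a => christoffel a.1.1 k i j := by
    intro k i j
    unfold christoffel
    exact (UniformlyBounded.sum hS fun l _ => (hI2 k l).mul hS
      (((hdG i j l).add hS (hdG j i l)).sub hS (hdG l i j))).const_mul hS _
  have hR : ∀ i j, UniformlyBounded S 1 fun a y => ricci a.1.1 y i j := by
    intro i j
    simp only [ricci, of_apply]
    exact (UniformlyBounded.sum hS fun k _ =>
      ((hΓ k i j).partialD k).sub hS ((hΓ k i k).partialD j)).add hS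
      (UniformlyBounded.sum hS fun k _ => UniformlyBounded.sum hS fun l _ =>
        ((hΓ k k l).pred.mul hS (hΓ l i j).pred).sub hS ((hΓ k j l).pred.mul hS (hΓ l i k).pred))
  have hA : ∀ i j, UniformlyBounded S 1 fun a y => schouten a.1.1 y i j := by
    intro i j
    have hs : UniformlyBounded S 1 fun a y => scalarCurvature a.1.1 y := by
      unfold scalarCurvature
      exact UniformlyBounded.sum hS fun k _ => UniformlyBounded.sum hS fun l _ =>
        (hI1 k l).mul hS (hR k l)
    refine (((hR i j).sub hS ((hs.const_mul hS (1 / (2 * ((n : ℝ) - 1)))).mul hS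
      (hG i j).pred.pred)).const_mul hS (1 / ((n : ℝ) - 2))).congr hS fun a y _ => ?_
    simp only [schouten, Matrix.smul_apply, Matrix.sub_apply, smul_eq_mul]
    ring
  obtain ⟨B₁, hB₁⟩ := UniformlyBounded.exists_c1Bound_family hS
    (F := fun x : Fin n × Fin n × Fin n => fun a => christoffel a.1.1 x.1 x.2.1 x.2.2)
    fun x => (hΓ x.1 x.2.1 x.2.2).pred
  obtain ⟨B₂, hB₂⟩ := UniformlyBounded.exists_c1Bound_family hS
    (F := fun x : Fin n × Fin n => fun a y => a.1.1 y x.1 x.2) fun x => (hG x.1 x.2).pred.pred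
  obtain ⟨B₃, hB₃⟩ := UniformlyBounded.exists_c1Bound_family hS
    (F := fun x : Fin n × Fin n => fun a y => (a.1.1 y)⁻¹ x.1 x.2) fun x => hI1 x.1 x.2
  obtain ⟨B₄, hB₄⟩ := UniformlyBounded.exists_c1Bound_family hS
    (F := fun x : Fin n × Fin n => fun a y => schouten a.1.1 y x.1 x.2) fun x => hA x.1 x.2
  refine ⟨max 1 (max (max B₁ B₂) (max B₃ B₄)), le_max_left _ _, fun G T hGT hK => ?_⟩
  let a : ι := ⟨(G, T), hGT, hK⟩
  refine ⟨fun k i j => (hB₁ (k, i, j) a).mono ?_, fun i j => (hB₂ (i, j) a).mono ?_,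
    fun i j => (hB₃ (i, j) a).mono ?_, fun i j => (hB₄ (i, j) a).mono ?_⟩
  · exact ((le_max_left _ _).trans (le_max_left _ _)).trans (le_max_right _ _)
  · exact ((le_max_right _ _).trans (le_max_left _ _)).trans (le_max_right _ _)
  · exact ((le_max_left _ _).trans (le_max_right _ _)).trans (le_max_right _ _)
  · exact ((le_max_right _ _).trans (le_max_right _ _)).trans (le_max_right _ _)

end UniformBounds

end

/-! ### Coordinate vector fields of a chart -/

section Chart

variable {n : ℕ} {H : Type u} [TopologicalSpace H]
  {I : ModelWithCorners ℝ (EuclideanSpace ℝ (Fin n)) H}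
  {M : Type v} [TopologicalSpace M] [ChartedSpace H M]
  {φ : OpenPartialHomeomorph M (EuclideanSpace ℝ (Fin n))}

/-- The differential of the inverse of a coordinate system. -/
noncomputable def coordMap (I : ModelWithCorners ℝ (EuclideanSpace ℝ (Fin n)) H)
    (φ : OpenPartialHomeomorph M (EuclideanSpace ℝ (Fin n))) (y : EuclideanSpace ℝ (Fin n)) :
    EuclideanSpace ℝ (Fin n) →L[ℝ] TangentSpace I (φ.symm y) :=
  mfderiv 𝓘(ℝ, EuclideanSpace ℝ (Fin n)) I φ.symm y

theorem coordVec_eq (y : EuclideanSpace ℝ (Fin n)) (i : Fin n) :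
    coordVec I φ y i = coordMap I φ y (EuclideanSpace.single i 1) := rfl

theorem coordMap_apply (y ξ : EuclideanSpace ℝ (Fin n)) :
    coordMap I φ y ξ = ∑ i, ξ i • coordVec I φ y i := by
  have h : ξ = ∑ i, ξ i • EuclideanSpace.single i (1 : ℝ) := by
    ext j
    simp [Finset.sum_apply, Pi.single_apply]
  conv_lhs => rw [h, map_sum]
  refine Finset.sum_congr rfl fun i _ => ?_
  rw [map_smul, coordVec_eq]

namespace IsCoordinateChart

theorem mdifferentiableAt_symm (hφ : IsCoordinateChart I φ) {y : EuclideanSpace ℝ (Fin n)}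
    (hy : y ∈ φ.target) :
    MDifferentiableAt 𝓘(ℝ, EuclideanSpace ℝ (Fin n)) I φ.symm y :=
  ((hφ.smooth_symm y hy).contMDiffAt (φ.open_target.mem_nhds hy)).mdifferentiableAt (by simp)

theorem mdifferentiableAt (hφ : IsCoordinateChart I φ) {x : M} (hx : x ∈ φ.source) :
    MDifferentiableAt I 𝓘(ℝ, EuclideanSpace ℝ (Fin n)) φ x :=
  ((hφ.smooth x hx).contMDiffAt (φ.open_source.mem_nhds hx)).mdifferentiableAt (by simp)

/-- The chain rule for φ ∘ φ⁻¹ = id gives a left inverse. -/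
theorem coordMap_injective (hφ : IsCoordinateChart I φ) {y : EuclideanSpace ℝ (Fin n)}
    (hy : y ∈ φ.target) :
    Function.Injective (coordMap I φ y) := by
  have h1 : HasMFDerivAt 𝓘(ℝ, EuclideanSpace ℝ (Fin n)) 𝓘(ℝ, EuclideanSpace ℝ (Fin n))
      (φ ∘ φ.symm) y _ :=
    HasMFDerivAt.comp y (hφ.mdifferentiableAt (φ.map_target hy)).hasMFDerivAt
      (hφ.mdifferentiableAt_symm hy).hasMFDerivAt
  have h2 : HasMFDerivAt 𝓘(ℝ, EuclideanSpace ℝ (Fin n)) 𝓘(ℝ, EuclideanSpace ℝ (Fin n))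
      (φ ∘ φ.symm) y (ContinuousLinearMap.id ℝ _) := by
    refine (hasMFDerivAt_id y).congr_of_eventuallyEq ?_
    filter_upwards [φ.open_target.mem_nhds hy] with z hz
    exact φ.right_inv hz
  have h3 := hasMFDerivAt_unique h1 h2
  intro a b hab
  have h4 : mfderiv I 𝓘(ℝ, EuclideanSpace ℝ (Fin n)) φ (φ.symm y) (coordMap I φ y a) = a :=
    DFunLike.congr_fun h3 a
  have h5 : mfderiv I 𝓘(ℝ, EuclideanSpace ℝ (Fin n)) φ (φ.symm y) (coordMap I φ y b) = b :=
    DFunLike.congr_fun h3 b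
  exact h4.symm.trans ((congrArg _ hab).trans h5)

theorem coordMap_surjective (hφ : IsCoordinateChart I φ) {y : EuclideanSpace ℝ (Fin n)}
    (hy : y ∈ φ.target) :
    Function.Surjective (coordMap I φ y) := by
  have h := hφ.coordMap_injective hy
  exact (LinearMap.injective_iff_surjective (K := ℝ) (V := EuclideanSpace ℝ (Fin n))
    (f := (coordMap I φ y).toLinearMap)).1 h

variable [IsManifold I ∞ M]

/-- The coordinate field is the tangent map of the inverse chart applied to a constant section. -/
theorem contMDiffOn_coordVec (hφ : IsCoordinateChart I φ) (i : Fin n) :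
    ContMDiffOn 𝓘(ℝ, EuclideanSpace ℝ (Fin n)) I.tangent ∞
      (fun y => (⟨φ.symm y, coordVec I φ y i⟩ : TangentBundle I M)) φ.target := by
  have h := hφ.smooth_symm.contMDiffOn_tangentMapWithin (m := ∞) (by simp)
    φ.open_target.uniqueMDiffOn
  have hs : ContMDiff 𝓘(ℝ, EuclideanSpace ℝ (Fin n))
      (𝓘(ℝ, EuclideanSpace ℝ (Fin n))).tangent ∞
      (fun y => (⟨y, (EuclideanSpace.single i 1 : EuclideanSpace ℝ (Fin n))⟩ :
        TangentBundle 𝓘(ℝ, EuclideanSpace ℝ (Fin n)) (EuclideanSpace ℝ (Fin n)))) := by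
    exact (contMDiff_vectorSpace_iff_contDiff (V := fun _ => EuclideanSpace.single i 1)).2 contDiff_const
  refine (h.comp (t := _) hs.contMDiffOn (fun y hy => hy)).congr fun y hy => ?_
  simp only [Function.comp_apply, tangentMapWithin, coordVec,
    mfderivWithin_of_isOpen φ.open_target hy]

variable [RiemannianBundle (fun x : M => TangentSpace I x)]
  [IsContMDiffRiemannianBundle I ∞ (EuclideanSpace ℝ (Fin n)) (fun x : M => TangentSpace I x)]

theorem contDiffOn_metricCoeff (hφ : IsCoordinateChart I φ) (i j : Fin n) :
    ContDiffOn ℝ ∞ (fun y => metricCoeff I φ y i j) φ.target := by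
  rw [← contMDiffOn_iff_contDiffOn]
  exact (hφ.contMDiffOn_coordVec i).inner_bundle (hφ.contMDiffOn_coordVec j)

end IsCoordinateChart
end Chart

/-! ### Riemannian lengths and gradients in coordinates -/

section ChartMetric

variable {n : ℕ} {H : Type u} [TopologicalSpace H]
  {I : ModelWithCorners ℝ (EuclideanSpace ℝ (Fin n)) H}
  {M : Type v} [TopologicalSpace M] [ChartedSpace H M]
  {φ : OpenPartialHomeomorph M (EuclideanSpace ℝ (Fin n))}

theorem dirDeriv_coordMap {h : M → ℝ} {y : EuclideanSpace ℝ (Fin n)}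
    (hφ : IsCoordinateChart I φ) (hy : y ∈ φ.target)
    (hh : MDifferentiableAt I 𝓘(ℝ, ℝ) h (φ.symm y)) (ξ : EuclideanSpace ℝ (Fin n)) :
    dirDeriv I h (φ.symm y) (coordMap I φ y ξ) = ∑ i, ξ i * partialD i (h ∘ φ.symm) y := by
  rw [← fderiv_apply_eq_sum_partialD, ← mfderiv_eq_fderiv,
    mfderiv_comp y hh (hφ.mdifferentiableAt_symm hy)]
  rfl

theorem dirDeriv_coordVec {h : M → ℝ} {y : EuclideanSpace ℝ (Fin n)}
    (hφ : IsCoordinateChart I φ) (hy : y ∈ φ.target)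
    (hh : MDifferentiableAt I 𝓘(ℝ, ℝ) h (φ.symm y)) (i : Fin n) :
    dirDeriv I h (φ.symm y) (coordVec I φ y i) = partialD i (h ∘ φ.symm) y := by
  rw [coordVec_eq, dirDeriv_coordMap hφ hy hh]
  simp

theorem dirDeriv_smul (h : M → ℝ) (x : M) (c : ℝ) (v : TangentSpace I x) :
    dirDeriv I h x (c • v) = c * dirDeriv I h x v :=
  (mfderiv I 𝓘(ℝ, ℝ) h x).map_smul c v

variable [RiemannianBundle (fun x : M => TangentSpace I x)]

theorem inner_coordMap (y ξ η : EuclideanSpace ℝ (Fin n)) :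
    inner ℝ (coordMap I φ y ξ) (coordMap I φ y η)
      = ∑ i, ∑ j, ξ i * η j * metricCoeff I φ y i j := by
  rw [coordMap_apply, coordMap_apply, sum_inner]
  refine Finset.sum_congr rfl fun i _ => ?_
  rw [inner_sum]
  refine Finset.sum_congr rfl fun j _ => ?_
  rw [real_inner_smul_left, real_inner_smul_right, mul_assoc]
  rfl

theorem norm_coordVec_le {y : EuclideanSpace ℝ (Fin n)} {B : ℝ} (hB : 1 ≤ B) (i : Fin n)
    (h : |metricCoeff I φ y i i| ≤ B) : ‖coordVec I φ y i‖ ≤ B := by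
  have h1 : ‖coordVec I φ y i‖ ^ 2 ≤ B := by
    rw [← real_inner_self_eq_norm_sq]
    exact (le_abs_self _).trans h
  nlinarith [norm_nonneg (coordVec I φ y i)]

theorem norm_coordMap_le {y : EuclideanSpace ℝ (Fin n)} {B : ℝ} (hB : 1 ≤ B)
    (h : ∀ i, |metricCoeff I φ y i i| ≤ B) (ξ : EuclideanSpace ℝ (Fin n)) :
    ‖coordMap I φ y ξ‖ ≤ n * B * ‖ξ‖ := by
  rw [coordMap_apply]
  refine (norm_sum_le _ _).trans ?_
  calc ∑ i, ‖ξ i • coordVec I φ y i‖ ≤ ∑ _i : Fin n, ‖ξ‖ * B := by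
        refine Finset.sum_le_sum fun i _ => ?_
        rw [norm_smul]
        exact mul_le_mul (PiLp.norm_apply_le ξ i) (norm_coordVec_le hB i (h i)) (norm_nonneg _)
          (norm_nonneg _)
    _ = n * B * ‖ξ‖ := by
        rw [Finset.sum_const, Finset.card_univ, Fintype.card_fin, nsmul_eq_mul]
        ring

namespace IsCoordinateChart

theorem posDef_metricCoeff (hφ : IsCoordinateChart I φ) {y : EuclideanSpace ℝ (Fin n)}
    (hy : y ∈ φ.target) : (metricCoeff I φ y).PosDef := by
  refine Matrix.PosDef.of_dotProduct_mulVec_pos ?_ fun ξ hξ => ?_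
  · ext i j
    exact real_inner_comm (coordVec I φ y i) (coordVec I φ y j)
  · have h1 : coordMap I φ y (WithLp.toLp 2 ξ) ≠ 0 := by
      intro h0
      apply hξ
      have := hφ.coordMap_injective hy (h0.trans (map_zero _).symm)
      simpa using this
    have h2 := real_inner_self_pos.2 h1
    rw [inner_coordMap] at h2
    refine h2.trans_eq ?_
    simp only [dotProduct, Matrix.mulVec, Finset.mul_sum]
    refine Finset.sum_congr rfl fun i _ => Finset.sum_congr rfl fun j _ => ?_
    simp only [Pi.star_apply, star_trivial]
    ring

/-- The vector with components g^{ij}, i fixed, is the gradient of the i-th coordinate: its inner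
product with η is η_i and its squared length is g^{ii}. Cauchy–Schwarz concludes. -/
theorem abs_apply_le (hφ : IsCoordinateChart I φ) {y : EuclideanSpace ℝ (Fin n)}
    (hy : y ∈ φ.target) {B : ℝ} (hB : 1 ≤ B) (i : Fin n)
    (h : |(metricCoeff I φ y)⁻¹ i i| ≤ B) (ξ : EuclideanSpace ℝ (Fin n)) :
    |ξ i| ≤ B * ‖coordMap I φ y ξ‖ := by
  have hdet : IsUnit (metricCoeff I φ y).det :=
    isUnit_iff_ne_zero.2 (hφ.posDef_metricCoeff hy).det_pos.ne'
  have key : ∀ η : EuclideanSpace ℝ (Fin n),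
      inner ℝ (coordMap I φ y (WithLp.toLp 2 fun j => (metricCoeff I φ y)⁻¹ i j))
        (coordMap I φ y η) = η i := by
    intro η
    rw [inner_coordMap, Finset.sum_comm]
    have : ∀ j, ∑ k, (metricCoeff I φ y)⁻¹ i k * η j * metricCoeff I φ y k j
        = η j * if i = j then 1 else 0 := by
      intro j
      rw [← Matrix.one_apply, ← Matrix.nonsing_inv_mul _ hdet, Matrix.mul_apply, Finset.mul_sum]
      exact Finset.sum_congr rfl fun k _ => by ring
    refine (Finset.sum_congr rfl fun j _ => this j).trans ?_
    simp
  have h1 := key (WithLp.toLp 2 fun j => (metricCoeff I φ y)⁻¹ i j)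
  rw [real_inner_self_eq_norm_sq] at h1
  simp only at h1
  set V := coordMap I φ y (WithLp.toLp 2 fun j => (metricCoeff I φ y)⁻¹ i j)
  have h2 : ‖V‖ ≤ B := by
    have : ‖V‖ ^ 2 ≤ B := h1.trans_le ((le_abs_self _).trans h)
    nlinarith [norm_nonneg V]
  rw [← key ξ]
  exact (abs_real_inner_le_norm _ _).trans (mul_le_mul_of_nonneg_right h2 (norm_nonneg _))

/-- The metric coefficients, on any open set of coordinates. -/
theorem isMetricOn [IsManifold I ∞ M]
    [IsContMDiffRiemannianBundle I ∞ (EuclideanSpace ℝ (Fin n)) (fun x : M => TangentSpace I x)]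
    (hφ : IsCoordinateChart I φ) {S : Set (EuclideanSpace ℝ (Fin n))} (hS : IsOpen S)
    (hSt : S ⊆ φ.target) : IsMetricOn (metricCoeff I φ) S where
  isOpen := hS
  smooth i j := (hφ.contDiffOn_metricCoeff i j).mono hSt
  posDef _ hy := hφ.posDef_metricCoeff (hSt hy)

variable {h : M → ℝ} {y : EuclideanSpace ℝ (Fin n)} {B : ℝ}

theorem abs_dirDeriv_le (hφ : IsCoordinateChart I φ) (hy : y ∈ φ.target)
    (hh : MDifferentiableAt I 𝓘(ℝ, ℝ) h (φ.symm y)) (hB : 1 ≤ B)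
    (hinv : ∀ i, |(metricCoeff I φ y)⁻¹ i i| ≤ B) {v : TangentSpace I (φ.symm y)}
    (hv : ‖v‖ ≤ 1) :
    |dirDeriv I h (φ.symm y) v| ≤ n * B * √(∑ k, partialD k (h ∘ φ.symm) y ^ 2) := by
  obtain ⟨ξ, rfl⟩ := hφ.coordMap_surjective hy v
  rw [dirDeriv_coordMap hφ hy hh, mul_assoc]
  refine abs_sum_le_card_mul fun i => abs_mul_le_mul ?_ 
    (abs_le_sqrt_sum_sq (fun k => partialD k (h ∘ φ.symm) y) i)
  refine (hφ.abs_apply_le hy hB i (hinv i) ξ).trans ?_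
  exact mul_le_of_le_one_right (by linarith) hv

theorem gradNorm_le (hφ : IsCoordinateChart I φ) (hy : y ∈ φ.target)
    (hh : MDifferentiableAt I 𝓘(ℝ, ℝ) h (φ.symm y)) (hB : 1 ≤ B)
    (hinv : ∀ i, |(metricCoeff I φ y)⁻¹ i i| ≤ B) :
    gradNorm I h (φ.symm y) ≤ n * B * √(∑ k, partialD k (h ∘ φ.symm) y ^ 2) := by
  refine csSup_le ⟨_, 0, by simp, rfl⟩ ?_
  rintro t ⟨v, hv, rfl⟩
  exact hφ.abs_dirDeriv_le hy hh hB hinv hv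

theorem abs_partialD_le (hφ : IsCoordinateChart I φ) (hy : y ∈ φ.target)
    (hh : MDifferentiableAt I 𝓘(ℝ, ℝ) h (φ.symm y)) (hB : 1 ≤ B)
    (hinv : ∀ i, |(metricCoeff I φ y)⁻¹ i i| ≤ B) (hmet : ∀ i, |metricCoeff I φ y i i| ≤ B)
    (i : Fin n) : |partialD i (h ∘ φ.symm) y| ≤ B * gradNorm I h (φ.symm y) := by
  have hB0 : (0 : ℝ) < B := by linarith
  -- A real supremum is only informative for a bounded set, so boundedness must precede the lower
  -- bound on `gradNorm`.
  have hbdd : BddAbove {t : ℝ | ∃ v : TangentSpace I (φ.symm y),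
      ‖v‖ ≤ 1 ∧ t = |dirDeriv I h (φ.symm y) v|} := by
    refine ⟨n * B * √(∑ k, partialD k (h ∘ φ.symm) y ^ 2), ?_⟩
    rintro t ⟨v, hv, rfl⟩
    exact hφ.abs_dirDeriv_le hy hh hB hinv hv
  have h1 : |dirDeriv I h (φ.symm y) (B⁻¹ • coordVec I φ y i)| ≤ gradNorm I h (φ.symm y) := by
    refine le_csSup hbdd ⟨_, ?_, rfl⟩
    rw [norm_smul, Real.norm_of_nonneg (by positivity), inv_mul_le_iff₀ hB0, mul_one]
    exact norm_coordVec_le hB i (hmet i)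
  rw [dirDeriv_smul, dirDeriv_coordVec hφ hy hh, abs_mul, abs_of_nonneg (by positivity),
    inv_mul_le_iff₀ hB0] at h1
  exact h1

end IsCoordinateChart
end ChartMetric

/-! ### Coordinate balls inside Riemannian balls -/

section Ball

open MeasureTheory Filter Topology
open scoped ENNReal

variable {n : ℕ} {H : Type u} [TopologicalSpace H]
  {I : ModelWithCorners ℝ (EuclideanSpace ℝ (Fin n)) H}
  {M : Type v} [TopologicalSpace M] [ChartedSpace H M]
  {φ : OpenPartialHomeomorph M (EuclideanSpace ℝ (Fin n))}
  [RiemannianBundle (fun x : M => TangentSpace I x)]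

/-- The Riemannian length of a coordinate segment on which the metric is bounded. -/
theorem IsCoordinateChart.riemannianEDist_segment_le (hφ : IsCoordinateChart I φ)
    {y ξ : EuclideanSpace ℝ (Fin n)} {a b B : ℝ} (hab : a ≤ b) (hB : 1 ≤ B)
    (ht : ∀ t ∈ Icc a b, y + t • ξ ∈ φ.target)
    (hg : ∀ t ∈ Icc a b, ∀ i, |metricCoeff I φ (y + t • ξ) i i| ≤ B) :
    riemannianEDist I (φ.symm (y + a • ξ)) (φ.symm (y + b • ξ))
      ≤ ENNReal.ofReal (n * B * ‖ξ‖ * (b - a)) := by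
  have hline : ∀ t : ℝ, HasFDerivAt (fun t : ℝ => y + t • ξ)
      ((ContinuousLinearMap.id ℝ ℝ).smulRight ξ) t := fun t =>
    ((hasFDerivAt_id t).smul_const ξ).const_add y
  have hsm : ContMDiffOn 𝓘(ℝ, ℝ) I 1 (fun t : ℝ => φ.symm (y + t • ξ)) (Icc a b) := by
    refine (hφ.smooth_symm.of_le (by simp)).comp (t := φ.target) ?_ ht
    rw [contMDiffOn_iff_contDiffOn]
    fun_prop
  refine (riemannianEDist_le_pathELength hsm rfl rfl hab).trans ?_
  rw [pathELength_eq_lintegral_mfderiv_Icc]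
  have hle : ∀ t ∈ Icc a b,
      ‖mfderiv 𝓘(ℝ, ℝ) I (fun t : ℝ => φ.symm (y + t • ξ)) t (1 : ℝ)‖ₑ
        ≤ ENNReal.ofReal (n * B * ‖ξ‖) := by
    intro t hti
    have h1 : HasMFDerivAt 𝓘(ℝ, ℝ) I (φ.symm ∘ fun t : ℝ => y + t • ξ) t _ :=
      HasMFDerivAt.comp t (hφ.mdifferentiableAt_symm (ht t hti)).hasMFDerivAt
        (hline t).hasMFDerivAt
    have h2 : mfderiv 𝓘(ℝ, ℝ) I (fun t : ℝ => φ.symm (y + t • ξ)) t (1 : ℝ)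
        = coordMap I φ (y + t • ξ) ξ := by
      have h3 := h1.mfderiv
      have h4 : mfderiv 𝓘(ℝ, ℝ) I (φ.symm ∘ fun t : ℝ => y + t • ξ) t (1 : ℝ)
        = coordMap I φ (y + t • ξ) ((1 : ℝ) • ξ) := DFunLike.congr_fun h3 (1 : ℝ)
      rw [one_smul] at h4
      exact h4
    rw [h2, ← ofReal_norm]
    exact ENNReal.ofReal_le_ofReal (norm_coordMap_le hB (hg t hti) ξ)
  refine (setLIntegral_mono' measurableSet_Icc hle).trans ?_
  rw [setLIntegral_const, Real.volume_Icc, ← ENNReal.ofReal_mul (by positivity)]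

variable [IsManifold I ∞ M]
  [IsContMDiffRiemannianBundle I ∞ (EuclideanSpace ℝ (Fin n)) (fun x : M => TangentSpace I x)]

/-- The Riemannian distance is small near each point in the manifold topology; the triangle
inequality does the rest. -/
theorem isOpen_riemannianBall (p : M) (r : ℝ) : IsOpen (riemannianBall I p r) := by
  have : IsManifold I 1 M := IsManifold.of_le (n := ∞) (by simp)
  have : IsContinuousRiemannianBundle (EuclideanSpace ℝ (Fin n))
      (fun x : M => TangentSpace I x) := by
    obtain ⟨g, hg, h⟩ := IsContMDiffRiemannianBundle.exists_contMDiff (IB := I) (n := ∞)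
      (F := EuclideanSpace ℝ (Fin n)) (E := fun x : M => TangentSpace I x)
    exact ⟨g, hg.continuous, h⟩
  rw [isOpen_iff_mem_nhds]
  intro x hx
  have hx' : riemannianEDist I p x < ENNReal.ofReal r := hx
  filter_upwards [eventually_riemannianEDist_lt I x (tsub_pos_of_lt hx')] with z hz
  calc riemannianEDist I p z ≤ riemannianEDist I p x + riemannianEDist I x z :=
        riemannianEDist_triangle
    _ < riemannianEDist I p x + (ENNReal.ofReal r - riemannianEDist I p x) :=
        ENNReal.add_lt_add_left (hx'.trans_le le_top).ne hz
    _ = ENNReal.ofReal r := add_tsub_cancel_of_le hx'.le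

/-- A coordinate ball of controlled radius about a point of `B_{r/2}` lies in `B_r`. -/
theorem IsInteriorBall.coordinate_ball_subset [T2Space M] {p : M} {r : ℝ}
    (hb : IsInteriorBall I p r)
    (hφ : IsCoordinateChart I φ) (hsub : riemannianBall I p r ⊆ φ.source) {B : ℝ} (hB : 1 ≤ B)
    (hn : 0 < n) (hg : ∀ x ∈ riemannianBall I p r, ∀ i, |metricCoeff I φ (φ x) i i| ≤ B)
    {x : M} (hx : x ∈ riemannianBall I p (r / 2)) :
    Metric.ball (φ x) (r / (4 * (n * B))) ⊆ φ.target ∩ φ.symm ⁻¹' riemannianBall I p r := by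
  have hr := hb.radius_pos
  have hnB : (0 : ℝ) < n * B := mul_pos (by exact_mod_cast hn) (by linarith)
  have hlt : ∀ {σ : ℝ} {z : M}, riemannianEDist I p z ≤ ENNReal.ofReal σ → σ < r →
      z ∈ riemannianBall I p r := fun hz hσ =>
    hz.trans_lt ((ENNReal.ofReal_lt_ofReal_iff hr).2 hσ)
  have hxr : x ∈ riemannianBall I p r := hlt (le_of_lt hx) (half_lt_self hr)
  have hxs := hsub hxr
  -- Compactness of the smaller closed balls makes their chart images closed in ℝⁿ; this is what
  -- keeps the segment below from leaving the chart.
  have hclosed : ∀ σ < r, IsClosed (φ '' {z | riemannianEDist I p z ≤ ENNReal.ofReal σ}) :=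
    fun σ hσ => ((hb.compact_closedBall σ hσ).image_of_continuousOn
      (φ.continuousOn.mono fun z hz => hsub (hlt hz hσ))).isClosed
  intro y hy
  set ξ := y - φ x with hξ
  have hξn : n * B * ‖ξ‖ ≤ r / 4 := by
    have h1 : ‖ξ‖ < r / (4 * (n * B)) := by rwa [hξ, ← dist_eq_norm]
    rw [lt_div_iff₀ (by positivity)] at h1
    linarith
  set γ : ℝ → EuclideanSpace ℝ (Fin n) := fun t => φ x + t • ξ with hγ
  have hγc : Continuous γ := by fun_prop
  -- Continuity method on [0, 1]: from distance at most r/2 the segment gains at most r/4 in length,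
  -- so it stays within 3r/4 < r.
  set s : Set ℝ := {t | γ t ∈ φ.target ∧
    riemannianEDist I p (φ.symm (γ t)) ≤ ENNReal.ofReal (r / 2 + t * (r / 4))} with hs
  have hσ1 : ∀ t ≤ (1 : ℝ), r / 2 + t * (r / 4) < r := fun t ht => by nlinarith
  suffices h1 : (1 : ℝ) ∈ s by
    have e : γ 1 = y := by simp [hγ, hξ]
    rw [hs, mem_ofPred_eq, e] at h1
    exact ⟨h1.1, hlt h1.2 (hσ1 1 le_rfl)⟩
  refine IsClosed.mem_of_ge_of_forall_exists_gt (a := 0) (s := s) ?_ ?_ zero_le_one ?_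
  · refine isClosed_of_closure_subset fun t ht => ?_
    have ht01 : t ∈ Icc (0 : ℝ) 1 := isClosed_Icc.closure_subset_iff.2 inter_subset_right ht
    -- The allowed radius depends on t, so a limit is taken inside one slightly larger closed image;
    -- as t ≤ 1 and ε < 1 its radius is still below r. Then ε → 0 recovers the sharp radius.
    have key : ∀ ε ∈ Ioo (0 : ℝ) 1,
        γ t ∈ φ '' {z | riemannianEDist I p z ≤ ENNReal.ofReal (r / 2 + (t + ε) * (r / 4))} := by
      intro ε hε
      have h1 : r / 2 + (t + ε) * (r / 4) < r := by nlinarith [hε.2, ht01.2]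
      refine (((hclosed _ h1).preimage hγc).closure_subset_iff).2 ?_
        (mem_closure_iff_nhds.2 fun U hU => ?_ :
          t ∈ closure ((s ∩ Icc 0 1) ∩ Iio (t + ε)))
      · rintro t' ⟨⟨⟨h2, h3⟩, h4⟩, h5⟩
        refine ⟨φ.symm (γ t'), h3.trans (ENNReal.ofReal_le_ofReal ?_), φ.right_inv h2⟩
        have : t' < t + ε := h5
        nlinarith
      · have := mem_closure_iff_nhds.1 ht (U ∩ Iio (t + ε))
          (inter_mem hU (Iio_mem_nhds (by linarith [hε.1])))
        obtain ⟨t', ⟨h2, h3⟩, h4⟩ := this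
        exact ⟨t', h2, h4, h3⟩
    have key2 : ∀ ε ∈ Ioo (0 : ℝ) 1, γ t ∈ φ.target ∧
        riemannianEDist I p (φ.symm (γ t)) ≤ ENNReal.ofReal (r / 2 + (t + ε) * (r / 4)) := by
      intro ε hε
      obtain ⟨z, hz, hzt⟩ := key ε hε
      have hzs : z ∈ φ.source := hsub (hlt hz (by nlinarith [hε.2, ht01.2]))
      rw [← hzt, φ.left_inv hzs]
      exact ⟨φ.map_source hzs, hz⟩
    refine ⟨⟨(key2 (1 / 2) (by norm_num)).1, ?_⟩, ht01⟩
    have hlim : Tendsto (fun ε : ℝ => ENNReal.ofReal (r / 2 + (t + ε) * (r / 4))) (𝓝[>] 0)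
        (𝓝 (ENNReal.ofReal (r / 2 + t * (r / 4)))) := by
      refine (ENNReal.continuous_ofReal.tendsto _).comp ?_
      have : Continuous fun ε : ℝ => r / 2 + (t + ε) * (r / 4) := by fun_prop
      have h2 := this.tendsto 0
      rw [add_zero] at h2
      exact h2.mono_left nhdsWithin_le_nhds
    refine ge_of_tendsto hlim ?_
    filter_upwards [Ioo_mem_nhdsGT (zero_lt_one' ℝ)] with ε hε
    exact (key2 ε hε).2
  · refine ⟨?_, ?_⟩
    · simpa [hγ] using φ.map_source hxs
    · simpa [hγ, φ.left_inv hxs] using le_of_lt hx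
  · rintro t ⟨⟨ht1, ht2⟩, ht3⟩
    have hopen : IsOpen (γ ⁻¹' (φ.target ∩ φ.symm ⁻¹' riemannianBall I p r)) :=
      (φ.symm.isOpen_inter_preimage (isOpen_riemannianBall p r)).preimage hγc
    have htm : t ∈ γ ⁻¹' (φ.target ∩ φ.symm ⁻¹' riemannianBall I p r) :=
      ⟨ht1, hlt ht2 (hσ1 t ht3.2.le)⟩
    obtain ⟨δ, hδ, hδs⟩ := Metric.isOpen_iff.1 hopen t htm
    obtain ⟨t', htt', ht'⟩ : ∃ t', t < t' ∧ t' < min (t + δ) 1 :=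
      exists_between (lt_min (by linarith) ht3.2)
    have hIcc : ∀ c ∈ Icc t t', c ∈ γ ⁻¹' (φ.target ∩ φ.symm ⁻¹' riemannianBall I p r) := by
      intro c hc
      apply hδs
      rw [Metric.mem_ball, Real.dist_eq, abs_of_nonneg (by linarith [hc.1])]
      linarith [hc.2, ht'.trans_le (min_le_left _ _)]
    have ht'1 : t' ≤ 1 := (ht'.trans_le (min_le_right _ _)).le
    refine ⟨t', ⟨(hIcc t' ⟨htt'.le, le_rfl⟩).1, ?_⟩, htt', ht'1⟩
    have hseg := hφ.riemannianEDist_segment_le htt'.le hB (fun c hc => (hIcc c hc).1)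
      (fun c hc i => by
        have := hg _ (hIcc c hc).2 i
        rwa [φ.right_inv (hIcc c hc).1] at this)
    calc riemannianEDist I p (φ.symm (γ t'))
        ≤ riemannianEDist I p (φ.symm (γ t)) + riemannianEDist I (φ.symm (γ t)) (φ.symm (γ t')) :=
          riemannianEDist_triangle
      _ ≤ ENNReal.ofReal (r / 2 + t * (r / 4)) + ENNReal.ofReal (n * B * ‖ξ‖ * (t' - t)) :=
          add_le_add ht2 hseg
      _ = ENNReal.ofReal (r / 2 + t * (r / 4) + n * B * ‖ξ‖ * (t' - t)) := by
          have h1 : 0 ≤ t * (r / 4) := mul_nonneg ht3.1 (by positivity)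
          exact (ENNReal.ofReal_add (by linarith)
            (mul_nonneg (by positivity) (by linarith))).symm
      _ ≤ ENNReal.ofReal (r / 2 + t' * (r / 4)) := by
          refine ENNReal.ofReal_le_ofReal ?_
          nlinarith

end Ball

/-- Scaling a matrix scales its vector of eigenvalues. -/
theorem IsEigenvalueVector.smul {n : ℕ} {T : Matrix (Fin n) (Fin n) ℝ} {lam : Fin n → ℝ}
    (h : IsEigenvalueVector T lam) {c : ℝ} (hc : c ≠ 0) :
    IsEigenvalueVector (c • T) (c • lam) := by
  refine Polynomial.funext fun x => ?_
  have h1 := congrArg (Polynomial.eval (c⁻¹ * x)) h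
  have e : Matrix.scalar (Fin n) x - c • T = c • (Matrix.scalar (Fin n) (c⁻¹ * x) - T) := by
    rw [smul_sub]
    congr 1
    ext i j
    by_cases hij : i = j <;> simp [Matrix.scalar_apply, hij, hc]
  rw [Matrix.eval_charpoly] at h1 ⊢
  rw [e, Matrix.det_smul, h1, Polynomial.eval_prod, Polynomial.eval_prod, ← Finset.card_univ,
    ← Finset.prod_const, ← Finset.prod_mul_distrib]
  refine Finset.prod_congr rfl fun i _ => ?_
  simp only [Polynomial.eval_sub, Polynomial.eval_X, Polynomial.eval_C, Pi.smul_apply, smul_eq_mul]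
  rw [mul_sub, mul_inv_cancel_left₀ hc]

/-! ### From the manifold to a coordinate ball -/

section Local

variable {n : ℕ} {H : Type u} [TopologicalSpace H]
  {I : ModelWithCorners ℝ (EuclideanSpace ℝ (Fin n)) H}
  {M : Type v} [TopologicalSpace M] [ChartedSpace H M]
  {φ : OpenPartialHomeomorph M (EuclideanSpace ℝ (Fin n))}
  [RiemannianBundle (fun x : M => TangentSpace I x)]

/-- The matrix of -g_w⁻¹A_{g_w} is e^{-2w} times that of g⁻¹W; homogeneity of f^τ moves the factor
to the right side. -/
theorem exists_eigenvalueVector_of_solves {f : (Fin n → ℝ) → ℝ} {Γ : Set (Fin n → ℝ)} {τ : ℝ}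
    (hf : IsAdmissiblePair f Γ) (hn : 3 ≤ n) {ψ w : M → ℝ}
    {S : Set (EuclideanSpace ℝ (Fin n))} (hm : IsMetricOn (metricCoeff I φ) S)
    (hw : ContDiffOn ℝ 2 (w ∘ φ.symm) S) {y : EuclideanSpace ℝ (Fin n)} (hy : y ∈ S)
    (hyt : y ∈ φ.target)
    (h : ∃ lam : Fin n → ℝ, IsEigenvalueVector (negSchoutenEndo I φ w (φ.symm y)) lam ∧
      lam ∈ coneTau τ Γ ∧ fTau τ f lam = ψ (φ.symm y)) :
    ∃ lam, IsEigenvalueVector ((metricCoeff I φ y)⁻¹ * conformalHessian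
        (christoffel (metricCoeff I φ)) (metricCoeff I φ) (schouten (metricCoeff I φ))
        (w ∘ φ.symm) y) lam ∧
      lam ∈ coneTau τ Γ ∧
      fTau τ f lam = (ψ ∘ φ.symm) y * Real.exp (2 * (w ∘ φ.symm) y) := by
  obtain ⟨lam, h1, h2, h3⟩ := h
  have he := Real.exp_pos (2 * (w ∘ φ.symm) y)
  refine ⟨Real.exp (2 * (w ∘ φ.symm) y) • lam, ?_, hf.smul_mem_coneTau he h2, ?_⟩
  · have h4 := h1.smul he.ne'
    convert h4 using 1
    have e1 : conformalCoeff I φ w = fun z => Real.exp (2 * (w ∘ φ.symm) z) • metricCoeff I φ z :=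
      rfl
    rw [negSchoutenEndo, φ.right_inv hyt, e1, hm.schouten_conformal hn hw hy]
    simp only
    rw [hm.inv_conformal hy, mul_neg, neg_neg, Matrix.smul_mul, smul_smul, ← Real.exp_add]
    simp
  · rw [hf.fTau_smul he h2, h3, mul_comm]
    rfl

variable [IsManifold I ∞ M]
  [IsContMDiffRiemannianBundle I ∞ (EuclideanSpace ℝ (Fin n)) (fun x : M => TangentSpace I x)]

/-- A solution on the manifold gives, in coordinates, a solution on a ball of `ℝⁿ`. -/
theorem isLocalSolution_of_solves {f : (Fin n → ℝ) → ℝ} {Γ : Set (Fin n → ℝ)} {τ : ℝ}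
    (hf : IsAdmissiblePair f Γ) (hn : 3 ≤ n) {ψ w : M → ℝ} {U : Set M} {B L m : ℝ}
    {S : Set (EuclideanSpace ℝ (Fin n))} (hB : 1 ≤ B) (hφ : IsCoordinateChart I φ)
    (hS : IsOpen S) (hSt : S ⊆ φ.target) (hSU : ∀ y ∈ S, φ.symm y ∈ U)
    (hbd : (∀ k i j, C1Bound B (christoffel (metricCoeff I φ) k i j) S) ∧
      (∀ i j, C1Bound B (fun y => metricCoeff I φ y i j) S) ∧
      (∀ i j, C1Bound B (fun y => (metricCoeff I φ y)⁻¹ i j) S) ∧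
      ∀ i j, C1Bound B (fun y => schouten (metricCoeff I φ) y i j) S)
    (hτ : 0 < τ) (hτ1 : τ ≤ 1) (hψ : ContMDiff I 𝓘(ℝ, ℝ) ∞ ψ) (hψ0 : ∀ x, 0 < ψ x)
    (hψL : ∀ x ∈ U, ψ x ≤ L ∧ gradNorm I ψ x ≤ L)
    (hw : ContMDiffOn I 𝓘(ℝ, ℝ) 3 w U) (hsol : SolvesConformalEquation I φ f Γ τ ψ w U)
    (hm : ∀ x ∈ U, w x ≤ m) :
    IsLocalSolution f Γ B (B * max L 0) τ m (christoffel (metricCoeff I φ)) (metricCoeff I φ)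
      (schouten (metricCoeff I φ)) (ψ ∘ φ.symm) (w ∘ φ.symm) S := by
  have hmet := hφ.isMetricOn hS hSt
  have hwS : ContDiffOn ℝ 3 (w ∘ φ.symm) S := by
    rw [← contMDiffOn_iff_contDiffOn]
    exact hw.comp ((hφ.smooth_symm.of_le (WithTop.coe_le_coe.2 le_top)).mono hSt) hSU
  have hψS : ContDiffOn ℝ ∞ (ψ ∘ φ.symm) S := by
    rw [← contMDiffOn_iff_contDiffOn]
    exact hψ.comp_contMDiffOn (hφ.smooth_symm.mono hSt)
  exact
  { isOpen := hS
    tau_pos := hτ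
    tau_le := hτ1
    bound_gam := hbd.1
    bound_metric := hbd.2.1
    bound_inv := hbd.2.2.1
    bound_schouten := hbd.2.2.2
    posDef := hmet.posDef
    gam_symm := fun y hy k i j => hmet.christoffel_symm hy k i j
    schouten_symm := fun y hy i j => hmet.schouten_symm hy i j
    psi_pos := fun y _ => hψ0 _
    -- The constant B max(L, 0) serves both for ψ and for its partial derivatives: coordinate
    -- vectors have length at most B, and L may be negative.
    psi_le := fun y hy => by
      have h1 := (hψL _ (hSU y hy)).1.trans (le_max_left L 0)
      exact h1.trans (le_mul_of_one_le_left (le_max_right _ _) hB)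
    psi_diff := fun y hy => (hψS.differentiableOn (by simp)).differentiableAt (hS.mem_nhds hy)
    dpsi_le := fun y hy i => by
      refine (hφ.abs_partialD_le (hSt hy) (hψ.mdifferentiable (by simp) _) hB
        (fun i => (hbd.2.2.1 i i y hy).2.1) (fun i => (hbd.2.1 i i y hy).2.1) i).trans ?_
      exact mul_le_mul_of_nonneg_left ((hψL _ (hSU y hy)).2.trans (le_max_left _ _))
        (by linarith)
    smooth := hwS
    le_sup := fun y hy => hm _ (hSU y hy)
    equation := fun y hy => exists_eigenvalueVector_of_solves hf hn hmet
      (hwS.of_le (by norm_num)) hy (hSt hy) (hsol _ (hSU y hy)) }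

end Local

/-! ### The interior gradient estimate -/

theorem theorem1p3 (n : ℕ) (hn : 3 ≤ n) (f : (Fin n → ℝ) → ℝ) (Γ : Set (Fin n → ℝ))
    (hfΓ : IsAdmissiblePair f Γ) (μ : ℝ) (hμ : IsMuPlus Γ μ) (hμ1 : 1 < μ)
    (K L R : ℝ) :
    ∃ C : ℝ, ∀ (H : Type u) [TopologicalSpace H]
      (I : ModelWithCorners ℝ (EuclideanSpace ℝ (Fin n)) H)
      (M : Type v) [TopologicalSpace M] [T2Space M] [ChartedSpace H M] [IsManifold I ∞ M]
      [RiemannianBundle (fun x : M => TangentSpace I x)]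
      [IsContMDiffRiemannianBundle I ∞ (EuclideanSpace ℝ (Fin n))
        (fun x : M => TangentSpace I x)]
      (p : M) (r : ℝ) (φ : OpenPartialHomeomorph M (EuclideanSpace ℝ (Fin n)))
      (τ : ℝ) (ψ w : M → ℝ),
      IsInteriorBall I p r → r ≤ R →
      IsCoordinateChart I φ → riemannianBall I p r ⊆ φ.source →
      MetricC3Bound I φ (riemannianBall I p r) K →
      0 < τ → τ ≤ 1 →
      ContMDiff I 𝓘(ℝ, ℝ) ∞ ψ → (∀ x, 0 < ψ x) →
      (∀ x ∈ riemannianBall I p r, ψ x ≤ L ∧ gradNorm I ψ x ≤ L) →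
      ContMDiffOn I 𝓘(ℝ, ℝ) 3 w (riemannianBall I p r) →
      SolvesConformalEquation I φ f Γ τ ψ w (riemannianBall I p r) →
      BddAbove (w '' riemannianBall I p r) →
      ∀ x ∈ riemannianBall I p (r / 2),
        gradNorm I w x ≤ C * (r⁻¹ + Real.exp (sSup (w '' riemannianBall I p r))) := by
  have hn0 : 0 < n := by omega
  obtain ⟨B, hB, hbound⟩ := exists_curvature_bound n (max K 1)
  have hB0 : 0 < B := by linarith
  obtain ⟨Λ, hΛ1, hΛ⟩ := hfΓ.exists_ball_bound hn0 hμ hμ1 hB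
    (mul_nonneg hB0.le (le_max_right L 0))
  set D : ℝ := max K 1 with hD
  have hD1 : 1 ≤ D := le_max_right _ _
  have hnD : (0 : ℝ) < n * D := mul_pos (by exact_mod_cast hn0) (by linarith)
  have hnB : (0 : ℝ) < n * B := mul_pos (by exact_mod_cast hn0) hB0
  -- The factor nB converts the Euclidean gradient to the Riemannian one, 8nD comes from 2/s =
  -- 8nD/r, and |R| absorbs the additive 1 through 1 ≤ |R|/r.
  refine ⟨n * B * (Λ * (|R| + 8 * (n * D) + 1)), ?_⟩
  intro H _ I M _ _ _ _ _ _ p r φ τ ψ w hball hrR hφ hsub hK hτ hτ1 hψ hψ0 hψL hw hsol hbdd x hx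
  have hr := hball.radius_pos
  have hKD : ∀ z ∈ riemannianBall I p r, ∀ i j, |(metricCoeff I φ (φ z))⁻¹ i j| ≤ D ∧
      ∀ k : ℕ, k ≤ 3 → ‖iteratedFDeriv ℝ k (fun y => metricCoeff I φ y i j) (φ z)‖ ≤ D :=
    fun z hz i j => ⟨(hK z hz i j).1.trans (le_max_left _ _),
      fun k hk => ((hK z hz i j).2 k hk).trans (le_max_left _ _)⟩
  have hcontain := hball.coordinate_ball_subset hφ hsub hD1 hn0 (fun z hz i => by
    have := (hKD z hz i i).2 0 (by norm_num)
    rwa [norm_iteratedFDeriv_zero, Real.norm_eq_abs] at this) hx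
  set s : ℝ := r / (4 * (n * D)) with hs
  have hs0 : 0 < s := by positivity
  have hbd := hbound (metricCoeff I φ) (Metric.ball (φ x) s)
    (hφ.isMetricOn Metric.isOpen_ball (hcontain.trans inter_subset_left)) (fun y hy i j => by
      have := hKD (φ.symm y) (hcontain hy).2 i j
      rwa [φ.right_inv (hcontain hy).1] at this)
  have hloc := isLocalSolution_of_solves hfΓ hn hB hφ
    Metric.isOpen_ball (hcontain.trans inter_subset_left) (fun y hy => (hcontain hy).2) hbd
    hτ hτ1 hψ hψ0 hψL hw hsol (fun z hz => le_csSup hbdd (mem_image_of_mem w hz))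
  set m := sSup (w '' riemannianBall I p r)
  have hest := hΛ τ m _ _ _ _ _ (φ x) s hs0 hloc
  have hx0 : φ x ∈ Metric.ball (φ x) s := Metric.mem_ball_self hs0
  have hxr : x ∈ riemannianBall I p r :=
    lt_of_lt_of_le hx (ENNReal.ofReal_le_ofReal (half_le_self hr.le))
  have hxx : φ.symm (φ x) = x := φ.left_inv (hsub hxr)
  have hgrad := hφ.gradNorm_le (h := w) (hcontain hx0).1 (by
    rw [hxx]
    exact ((hw x hxr).contMDiffAt ((isOpen_riemannianBall p r).mem_nhds hxr)).mdifferentiableAt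
      (by norm_num)) hB (fun i => (hbd.2.2.1 i i _ hx0).2.1)
  rw [hxx] at hgrad
  refine hgrad.trans ?_
  rw [mul_assoc ((n : ℝ) * B)]
  refine mul_le_mul_of_nonneg_left (hest.trans ?_) hnB.le
  rw [mul_assoc]
  refine mul_le_mul_of_nonneg_left ?_ (by linarith)
  have e1 : 2 / s = 8 * (n * D) * r⁻¹ := by
    rw [hs]
    field_simp
    norm_num
  have e2 : 1 ≤ |R| * r⁻¹ := by
    rw [← div_eq_mul_inv, one_le_div hr]
    exact hrR.trans (le_abs_self R)
  have e3 : 0 < r⁻¹ := by positivity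
  have e4 := Real.exp_pos m
  rw [e1]
  nlinarith [mul_nonneg (abs_nonneg R) e4.le, mul_pos hnD e4]
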